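/- Let $(X,\mathsf d)$ be a complete separable metric space and $\mathfrak m\ge 0$ a Borel measure on $X$ that is finite on bounded sets. **Sobolev space.** Let $\mathrm{LIP}_{bs}(X)$ be the set of real-valued Lipschitz functions on $X$ with bounded support, and for such $u$ let $\mathrm{lip}(u)(x)=\limsup_{y\to x}|u(y)-u(x)|/\mathsf d(y,x)$ be its slope ($0$ if $x$ is isolated). For $f\in L^2(\mathfrak m)$ the Cheeger energy is $$\mathrm E_{\mathrm{Ch}}(f)=\inf\Big\{\liminf_{n}\tfrac12\int \mathrm{lip}^2(u_n)\,d\mathfrak m \;:\; (u_n)_n\subseteq\mathrm{LIP}_{bs}(X),\ u_n\to f \text{ in } L^2(\mathfrak m)\Big\},$$ and $W^{1,2}(X)$ consists of those $f\in L^2(\mathfrak m)$ for which there are $u_n\in\mathrm{LIP}_{bs}(X)$ with $u_n\to f$ in $L^2(\mathfrak m)$ and $\liminf_n\int\mathrm{lip}^2(u_n)\,d\mathfrak m<\infty$; its norm is $\|f\|_{W^{1,2}}=(\|f\|_{L^2(\mathfrak m)}^2+2\mathrm E_{\mathrm{Ch}}(f))^{1/2}$. For $f\in W^{1,2}(X)$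 the minimal relaxed slope $|Df|\in L^2(\mathfrak m)$ is the ($\mathfrak m$-a.e. unique) strong $L^2(\mathfrak m)$-limit of slopes $\mathrm{lip}(u_n)$ of some sequence $(u_n)_n\subseteq \mathrm{LIP}_{bs}(X)$ with $u_n\to f$ in $L^2(\mathfrak m)$ that satisfies $\mathrm E_{\mathrm{Ch}}(f)=\frac12\int|Df|^2\,d\mathfrak m$. The space $(X,\mathsf d,\mathfrak m)$ is infinitesimally Hilbertian if $W^{1,2}(X)$ is a Hilbert space, i.e. its norm satisfies the parallelogram rule; in this case, for $f,g\in W^{1,2}(X)$, the pointwise scalar product of the gradients is $$\langle\nabla g,\nabla f\rangle=\tfrac12\big(|D(g+f)|^2-|Dg|^2-|Df|^2\big)\in L^1(\mathfrak m).$$ **Test plans.** Let $C([0,1],X)$ carry the supremum distance, and let $\mathrm e_t(\gamma)=\gamma_t$. A curve $\gamma\in C([0,1],X)$ is absolutely continuous if there is $h\in L^1(0,1)$ with $\mathsf d(\gamma_t,\gamma_s)\le\int_s^t h(r)\,dr$ for all $s<t$; its metric speed is $|\dot\gamma_t|=\lim_{s\to t}\mathsf d(\gamma_s,\gamma_t)/|s-t|$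 ($0$ where the limit does not exist), and $\gamma\in AC^2$ if moreover $|\dot\gamma|\in L^2(0,1)$. For $t\in(0,1]$ put $\mathrm E_{2,t}(\gamma)=t\big(\frac1t\int_0^t|\dot\gamma_s|^2ds\big)^{1/2}$ if $\gamma\in AC^2$ and $\mathrm E_{2,t}(\gamma)=+\infty$ otherwise. A $2$-test plan is a Borel probability measure $\pi$ on $C([0,1],X)$ such that $(\mathrm e_t)_\#\pi\le C\mathfrak m$ for all $t\in[0,1]$ and some constant $C>0$, and $\int \mathrm E_{2,1}^2\,d\pi<\infty$. It $2$-represents the gradient of $f\in W^{1,2}(X)$ if, as $t\searrow0$, $$\frac{f\circ\mathrm e_t-f\circ\mathrm e_0}{\mathrm E_{2,t}}\to|Df|\circ\mathrm e_0\quad\text{and}\quad\frac{\mathrm E_{2,t}}{t}\to|Df|\circ\mathrm e_0\qquad\text{strongly in }L^2(\pi)$$ (with the convention $0/0=0$). **Statement.** Let $(X,\mathsf d,\mathfrak m)$ be infinitesimally Hilbertian, let $f\in W^{1,2}(X)$, and let $\pi$ be a $2$-test plan that $2$-represents the gradient of $f$. Then for every $g\in W^{1,2}(X)$ $$\frac{g\circ\mathrm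 e_t-g\circ\mathrm e_0}{t}\rightharpoonup\langle\nabla g,\nabla f\rangle\circ\mathrm e_0\qquad\text{weakly in }L^1(\pi)\text{ as }t\searrow0;$$ that is, all these functions belong to $L^1(\pi)$ and for every $h\in L^\infty(\pi)$ $$\lim_{t\searrow0}\int h\,\frac{g\circ\mathrm e_t-g\circ\mathrm e_0}{t}\,d\pi=\int h\,\langle\nabla g,\nabla f\rangle\circ\mathrm e_0\,d\pi .$$ -/

import Mathlib

open MeasureTheory Filter Topology Set
open scoped ENNReal NNReal unitInterval

noncomputable section

namespace MetricSobolev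

section Sobolev

variable {X : Type*} [MetricSpace X] [MeasurableSpace X]

/-- The measure `m` is finite on bounded sets. -/
def BoundedlyFinite (m : Measure X) : Prop :=
  ∀ s : Set X, Bornology.IsBounded s → m s < ∞

/-- Lipschitz functions with bounded support. -/
def IsLipBs (u : X → ℝ) : Prop :=
  (∃ K : ℝ≥0, LipschitzWith K u) ∧ Bornology.IsBounded (Function.support u)

/-- The slope `lip u x = limsup_{y → x} |u y - u x| / d(y, x)`. At an isolated point the punctured
neighbourhood filter is `⊥`, so the upper limit, taken in `[0, ∞]`, is `0`. -/
def lip (u : X → ℝ) (x : X) : ℝ≥0∞ :=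
  limsup (fun y => edist (u y) (u x) / edist y x) (𝓝[≠] x)

/-- `u` is a sequence of Lipschitz functions with bounded support converging to `f` in `L²(m)`. -/
def ApproximatesL2 (m : Measure X) (f : X → ℝ) (u : ℕ → X → ℝ) : Prop :=
  (∀ n, IsLipBs (u n)) ∧ Tendsto (fun n => eLpNorm (fun x => u n x - f x) 2 m) atTop (𝓝 0)

/-- `f` is (a representative of) an element of the Sobolev space `W^{1,2}`. -/
def MemW12 (m : Measure X) (f : X → ℝ) : Prop :=
  MemLp f 2 m ∧ ∃ u : ℕ → X → ℝ, ApproximatesL2 m f u ∧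
    liminf (fun n => ∫⁻ x, lip (u n) x ^ 2 ∂m) atTop < ∞

/-- The Cheeger `2`-energy. -/
def cheegerEnergy (m : Measure X) (f : X → ℝ) : ℝ≥0∞ :=
  ⨅ (u : ℕ → X → ℝ) (_ : ApproximatesL2 m f u),
    liminf (fun n => 2⁻¹ * ∫⁻ x, lip (u n) x ^ 2 ∂m) atTop

/-- The norm of `W^{1,2}`, i.e. `(‖f‖²_{L²} + 2 E_Ch(f))^{1/2}`. -/
def w12Norm (m : Measure X) (f : X → ℝ) : ℝ :=
  Real.sqrt ((eLpNorm f 2 m).toReal ^ 2 + 2 * (cheegerEnergy m f).toReal)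

/-- The norm of `W^{1,2}` is a Hilbert norm (it satisfies the parallelogram rule). -/
def InfinitesimallyHilbertian (m : Measure X) : Prop :=
  ∀ f g : X → ℝ, MemW12 m f → MemW12 m g →
    w12Norm m (f + g) ^ 2 + w12Norm m (f - g) ^ 2 = 2 * w12Norm m f ^ 2 + 2 * w12Norm m g ^ 2

/-- `G` is the minimal `2`-relaxed slope of `f`: it is a strong `L²(m)`-limit of slopes of Lipschitz
functions with bounded support that converge to `f` in `L²(m)`, and it realises the
Cheeger energy of `f`. For `f ∈ W^{1,2}` such a `G` exists and is unique up to `m`-a.e. equality. -/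
def IsMinimalRelaxedSlope (m : Measure X) (f G : X → ℝ) : Prop :=
  MemLp G 2 m ∧
  (∃ u : ℕ → X → ℝ, ApproximatesL2 m f u ∧
    Tendsto (fun n => eLpNorm (fun x => (lip (u n) x).toReal - G x) 2 m) atTop (𝓝 0)) ∧
  cheegerEnergy m f = 2⁻¹ * ∫⁻ x, ‖G x‖ₑ ^ 2 ∂m

open Classical in
/-- (A representative of) the minimal `2`-relaxed slope `|Df|`. -/
def relaxedSlope (m : Measure X) (f : X → ℝ) : X → ℝ :=
  if h : ∃ G : X → ℝ, IsMinimalRelaxedSlope m f G then h.choose else 0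

/-- The pointwise scalar product `⟨∇g, ∇f⟩`, by polarisation of the pointwise norm
`|∇f| = |Df|`. -/
def gradInner (m : Measure X) (g f : X → ℝ) (x : X) : ℝ :=
  (relaxedSlope m (g + f) x ^ 2 - relaxedSlope m g x ^ 2 - relaxedSlope m f x ^ 2) / 2

end Sobolev

section Curves

variable {X : Type*} [MetricSpace X]

/-- Absolutely continuous curves. -/
def IsAC (γ : C(I, X)) : Prop :=
  ∃ g : I → ℝ, Integrable g ∧ ∀ s t : I, s < t → dist (γ t) (γ s) ≤ ∫ r in Icc s t, g r

open Classical in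
/-- The metric speed `lim_{s → t} d(γ s, γ t) / |s - t|`, declared to be `0` where the limit does
not exist. -/
def metricSpeed (γ : C(I, X)) (t : I) : ℝ :=
  if h : ∃ v : ℝ, Tendsto (fun s : I => dist (γ s) (γ t) / dist s t) (𝓝[≠] t) (𝓝 v)
  then h.choose else 0

/-- `2`-absolutely continuous curves. -/
def IsAC2 (γ : C(I, X)) : Prop :=
  IsAC γ ∧ MemLp (metricSpeed γ) 2 volume

open Classical in
/-- The `2`-energy functional `E_{2,t}`. -/
def energy (t : I) (γ : C(I, X)) : ℝ≥0∞ :=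
  if IsAC2 γ then
    ENNReal.ofReal t * (⨍⁻ s in Icc 0 t, ENNReal.ofReal (metricSpeed γ s) ^ 2 ∂volume) ^ (1 / 2 : ℝ)
  else ∞

end Curves

section Plans

variable {X : Type*} [MetricSpace X] [MeasurableSpace X] [MeasurableSpace C(I, X)]

/-- `2`-test plans. -/
structure IsTestPlan (m : Measure X) (π : Measure C(I, X)) : Prop where
  isProbabilityMeasure : IsProbabilityMeasure π
  compression : ∃ C : ℝ≥0, ∀ t : I, π.map (fun γ => γ t) ≤ C • m
  kineticEnergy : ∫⁻ γ, energy 1 γ ^ 2 ∂π < ∞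

/-- The plan `π` `2`-represents the gradient of `f`. In the first condition `0 / 0 = 0`: if
`E_{2,t}(γ) = 0` then `γ` is constant on `[0, t]`. -/
structure RepresentsGradient (m : Measure X) (π : Measure C(I, X)) (f : X → ℝ) : Prop where
  quotient : Tendsto (fun t : I => eLpNorm (fun γ : C(I, X) =>
    (f (γ t) - f (γ 0)) / (energy t γ).toReal - relaxedSlope m f (γ 0)) 2 π) (𝓝[>] 0) (𝓝 0)
  speed : Tendsto (fun t : I => eLpNorm (fun γ : C(I, X) =>
    (energy t γ).toReal / (t : ℝ) - relaxedSlope m f (γ 0)) 2 π) (𝓝[>] 0) (𝓝 0)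

end Plans

/-- Weak convergence in `L¹(μ)` of the family `F` to `G` along the filter `l`. -/
def WeakTendstoL1 {Ω ι : Type*} [MeasurableSpace Ω] (μ : Measure Ω) (F : ι → Ω → ℝ) (l : Filter ι)
    (G : Ω → ℝ) : Prop :=
  (∀ i, Integrable (F i) μ) ∧ Integrable G μ ∧
    ∀ h : Ω → ℝ, MemLp h ∞ μ →
      Tendsto (fun i => ∫ ω, h ω * F i ω ∂μ) l (𝓝 (∫ ω, h ω * G ω ∂μ))

end MetricSobolev

end

/-!
The key point is the pointwise parallelogram rule for `|Df|`. Let `fₙ`, `gₙ` be compositions of `f`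
and `g` with a sawtooth of slope `±1` and height tending to `0`. By locality of the relaxed slope,
`|D(fₙ ± gₙ)|` is almost everywhere `|D(f + g)|` or `|D(f - g)|`, while the functions themselves are
uniformly small. Multiplying by a Lipschitz weight `ψ` therefore costs nothing in the limit, and the
integral parallelogram rule for `ψ fₙ` and `ψ gₙ` becomes the one for `ψ² |D ·|²`. Since `ψ` is
arbitrary, `|D(f + c g)|² = |Df|² + 2 c ⟨∇g, ∇f⟩ + c² |Dg|²` almost everywhere for `c = 1 / k`.

Along a curve, the upper gradient inequality for `lip u` and Young's inequality give
`u(γ_t) - u(γ_0) ≤ ½ ∫₀ᵗ lip(u)²(γ_s) ds + E_{2,t}(γ)² / (2 t)`, which passes to `f + c g` after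
integration against a weight `h ≥ 0`. Dividing by `t`, letting `t → 0` and subtracting the limit for
`f`, where the two inequalities are equalities, bounds the upper limit of the integrated difference
quotients of `g` by `∫ h ⟨∇g, ∇f⟩ + O(c)`. Let `c → 0`, and replace `g` by `-g` for the lower limit.
-/

namespace MetricSobolev

section Slope

variable {X : Type*} [MetricSpace X] {u v : X → ℝ} {x : X}

/-- The slope `lip u` as a real-valued function; it is only meaningful where `lip u` is finite, in
particular for Lipschitz `u`. -/
noncomputable def rlip (u : X → ℝ) (x : X) : ℝ := (lip u x).toReal

lemma rlip_nonneg (u : X → ℝ) (x : X) : 0 ≤ rlip u x := ENNReal.toReal_nonneg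

lemma lip_le_of_lipschitzWith {K : ℝ≥0} (hu : LipschitzWith K u) (x : X) : lip u x ≤ K :=
  limsup_le_of_le (by isBoundedDefault) <| Eventually.of_forall fun y =>
    ENNReal.div_le_of_le_mul (hu y x)

lemma lip_ne_top {K : ℝ≥0} (hu : LipschitzWith K u) (x : X) : lip u x ≠ ∞ :=
  ((lip_le_of_lipschitzWith hu x).trans_lt ENNReal.coe_lt_top).ne

lemma rlip_le_of_lipschitzWith {K : ℝ≥0} (hu : LipschitzWith K u) (x : X) : rlip u x ≤ K :=
  ENNReal.toReal_mono ENNReal.coe_ne_top (lip_le_of_lipschitzWith hu x)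

lemma eventually_edist_div_lt (hu : lip u x ≠ ∞) {ε : ℝ≥0∞} (hε : ε ≠ 0) :
    ∀ᶠ y in 𝓝[≠] x, edist (u y) (u x) / edist y x < lip u x + ε :=
  eventually_lt_of_limsup_lt (ENNReal.lt_add_right hu hε) (by isBoundedDefault)

lemma eventually_abs_sub_le_rlip (hu : lip u x ≠ ∞) {ε : ℝ} (hε : 0 < ε) :
    ∀ᶠ y in 𝓝 x, |u y - u x| ≤ (rlip u x + ε) * dist y x := by
  have h := eventually_edist_div_lt hu (ENNReal.ofReal_pos.2 hε).ne'
  rw [eventually_nhdsWithin_iff] at h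
  filter_upwards [h] with y hy
  rcases eq_or_ne y x with rfl | hne
  · simp
  have hlt := ENNReal.toReal_strict_mono (by finiteness) (hy hne)
  rw [ENNReal.toReal_div, edist_dist, edist_dist, ENNReal.toReal_ofReal dist_nonneg,
    ENNReal.toReal_ofReal dist_nonneg, ENNReal.toReal_add hu ENNReal.ofReal_ne_top,
    ENNReal.toReal_ofReal hε.le, div_lt_iff₀ (dist_pos.2 hne), Real.dist_eq] at hlt
  exact hlt.le

/-- The weight is frozen at `x` because it is continuous there: this is the mechanism behind both
the Leibniz rule and the chain rule. -/
lemma lip_le_mul_of_abs_sub_le {F a : X → ℝ} (hu : lip u x ≠ ∞) (ha : ContinuousAt a x)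
    (h : ∀ y, |F y - F x| ≤ a y * |u y - u x|) : lip F x ≤ ENNReal.ofReal (a x) * lip u x := by
  have hlim : limsup (fun y => ENNReal.ofReal (a y)) (𝓝[≠] x) ≤ ENNReal.ofReal (a x) :=
    (limsup_le_limsup_of_le nhdsWithin_le_nhds).trans
      (ENNReal.tendsto_ofReal ha.tendsto).limsup_eq.le
  calc lip F x
      ≤ limsup ((fun y => ENNReal.ofReal (a y)) *
          fun y => edist (u y) (u x) / edist y x) (𝓝[≠] x) := by
        refine limsup_le_limsup (Eventually.of_forall fun y => ?_)
        simp only [Pi.mul_apply, ← mul_div_assoc, edist_dist (F y), edist_dist (u y), Real.dist_eq,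
          ← ENNReal.ofReal_mul' (abs_nonneg (u y - u x))]
        gcongr
        exact h y
    _ ≤ _ := ENNReal.limsup_mul_le' (.inr hu) (.inl (hlim.trans_lt ENNReal.ofReal_lt_top).ne)
    _ ≤ ENNReal.ofReal (a x) * lip u x := mul_le_mul' hlim le_rfl

lemma rlip_le_mul_of_abs_sub_le {F a : X → ℝ} (hu : lip u x ≠ ∞) (ha : ContinuousAt a x)
    (hax : 0 ≤ a x) (h : ∀ y, |F y - F x| ≤ a y * |u y - u x|) : rlip F x ≤ a x * rlip u x := by
  have := ENNReal.toReal_mono (by finiteness) (lip_le_mul_of_abs_sub_le hu ha h)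
  rwa [ENNReal.toReal_mul, ENNReal.toReal_ofReal hax] at this

lemma lip_add_le (u v : X → ℝ) (x : X) : lip (u + v) x ≤ lip u x + lip v x := by
  refine ENNReal.le_of_forall_pos_le_add fun ε hε hfin => limsup_le_of_le (by isBoundedDefault) ?_
  have hε2 : (ε / 2 : ℝ≥0∞) ≠ 0 := by simpa using hε.ne'
  obtain ⟨hu, hv⟩ := ENNReal.add_ne_top.1 hfin.ne
  filter_upwards [eventually_edist_div_lt hu hε2, eventually_edist_div_lt hv hε2] with y huy hvy
  calc edist (u y + v y) (u x + v x) / edist y x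
      ≤ (edist (u y) (u x) + edist (v y) (v x)) / edist y x := by
        gcongr
        exact edist_add_add_le ..
    _ = edist (u y) (u x) / edist y x + edist (v y) (v x) / edist y x := ENNReal.add_div
    _ ≤ (lip u x + ε / 2) + (lip v x + ε / 2) := by gcongr
    _ = lip u x + lip v x + ε := by rw [add_add_add_comm, ENNReal.add_halves]

lemma rlip_add_le (hu : lip u x ≠ ∞) (hv : lip v x ≠ ∞) :
    rlip (u + v) x ≤ rlip u x + rlip v x := by
  rw [rlip, rlip, rlip, ← ENNReal.toReal_add hu hv]
  exact ENNReal.toReal_mono (by finiteness) (lip_add_le u v x)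

lemma rlip_const_mul_le (hu : lip u x ≠ ∞) (c : ℝ) :
    rlip (fun y => c * u y) x ≤ |c| * rlip u x :=
  rlip_le_mul_of_abs_sub_le hu (a := fun _ => |c|) continuousAt_const (abs_nonneg c)
    fun y => by rw [← mul_sub, abs_mul]

lemma rlip_average_le (hu : lip u x ≠ ∞) (hv : lip v x ≠ ∞) :
    rlip (fun y => 2⁻¹ * (u y + v y)) x ≤ 2⁻¹ * (rlip u x + rlip v x) := by
  have hadd : lip (u + v) x ≠ ∞ := ((lip_add_le u v x).trans_lt (by finiteness)).ne
  calc rlip (fun y => 2⁻¹ * (u y + v y)) x ≤ |2⁻¹| * rlip (u + v) x := rlip_const_mul_le hadd _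
    _ ≤ 2⁻¹ * (rlip u x + rlip v x) := by
      rw [abs_of_pos (by norm_num)]
      gcongr
      exact rlip_add_le hu hv

lemma rlip_glue_le {ψ : X → ℝ} (hu : lip u x ≠ ∞) (hv : lip v x ≠ ∞) (hψx : lip ψ x ≠ ∞)
    (hψ : ContinuousAt ψ x) (h0 : ∀ y, 0 ≤ ψ y) (h1 : ∀ y, ψ y ≤ 1) :
    rlip (fun y => (1 - ψ y) * u y + ψ y * v y) x ≤
      (1 - ψ x) * rlip u x + ψ x * rlip v x + |v x - u x| * rlip ψ x := by
  set U : X → ℝ := fun y => (1 - ψ y) * (u y - u x) with hU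
  set V : X → ℝ := fun y => ψ y * (v y - v x) with hV
  set W : X → ℝ := fun y => (v x - u x) * ψ y + u x with hW
  have hUa : ∀ y, |U y - U x| ≤ (1 - ψ y) * |u y - u x| := fun y => by
    simp [hU, abs_mul, abs_of_nonneg (sub_nonneg.2 (h1 y))]
  have hVa : ∀ y, |V y - V x| ≤ ψ y * |v y - v x| := fun y => by
    simp [hV, abs_mul, abs_of_nonneg (h0 y)]
  have hWa : ∀ y, |W y - W x| ≤ |v x - u x| * |ψ y - ψ x| := fun y => by
    simp [hW, ← mul_sub, abs_mul]
  have h1ψ : ContinuousAt (fun y => 1 - ψ y) x := continuousAt_const.sub hψ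
  have hUx : lip U x ≠ ∞ :=
    ((lip_le_mul_of_abs_sub_le hu h1ψ hUa).trans_lt (by finiteness)).ne
  have hVx : lip V x ≠ ∞ := ((lip_le_mul_of_abs_sub_le hv hψ hVa).trans_lt (by finiteness)).ne
  have hWx : lip W x ≠ ∞ :=
    ((lip_le_mul_of_abs_sub_le hψx continuousAt_const hWa).trans_lt (by finiteness)).ne
  have hUVx : lip (U + V) x ≠ ∞ := ((lip_add_le U V x).trans_lt (by finiteness)).ne
  have hsplit : (fun y => (1 - ψ y) * u y + ψ y * v y) = U + V + W := by
    ext y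
    simp only [hU, hV, hW, Pi.add_apply]
    ring
  calc rlip (fun y => (1 - ψ y) * u y + ψ y * v y) x = rlip (U + V + W) x := by rw [hsplit]
    _ ≤ rlip U x + rlip V x + rlip W x :=
      (rlip_add_le hUVx hWx).trans (add_le_add_left (rlip_add_le hUx hVx) _)
    _ ≤ _ := by
      gcongr
      · exact rlip_le_mul_of_abs_sub_le hu h1ψ (sub_nonneg.2 (h1 x)) hUa
      · exact rlip_le_mul_of_abs_sub_le hv hψ (h0 x) hVa
      · exact rlip_le_mul_of_abs_sub_le hψx continuousAt_const (abs_nonneg _) hWa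

lemma rlip_comp_le {φ : ℝ → ℝ} {φ' : ℝ} (hu : lip u x ≠ ∞) (huc : ContinuousAt u x)
    (hφ : HasDerivAt φ φ' (u x)) : rlip (fun y => φ (u y)) x ≤ |φ'| * rlip u x := by
  have hslope : ContinuousAt (fun y => |dslope φ (u x) (u y)|) x :=
    (continuousAt_dslope_same.2 hφ.differentiableAt).comp' huc |>.abs
  have := rlip_le_mul_of_abs_sub_le (F := fun y => φ (u y)) hu hslope (abs_nonneg _) fun y => by
    rw [← abs_mul, mul_comm, ← smul_eq_mul, sub_smul_dslope]
  rwa [dslope_same, hφ.deriv] at this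

lemma rlip_comp_lipschitz_le {φ : ℝ → ℝ} (hu : lip u x ≠ ∞) (hφ : LipschitzWith 1 φ) :
    rlip (fun y => φ (u y)) x ≤ rlip u x := by
  have := rlip_le_mul_of_abs_sub_le (F := fun y => φ (u y)) (a := fun _ => 1) hu
    continuousAt_const zero_le_one
    fun y => by simpa [Real.dist_eq] using hφ.dist_le_mul (u y) (u x)
  simpa using this

lemma measurable_limsup_nhdsNE {P Y : Type*} [TopologicalSpace P] [MeasurableSpace P]
    [OpensMeasurableSpace P] [MetricSpace Y] {a : P → Y} (ha : Continuous a)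
    {k : P → Y → ℝ≥0∞} (hk : ∀ p y, y ≠ a p → ContinuousAt (fun p => k p y) p) :
    Measurable fun p => limsup (k p) (𝓝[≠] (a p)) := by
  have hbasis : ∀ p, limsup (k p) (𝓝[≠] (a p)) =
      ⨅ n : ℕ, ⨆ y ∈ Metric.ball (a p) (1 / ((n : ℝ) + 1)) ∩ {a p}ᶜ, k p y := by
    intro p
    rw [(nhdsWithin_hasBasis Metric.nhds_basis_ball_inv_nat_succ {a p}ᶜ).limsup_eq_iInf_iSup]
    simp only [iInf_pos]
  simp_rw [hbasis]
  refine Measurable.iInf fun n => LowerSemicontinuous.measurable fun p c hc => ?_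
  simp only [lt_iSup_iff] at hc ⊢
  obtain ⟨y, ⟨hball, hne⟩, hcy⟩ := hc
  have hdist : ContinuousAt (fun q => dist y (a q)) p := by fun_prop
  filter_upwards [hdist.eventually_lt continuousAt_const hball,
    ha.continuousAt.eventually_ne (Ne.symm hne), (hk p y hne).eventually_const_lt hcy]
    with q hqball hqne hqc
  exact ⟨y, ⟨hqball, hqne.symm⟩, hqc⟩

lemma measurable_lip [MeasurableSpace X] [OpensMeasurableSpace X] (hu : Continuous u) :
    Measurable (lip u) := by
  refine measurable_limsup_nhdsNE (a := id) continuous_id fun p y hne => ?_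
  have hnum : ContinuousAt (fun p => edist (u y) (u p)) p := by fun_prop
  have hden : ContinuousAt (fun p => edist y p) p := by fun_prop
  exact ENNReal.Tendsto.div hnum (Or.inr (by simpa using hne)) hden (Or.inr (edist_ne_top _ _))

lemma measurable_rlip [MeasurableSpace X] [OpensMeasurableSpace X] (hu : Continuous u) :
    Measurable (rlip u) := (measurable_lip hu).ennreal_toReal

end Slope

section TendstoLp

variable {α ι E F : Type*} [MeasurableSpace α] [NormedAddCommGroup E]
  [NormedAddCommGroup F] {μ : Measure α} {p q r : ℝ≥0∞} {l : Filter ι}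

/-- Strong convergence in `L^p(μ)` of a family of measurable functions to an element of `L^p(μ)`.
Members of the family may lie outside `L^p(μ)` as long as they do so before the limit. -/
structure TendstoLp (p : ℝ≥0∞) (μ : Measure α) (u : ι → α → E) (l : Filter ι) (f : α → E) :
    Prop where
  aestronglyMeasurable : ∀ i, AEStronglyMeasurable (u i) μ
  memLp : MemLp f p μ
  tendsto : Tendsto (fun i => eLpNorm (fun x => u i x - f x) p μ) l (𝓝 0)

lemma tendstoLp_const {f : α → E} (hf : MemLp f p μ) (l : Filter ι) :
    TendstoLp p μ (fun _ => f) l f :=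
  ⟨fun _ => hf.1, hf, by simp [tendsto_const_nhds]⟩

namespace TendstoLp

variable {u v : ι → α → E} {f g : α → E}

lemma comp_tendsto {κ : Type*} {k : Filter κ} {s : κ → ι} (h : TendstoLp p μ u l f)
    (hs : Tendsto s k l) : TendstoLp p μ (fun i => u (s i)) k f :=
  ⟨fun i => h.1 (s i), h.2, h.3.comp hs⟩

lemma mono {v : ι → α → F} {g : α → F} (h : TendstoLp p μ u l f)
    (hv : ∀ i, AEStronglyMeasurable (v i) μ) (hg : MemLp g p μ)
    (hle : ∀ i, ∀ᵐ x ∂μ, ‖v i x - g x‖ ≤ ‖u i x - f x‖) :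
    TendstoLp p μ v l g :=
  ⟨hv, hg, tendsto_of_tendsto_of_tendsto_of_le_of_le tendsto_const_nhds h.3 (fun _ => zero_le)
    fun i => eLpNorm_mono_ae (hle i)⟩

lemma congr (h : TendstoLp p μ u l f) (hu : ∀ i, u i =ᵐ[μ] v i) (hf : f =ᵐ[μ] g) :
    TendstoLp p μ v l g :=
  h.mono (fun i => (h.1 i).congr (hu i)) (h.2.ae_eq hf) fun i => by
    filter_upwards [hu i, hf] with x h1 h2 using by rw [h1, h2]

lemma comp_lipschitz {φ : E → F} (h : TendstoLp p μ u l f)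
    (hφ : LipschitzWith 1 φ) (h0 : φ 0 = 0) :
    TendstoLp p μ (fun i x => φ (u i x)) l (fun x => φ (f x)) :=
  h.mono (fun i => hφ.continuous.comp_aestronglyMeasurable (h.1 i)) (hφ.comp_memLp h0 h.2)
    fun i => ae_of_all _ fun x => by
      simpa only [dist_eq_norm, NNReal.coe_one, one_mul] using hφ.dist_le_mul (u i x) (f x)

lemma add (hu : TendstoLp p μ u l f) (hv : TendstoLp p μ v l g) :
    TendstoLp p μ (fun i x => u i x + v i x) l (fun x => f x + g x) := by
  refine ⟨fun i => (hu.1 i).add (hv.1 i), hu.2.add hv.2, ?_⟩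
  have hsum := ENNReal.Tendsto.const_mul (a := ENNReal.LpAddConst p) (hu.3.add hv.3)
    (Or.inr (ENNReal.LpAddConst_lt_top p).ne)
  rw [add_zero, mul_zero] at hsum
  refine tendsto_of_tendsto_of_tendsto_of_le_of_le tendsto_const_nhds hsum (fun _ => zero_le)
    fun i => ?_
  simp only [add_sub_add_comm]
  exact eLpNorm_add_le' ((hu.1 i).sub hu.2.1) ((hv.1 i).sub hv.2.1) p

lemma neg (hu : TendstoLp p μ u l f) : TendstoLp p μ (fun i x => -u i x) l (fun x => -f x) :=
  hu.mono (fun i => (hu.1 i).neg) hu.2.neg fun i => ae_of_all _ fun x => by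
    rw [← neg_sub', norm_neg]

lemma sub (hu : TendstoLp p μ u l f) (hv : TendstoLp p μ v l g) :
    TendstoLp p μ (fun i x => u i x - v i x) l (fun x => f x - g x) := by
  simpa only [sub_eq_add_neg] using hu.add hv.neg

lemma eventually_memLp (hu : TendstoLp p μ u l f) : ∀ᶠ i in l, MemLp (u i) p μ := by
  filter_upwards [hu.3.eventually_lt_const ENNReal.zero_lt_top] with i hi
  refine (MemLp.add ⟨(hu.1 i).sub hu.2.1, hi⟩ hu.2).ae_eq (ae_of_all _ fun x => ?_)
  simp only [Pi.add_apply, Pi.sub_apply, sub_add_cancel]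

lemma exists_subseq_tendsto_ae {u : ℕ → α → E} (h : TendstoLp p μ u atTop f) (hp : p ≠ 0) :
    ∃ s : ℕ → ℕ, StrictMono s ∧ ∀ᵐ x ∂μ, Tendsto (fun i => u (s i) x) atTop (𝓝 (f x)) :=
  (tendstoInMeasure_of_tendsto_eLpNorm hp h.1 h.2.1 h.3).exists_seq_tendsto_ae

lemma of_dominated {u : ℕ → α → E} {b : α → ℝ} (hp : p ≠ ∞)
    (hu : ∀ i, AEStronglyMeasurable (u i) μ) (hb : MemLp b p μ)
    (hub : ∀ i, ∀ᵐ x ∂μ, ‖u i x‖ ≤ b x)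
    (hlim : ∀ᵐ x ∂μ, Tendsto (fun i => u i x) atTop (𝓝 (f x))) : TendstoLp p μ u atTop f := by
  have hf : MemLp f p μ := by
    refine hb.mono' (aestronglyMeasurable_of_tendsto_ae atTop hu hlim) ?_
    filter_upwards [ae_all_iff.2 hub, hlim] with x hx hxlim
    exact le_of_tendsto' hxlim.norm hx
  refine ⟨hu, hf, ?_⟩
  rcases eq_or_ne p 0 with rfl | hp0
  · simp
  have hp' : 0 < p.toReal := ENNReal.toReal_pos hp0 hp
  have hdom : MemLp (fun x => ‖b x‖ + ‖f x‖) p μ := hb.norm.add hf.norm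
  have hlint : Tendsto (fun i => ∫⁻ x, ‖u i x - f x‖ₑ ^ p.toReal ∂μ) atTop
      (𝓝 (∫⁻ _, 0 ∂μ)) := by
    refine tendsto_lintegral_of_dominated_convergence'
      (fun x => ‖‖b x‖ + ‖f x‖‖ₑ ^ p.toReal)
      (fun i => ((hu i).sub hf.1).enorm.pow_const _) (fun i => ?_)
      (lintegral_rpow_enorm_lt_top_of_eLpNorm_lt_top hp0 hp hdom.2).ne ?_
    · filter_upwards [hub i] with x hx
      gcongr
      rw [enorm_le_iff_norm_le, Real.norm_of_nonneg (by positivity)]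
      exact (norm_sub_le _ _).trans (add_le_add_left (hx.trans (Real.le_norm_self _)) _)
    · filter_upwards [hlim] with x hx
      have := (hx.sub_const (f x)).enorm.ennrpow_const p.toReal
      rwa [sub_self, enorm_zero, ENNReal.zero_rpow_of_pos hp'] at this
  have := hlint.ennrpow_const (1 / p.toReal)
  simpa only [eLpNorm_eq_lintegral_rpow_enorm_toReal hp0 hp, lintegral_zero,
    ENNReal.zero_rpow_of_pos (one_div_pos.2 hp')] using this

lemma mono_exponent [IsFiniteMeasure μ] (h : TendstoLp q μ u l f) (hpq : p ≤ q) :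
    TendstoLp p μ u l f := by
  refine ⟨h.1, h.2.mono_exponent hpq, ?_⟩
  rcases eq_or_ne p 0 with rfl | hp
  · simp [tendsto_const_nhds]
  have hexp : 0 ≤ 1 / p.toReal - 1 / q.toReal := by
    rcases eq_or_ne q ∞ with rfl | hq
    · simp
    · exact sub_nonneg.2 (one_div_le_one_div_of_le
        (ENNReal.toReal_pos hp (hpq.trans_lt hq.lt_top).ne) (ENNReal.toReal_mono hq hpq))
  have hmul := ENNReal.Tendsto.mul_const (b := μ univ ^ (1 / p.toReal - 1 / q.toReal)) h.3
    (Or.inr (ENNReal.rpow_ne_top_of_nonneg hexp (measure_ne_top μ univ)))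
  rw [zero_mul] at hmul
  exact tendsto_of_tendsto_of_tendsto_of_le_of_le tendsto_const_nhds hmul (fun _ => zero_le)
    fun i => eLpNorm_le_eLpNorm_mul_rpow_measure_univ hpq ((h.1 i).sub h.2.1)

lemma tendsto_integral [NormedSpace ℝ E] (h : TendstoLp 1 μ u l f) :
    Tendsto (fun i => ∫ x, u i x ∂μ) l (𝓝 (∫ x, f x ∂μ)) :=
  tendsto_integral_of_L1' f h.2.1
    (h.eventually_memLp.mono fun _ hi => memLp_one_iff_integrable.1 hi) h.3

end TendstoLp

end TendstoLp

section TendstoLpReal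

variable {α ι : Type*} [MeasurableSpace α] {μ : Measure α} {p q r : ℝ≥0∞} {l : Filter ι}

lemma tendsto_eLpNorm_mul_zero [ENNReal.HolderTriple p q r] {a b : ι → α → ℝ} {A : ℝ≥0∞}
    (ha : ∀ i, AEStronglyMeasurable (a i) μ) (hb : ∀ i, AEStronglyMeasurable (b i) μ)
    (hA : A ≠ ∞) (haA : Tendsto (fun i => eLpNorm (a i) p μ) l (𝓝 A))
    (hb0 : Tendsto (fun i => eLpNorm (b i) q μ) l (𝓝 0)) :
    Tendsto (fun i => eLpNorm (fun x => a i x * b i x) r μ) l (𝓝 0) := by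
  have hmul := ENNReal.Tendsto.mul haA (Or.inr ENNReal.zero_ne_top) hb0 (Or.inr hA)
  rw [mul_zero] at hmul
  have hle : ∀ i, eLpNorm (a i • b i) r μ ≤ eLpNorm (a i) p μ * eLpNorm (b i) q μ := fun i =>
    eLpNorm_smul_le_mul_eLpNorm (hb i) (ha i)
  exact tendsto_of_tendsto_of_tendsto_of_le_of_le tendsto_const_nhds hmul (fun _ => zero_le) hle

namespace TendstoLp

variable {u v : ι → α → ℝ} {f g : α → ℝ}

lemma mul [ENNReal.HolderTriple p q r] (hu : TendstoLp p μ u l f) (hv : TendstoLp q μ v l g) :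
    TendstoLp r μ (fun i x => u i x * v i x) l (fun x => f x * g x) := by
  have hdu : ∀ i, AEStronglyMeasurable (fun x => u i x - f x) μ := fun i => (hu.1 i).sub hu.2.1
  have hdv : ∀ i, AEStronglyMeasurable (fun x => v i x - g x) μ := fun i => (hv.1 i).sub hv.2.1
  have hboth : TendstoLp r μ (fun i x => (u i x - f x) * (v i x - g x)) l (fun _ => 0) :=
    ⟨fun i => (hdu i).mul (hdv i), MemLp.zero', by
      simpa only [sub_zero] using
        tendsto_eLpNorm_mul_zero hdu hdv ENNReal.zero_ne_top hu.3 hv.3⟩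
  have hleft : TendstoLp r μ (fun i x => (u i x - f x) * g x) l (fun _ => 0) :=
    ⟨fun i => (hdu i).mul hv.2.1, MemLp.zero', by
      have : ENNReal.HolderTriple q p r := .symm
      simpa only [sub_zero, mul_comm (g _)] using
        tendsto_eLpNorm_mul_zero (fun _ => hv.2.1) hdu hv.2.2.ne tendsto_const_nhds hu.3⟩
  have hright : TendstoLp r μ (fun i x => f x * (v i x - g x)) l (fun _ => 0) :=
    ⟨fun i => hu.2.1.mul (hdv i), MemLp.zero', by
      simpa only [sub_zero] using
        tendsto_eLpNorm_mul_zero (fun _ => hu.2.1) hdv hu.2.2.ne tendsto_const_nhds hv.3⟩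
  refine (((hboth.add hleft).add hright).add (tendstoLp_const (hv.2.mul hu.2) l)).congr
    (fun i => ae_of_all _ fun x => ?_) (ae_of_all _ fun x => ?_)
  · simp only [Pi.mul_apply]; ring
  · simp only [Pi.mul_apply]; ring

lemma const_mul (hu : TendstoLp p μ u l f) (c : ℝ) :
    TendstoLp p μ (fun i x => c * u i x) l (fun x => c * f x) :=
  (tendstoLp_const (memLp_top_const c) l).mul hu

lemma abs (hu : TendstoLp p μ u l f) : TendstoLp p μ (fun i x => |u i x|) l (fun x => |f x|) :=
  hu.comp_lipschitz lipschitzWith_one_norm abs_zero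

lemma ae_le {u v : ℕ → α → ℝ} (hu : TendstoLp p μ u atTop f) (hv : TendstoLp q μ v atTop g)
    (hp : p ≠ 0) (hq : q ≠ 0) (hle : ∀ i, u i ≤ᵐ[μ] v i) : f ≤ᵐ[μ] g := by
  obtain ⟨s, hs, hsx⟩ := hu.exists_subseq_tendsto_ae hp
  obtain ⟨r, hr, hrx⟩ := (hv.comp_tendsto hs.tendsto_atTop).exists_subseq_tendsto_ae hq
  filter_upwards [hsx, hrx, ae_all_iff.2 hle] with x hux hvx hx
  exact le_of_tendsto_of_tendsto' (hux.comp hr.tendsto_atTop) hvx fun _ => hx _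

lemma integral_mul (hu : TendstoLp 1 μ u l f) {h : α → ℝ} (hh : MemLp h ∞ μ) :
    Tendsto (fun i => ∫ x, h x * u i x ∂μ) l (𝓝 (∫ x, h x * f x ∂μ)) :=
  ((tendstoLp_const hh l).mul hu).tendsto_integral

lemma integral_sq (hu : TendstoLp 2 μ u l f) :
    Tendsto (fun i => ∫ x, u i x ^ 2 ∂μ) l (𝓝 (∫ x, f x ^ 2 ∂μ)) := by
  simpa only [sq] using (hu.mul hu).tendsto_integral

lemma bdd_mul {u a : ℕ → α → ℝ} {b : α → ℝ} (hp : p ≠ ∞) (hu : TendstoLp p μ u atTop f)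
    (ha : ∀ i, AEStronglyMeasurable (a i) μ) (ha1 : ∀ i x, |a i x| ≤ 1)
    (hab : ∀ᵐ x ∂μ, Tendsto (fun i => a i x) atTop (𝓝 (b x))) :
    TendstoLp p μ (fun i x => a i x * u i x) atTop (fun x => b x * f x) := by
  have hfixed : TendstoLp p μ (fun i x => a i x * f x) atTop (fun x => b x * f x) := by
    refine of_dominated hp (fun i => (ha i).mul hu.2.1) hu.2.norm
      (fun i => ae_of_all _ fun x => ?_) ?_
    · rw [norm_mul]
      exact mul_le_of_le_one_left (norm_nonneg _) (ha1 i x)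
    · filter_upwards [hab] with x hx using hx.mul_const _
  have hdiff : TendstoLp p μ (fun i x => a i x * (u i x - f x)) atTop (fun _ => 0) :=
    hu.mono (fun i => (ha i).mul ((hu.1 i).sub hu.2.1)) MemLp.zero' fun i =>
      ae_of_all _ fun x => by
        rw [sub_zero, norm_mul]
        exact mul_le_of_le_one_left (norm_nonneg _) (ha1 i x)
  refine (hdiff.add hfixed).congr (fun i => ae_of_all _ fun x => ?_) (ae_of_all _ fun x => ?_)
  · change a i x * (u i x - f x) + a i x * f x = a i x * u i x
    ring
  · exact zero_add _

end TendstoLp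

lemma lintegral_enorm_sq_eq {f : α → ℝ} (hf : MemLp f 2 μ) :
    ∫⁻ x, ‖f x‖ₑ ^ 2 ∂μ = ENNReal.ofReal (∫ x, f x ^ 2 ∂μ) := by
  rw [ofReal_integral_eq_lintegral_ofReal hf.integrable_sq (ae_of_all _ fun x => sq_nonneg _)]
  refine lintegral_congr fun x => ?_
  rw [← sq_abs, ENNReal.ofReal_pow (abs_nonneg _), Real.enorm_eq_ofReal_abs]

lemma eLpNorm_two_toReal_sq {f : α → ℝ} (hf : MemLp f 2 μ) :
    (eLpNorm f 2 μ).toReal ^ 2 = ∫ x, f x ^ 2 ∂μ := by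
  have hpow : eLpNorm f 2 μ ^ 2 = ∫⁻ x, ‖f x‖ₑ ^ 2 ∂μ := by
    simpa using eLpNorm_nnreal_pow_eq_lintegral (μ := μ) (f := f) (p := 2) two_ne_zero
  rw [← ENNReal.toReal_pow, hpow, lintegral_enorm_sq_eq hf,
    ENNReal.toReal_ofReal (integral_nonneg fun x => sq_nonneg _)]

lemma exists_tendstoLp_two_of_cauchy {u : ℕ → α → ℝ} (hu : ∀ n, MemLp (u n) 2 μ)
    (h : ∀ ε > 0, ∃ N, ∀ a ≥ N, ∀ b ≥ N, ∫ x, (u a x - u b x) ^ 2 ∂μ < ε) :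
    ∃ f, TendstoLp 2 μ u atTop f := by
  have hnorm : ∀ a b, dist ((hu a).toLp (u a)) ((hu b).toLp (u b)) ^ 2 =
      ∫ x, (u a x - u b x) ^ 2 ∂μ := fun a b => by
    rw [dist_eq_norm, ← MemLp.toLp_sub, Lp.norm_toLp, eLpNorm_two_toReal_sq ((hu a).sub (hu b))]
    rfl
  have hcauchy : CauchySeq fun n => (hu n).toLp (u n) := by
    refine Metric.cauchySeq_iff.2 fun ε hε => ?_
    obtain ⟨N, hN⟩ := h (ε ^ 2) (by positivity)
    exact ⟨N, fun a ha b hb => lt_of_pow_lt_pow_left₀ 2 hε.le ((hnorm a b).trans_lt (hN a ha b hb))⟩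
  obtain ⟨f, hf⟩ := cauchySeq_tendsto_of_complete hcauchy
  refine ⟨f, fun n => (hu n).1, Lp.memLp f, ?_⟩
  exact (Lp.tendsto_Lp_iff_tendsto_eLpNorm'' u hu f (Lp.memLp f)).1 (by rwa [Lp.toLp_coeFn])

lemma tendsto_natCast_add_one_inv_atTop_zero :
    Tendsto (fun k : ℕ => ((k : ℝ≥0∞) + 1)⁻¹) atTop (𝓝 0) := by
  simpa using (tendsto_add_atTop_iff_nat 1).2 ENNReal.tendsto_inv_nat_nhds_zero

lemma TendstoLp.of_eLpNorm_sub_lt {u v : ℕ → α → ℝ} {f : α → ℝ} (hv : TendstoLp p μ v atTop f)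
    (hu : ∀ k, AEStronglyMeasurable (u k) μ)
    (h : ∀ k : ℕ, eLpNorm (fun x => u k x - v k x) p μ < ((k : ℝ≥0∞) + 1)⁻¹) :
    TendstoLp p μ u atTop f := by
  have hdiff : TendstoLp p μ (fun k x => u k x - v k x) atTop (fun _ => 0) := by
    refine ⟨fun k => (hu k).sub (hv.1 k), MemLp.zero', ?_⟩
    simp only [sub_zero]
    exact tendsto_of_tendsto_of_tendsto_of_le_of_le tendsto_const_nhds
      tendsto_natCast_add_one_inv_atTop_zero (fun _ => zero_le) fun k => (h k).le
  simpa only [sub_add_cancel, zero_add] using hdiff.add hv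

lemma integral_mul_nonneg_of_integral_sq_le {G D : α → ℝ} (hG : MemLp G 2 μ) (hD : MemLp D 2 μ)
    (h : ∀ ε : ℝ, 0 < ε → ε ≤ 1 → ∫ x, G x ^ 2 ∂μ ≤ ∫ x, (G x + ε * D x) ^ 2 ∂μ) :
    0 ≤ ∫ x, G x * D x ∂μ := by
  have hGD : Integrable (fun x => G x * D x) μ := hG.integrable_mul hD
  have hpos : ∀ ε : ℝ, 0 < ε → ε ≤ 1 →
      0 ≤ 2 * ∫ x, G x * D x ∂μ + ε * ∫ x, D x ^ 2 ∂μ := by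
    intro ε hε hε1
    have hexpand : ∫ x, (G x + ε * D x) ^ 2 ∂μ =
        ∫ x, G x ^ 2 ∂μ + (2 * ε * ∫ x, G x * D x ∂μ + ε ^ 2 * ∫ x, D x ^ 2 ∂μ) := by
      rw [← integral_const_mul, ← integral_const_mul,
        ← integral_add (hGD.const_mul _) (hD.integrable_sq.const_mul _), ← integral_add
          hG.integrable_sq (by exact (hGD.const_mul _).add (hD.integrable_sq.const_mul _))]
      exact integral_congr_ae (ae_of_all _ fun x => by ring)
    have hle := h ε hε hε1
    exact nonneg_of_mul_nonneg_right (by linarith) hε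
  have hlim : Tendsto (fun n : ℕ => 2 * ∫ x, G x * D x ∂μ +
      1 / ((n : ℝ) + 1) * ∫ x, D x ^ 2 ∂μ) atTop (𝓝 (2 * ∫ x, G x * D x ∂μ + 0 * _)) :=
    (tendsto_one_div_add_atTop_nhds_zero_nat.mul_const _).const_add _
  have hlim_nonneg := ge_of_tendsto' hlim fun n => hpos _ (by positivity)
    ((div_le_one (by positivity)).2 (le_add_of_nonneg_left n.cast_nonneg))
  linarith

end TendstoLpReal

section Positivity

variable {X : Type*} [PseudoEMetricSpace X] [MeasurableSpace X] [BorelSpace X] {m : Measure X}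

lemma tendsto_integral_thickenedIndicator_pow_mul {w : X → ℝ} (hw : Integrable w m) {k : ℕ}
    (hk : k ≠ 0) {δ : ℕ → ℝ} (hδ : ∀ n, 0 < δ n) (hδ0 : Tendsto δ atTop (𝓝 0)) {F : Set X}
    (hF : IsClosed F) :
    Tendsto (fun n => ∫ x, (thickenedIndicator (hδ n) F x : ℝ) ^ k * w x ∂m) atTop
      (𝓝 (∫ x in F, w x ∂m)) := by
  have hlim := tendsto_pi_nhds.1 (thickenedIndicator_tendsto_indicator_closure hδ hδ0 F)
  rw [← integral_indicator hF.measurableSet]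
  refine tendsto_integral_of_dominated_convergence (fun x => |w x|) (fun n => ?_) hw.abs
    (fun n => ae_of_all _ fun x => ?_) (ae_of_all _ fun x => ?_)
  · have : Continuous fun x => (thickenedIndicator (hδ n) F x : ℝ) ^ k := by fun_prop
    exact this.measurable.aestronglyMeasurable.mul hw.1
  · rw [norm_mul, Real.norm_of_nonneg (by positivity)]
    exact mul_le_of_le_one_left (abs_nonneg _)
      (pow_le_one₀ (by positivity) (by exact_mod_cast thickenedIndicator_le_one (hδ n) F x))
  · have hx := ((NNReal.continuous_coe.tendsto _).comp (hlim x)).pow k |>.mul_const (w x)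
    convert! hx using 2
    rw [hF.closure_eq]
    by_cases hxF : x ∈ F <;> simp [hxF, hk]

lemma ae_nonneg_of_forall_setIntegral_isClosed_nonneg {w : X → ℝ} (hw : Integrable w m)
    (h : ∀ F : Set X, IsClosed F → 0 ≤ ∫ x in F, w x ∂m) : 0 ≤ᵐ[m] w := by
  refine ae_nonneg_of_forall_setIntegral_nonneg hw fun s hs _ => ?_
  let ν := m.withDensity fun x => ‖w x‖ₑ
  have : IsFiniteMeasure ν := isFiniteMeasure_withDensity (hasFiniteIntegral_iff_enorm.1 hw.2).ne
  refine le_of_forall_pos_lt_add fun ε hε => ?_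
  obtain ⟨F, hFs, hF, hFε⟩ := hs.exists_isClosed_sdiff_lt (μ := ν) (measure_ne_top _ _)
    (ENNReal.ofReal_pos.2 hε).ne'
  have hsplit : ∫ x in s, w x ∂m = ∫ x in F, w x ∂m + ∫ x in s \ F, w x ∂m := by
    rw [← setIntegral_union disjoint_sdiff_self_right (hs.diff hF.measurableSet)
      hw.integrableOn hw.integrableOn, union_sdiff_cancel hFs]
  have hsmall : |∫ x in s \ F, w x ∂m| < ε := by
    have hle : ‖∫ x in s \ F, w x ∂m‖ₑ ≤ ν (s \ F) := by
      rw [withDensity_apply _ (hs.diff hF.measurableSet)]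
      exact enorm_integral_le_lintegral_enorm _
    have hlt := hle.trans_lt hFε
    rwa [Real.enorm_eq_ofReal_abs, ENNReal.ofReal_lt_ofReal_iff hε] at hlt
  linarith [h F hF, (abs_lt.1 hsmall).1]

lemma ae_nonneg_of_forall_lipschitz {w : X → ℝ} (hw : Integrable w m) {k : ℕ} (hk : k ≠ 0)
    (h : ∀ (ψ : X → ℝ) (K : ℝ≥0), LipschitzWith K ψ → (∀ x, 0 ≤ ψ x) → (∀ x, ψ x ≤ 1) →
      0 ≤ ∫ x, ψ x ^ k * w x ∂m) : 0 ≤ᵐ[m] w := by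
  refine ae_nonneg_of_forall_setIntegral_isClosed_nonneg hw fun F hF => ?_
  have hδ : ∀ n : ℕ, (0 : ℝ) < 1 / ((n : ℝ) + 1) := fun n => by positivity
  refine ge_of_tendsto' (tendsto_integral_thickenedIndicator_pow_mul hw hk hδ
    tendsto_one_div_add_atTop_nhds_zero_nat hF) fun n => ?_
  exact h _ _ (NNReal.isometry_coe.lipschitz.comp (lipschitzWith_thickenedIndicator (hδ n) F))
    (fun x => by positivity) fun x => by exact_mod_cast thickenedIndicator_le_one (hδ n) F x

end Positivity

section LipBs

variable {X : Type*} [MetricSpace X] {u v ψ : X → ℝ}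

namespace IsLipBs

lemma continuous (hu : IsLipBs u) : Continuous u :=
  hu.1.choose_spec.continuous

lemma lip_ne_top (hu : IsLipBs u) (x : X) : lip u x ≠ ∞ :=
  MetricSobolev.lip_ne_top hu.1.choose_spec x

lemma exists_bound (hu : IsLipBs u) : ∃ C, 0 ≤ C ∧ ∀ x, |u x| ≤ C := by
  obtain ⟨⟨K, hK⟩, hb⟩ := hu
  rcases isEmpty_or_nonempty X with hX | ⟨⟨z⟩⟩
  · exact ⟨0, le_rfl, fun x => hX.elim x⟩
  obtain ⟨R, hR⟩ := hb.subset_closedBall z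
  refine ⟨|u z| + K * |R|, by positivity, fun x => ?_⟩
  by_cases hx : u x = 0
  · rw [hx, abs_zero]; positivity
  have hdist : dist x z ≤ |R| := (hR hx).trans (le_abs_self R)
  have hux : |u x - u z| ≤ K * |R| :=
    (hK.dist_le_mul x z).trans (mul_le_mul_of_nonneg_left hdist K.2)
  linarith [abs_sub_abs_le_abs_sub (u x) (u z)]

lemma zero : IsLipBs (fun _ : X => (0 : ℝ)) :=
  ⟨⟨0, LipschitzWith.const 0⟩, by simp⟩

lemma add (hu : IsLipBs u) (hv : IsLipBs v) : IsLipBs (u + v) := by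
  obtain ⟨⟨K, hK⟩, hb⟩ := hu
  obtain ⟨⟨L, hL⟩, hb'⟩ := hv
  exact ⟨⟨K + L, hK.add hL⟩, (hb.union hb').subset (Function.support_add u v)⟩

lemma comp (hu : IsLipBs u) {φ : ℝ → ℝ} {M : ℝ≥0} (hφ : LipschitzWith M φ) (h0 : φ 0 = 0) :
    IsLipBs (fun x => φ (u x)) := by
  obtain ⟨⟨K, hK⟩, hb⟩ := hu
  exact ⟨⟨M * K, hφ.comp hK⟩, hb.subset (Function.support_comp_subset h0 u)⟩

lemma const_mul (hu : IsLipBs u) (c : ℝ) : IsLipBs (fun x => c * u x) :=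
  hu.comp (lipschitzWith_smul c) (mul_zero c)

lemma bdd_mul {M : ℝ≥0} (hu : IsLipBs u) (hψ : LipschitzWith M ψ) (hψ1 : ∀ y, |ψ y| ≤ 1) :
    IsLipBs (fun y => ψ y * u y) := by
  obtain ⟨A, _, hA⟩ := hu.exists_bound
  obtain ⟨⟨K, hK⟩, hb⟩ := hu
  refine ⟨⟨_, LipschitzWith.of_dist_le' (K := K + M * A) fun y x => ?_⟩,
    hb.subset (Function.support_mul_subset_right ψ u)⟩
  calc dist (ψ y * u y) (ψ x * u x)
      = |ψ y * (u y - u x) + (ψ y - ψ x) * u x| := by rw [Real.dist_eq]; congr 1; ring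
    _ ≤ |ψ y| * |u y - u x| + |ψ y - ψ x| * |u x| := by
      simpa only [abs_mul] using abs_add_le (ψ y * (u y - u x)) ((ψ y - ψ x) * u x)
    _ ≤ 1 * (K * dist y x) + M * dist y x * A := by
      gcongr
      exacts [hψ1 y, hK.dist_le_mul y x, hψ.dist_le_mul y x, hA x]
    _ = (K + M * A) * dist y x := by ring

lemma glue {M : ℝ≥0} (hu : IsLipBs u) (hv : IsLipBs v) (hψ : LipschitzWith M ψ)
    (h0 : ∀ y, 0 ≤ ψ y) (h1 : ∀ y, ψ y ≤ 1) :
    IsLipBs (fun y => (1 - ψ y) * u y + ψ y * v y) := by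
  have hψ' : LipschitzWith M fun y => 1 - ψ y := by
    simpa only [zero_add] using (LipschitzWith.const (1 : ℝ)).sub hψ
  exact (hu.bdd_mul hψ' fun y => abs_le.2 ⟨by linarith [h1 y], by linarith [h0 y]⟩).add
    (hv.bdd_mul hψ fun y => abs_le.2 ⟨by linarith [h0 y], h1 y⟩)

end IsLipBs

lemma rlip_eq_zero_of_notMem_tsupport {x : X} (hx : x ∉ tsupport u) : rlip u x = 0 := by
  have hlip : lip u x = limsup (fun _ => (⊥ : ℝ≥0∞)) (𝓝[≠] x) := by
    refine limsup_congr (nhdsWithin_le_nhds ?_)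
    filter_upwards [notMem_tsupport_iff_eventuallyEq.1 hx] with y hy
    simp [hy, image_eq_zero_of_notMem_tsupport hx]
  rw [rlip, hlip, limsup_const_bot, bot_eq_zero, ENNReal.toReal_zero]

variable [MeasurableSpace X] [BorelSpace X] {m : Measure X} {p : ℝ≥0∞}

lemma BoundedlyFinite.memLp_of_abs_le (hm : BoundedlyFinite m) {w : X → ℝ} {s : Set X} {C : ℝ}
    (hw : AEStronglyMeasurable w m) (hs : Bornology.IsBounded s) (hws : ∀ x ∉ closure s, w x = 0)
    (hC : ∀ x, |w x| ≤ C) : MemLp w p m := by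
  have hind : MemLp ((closure s).indicator fun _ => C) p m :=
    memLp_indicator_const p isClosed_closure.measurableSet C (Or.inr (hm _ hs.closure).ne)
  refine hind.mono' hw (ae_of_all _ fun x => ?_)
  by_cases hx : x ∈ closure s
  · rw [indicator_of_mem hx]
    exact hC x
  · rw [hws x hx, indicator_of_notMem hx, norm_zero]

namespace IsLipBs

lemma memLp (hm : BoundedlyFinite m) (hu : IsLipBs u) : MemLp u p m := by
  obtain ⟨A, -, hA⟩ := hu.exists_bound
  exact hm.memLp_of_abs_le hu.continuous.measurable.aestronglyMeasurable hu.2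
    (fun x hx => image_eq_zero_of_notMem_tsupport hx) hA

lemma memLp_rlip (hm : BoundedlyFinite m) (hu : IsLipBs u) : MemLp (rlip u) p m := by
  obtain ⟨⟨K, hK⟩, hb⟩ := hu
  refine hm.memLp_of_abs_le (C := K) (measurable_rlip hK.continuous).aestronglyMeasurable hb
    (fun x hx => rlip_eq_zero_of_notMem_tsupport hx) fun x => ?_
  rw [abs_of_nonneg (rlip_nonneg u x)]
  exact rlip_le_of_lipschitzWith hK x

lemma lintegral_lip_sq (hm : BoundedlyFinite m) (hu : IsLipBs u) :
    ∫⁻ x, lip u x ^ 2 ∂m = ENNReal.ofReal (∫ x, rlip u x ^ 2 ∂m) := by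
  rw [← lintegral_enorm_sq_eq (hu.memLp_rlip hm)]
  refine lintegral_congr fun x => ?_
  rw [Real.enorm_eq_ofReal (rlip_nonneg u x), rlip, ENNReal.ofReal_toReal (hu.lip_ne_top x)]

end IsLipBs

end LipBs

section Relaxation

variable {X : Type*} [MetricSpace X] [MeasurableSpace X] {m : Measure X} {f f' G H ψ : X → ℝ}
  {u v : ℕ → X → ℝ}

/-- The Dirichlet energy `∫ |Df|² dm`, i.e. twice the Cheeger energy, as a real number (`0` when the
Cheeger energy is infinite). -/
noncomputable def dirichlet (m : Measure X) (f : X → ℝ) : ℝ :=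
  2 * (cheegerEnergy m f).toReal

lemma MemW12.cheegerEnergy_ne_top (hf : MemW12 m f) : cheegerEnergy m f ≠ ∞ := by
  obtain ⟨-, u, hu, hlim⟩ := hf
  refine ((iInf₂_le u hu).trans_lt (lt_of_le_of_lt ?_ hlim)).ne
  exact liminf_le_liminf (Eventually.of_forall fun n => mul_le_of_le_one_left' (by simp))

/-- `G` is a relaxed slope of `f` if, in `L²(m)`, it is a limit of upper bounds for the slopes of
Lipschitz functions with bounded support that converge to `f`. -/
def IsRelaxedSlope (m : Measure X) (f G : X → ℝ) : Prop :=
  ∃ u Γ : ℕ → X → ℝ, (∀ n, IsLipBs (u n)) ∧ (∀ n, rlip (u n) ≤ᵐ[m] Γ n) ∧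
    TendstoLp 2 m u atTop f ∧ TendstoLp 2 m Γ atTop G

lemma IsRelaxedSlope.memLp (h : IsRelaxedSlope m f G) : MemLp f 2 m := by
  obtain ⟨_, _, _, _, hf, _⟩ := h
  exact hf.memLp

lemma IsRelaxedSlope.memLp_slope (h : IsRelaxedSlope m f G) : MemLp G 2 m := by
  obtain ⟨_, _, _, _, _, hΓ⟩ := h
  exact hΓ.memLp

lemma IsRelaxedSlope.ae_nonneg (h : IsRelaxedSlope m f G) : 0 ≤ᵐ[m] G := by
  obtain ⟨u, Γ, -, hle, -, hΓ⟩ := h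
  have hzero : MemLp (0 : X → ℝ) 2 m := MemLp.zero
  exact (tendstoLp_const hzero atTop).ae_le hΓ two_ne_zero two_ne_zero fun n =>
    (hle n).mono fun x hx => (rlip_nonneg _ x).trans hx

lemma exists_approximatesL2_lintegral_lip_lt (hE : cheegerEnergy m f ≠ ∞) :
    ∃ u : ℕ → X → ℝ, ApproximatesL2 m f u ∧ ∀ k : ℕ,
      2⁻¹ * ∫⁻ x, lip (u k) x ^ 2 ∂m < cheegerEnergy m f + ((k : ℝ≥0∞) + 1)⁻¹ := by
  have key : ∀ k : ℕ, ∃ v : X → ℝ, IsLipBs v ∧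
      eLpNorm (fun x => v x - f x) 2 m < ((k : ℝ≥0∞) + 1)⁻¹ ∧
      2⁻¹ * ∫⁻ x, lip v x ^ 2 ∂m < cheegerEnergy m f + ((k : ℝ≥0∞) + 1)⁻¹ := by
    intro k
    have hk : (0 : ℝ≥0∞) < ((k : ℝ≥0∞) + 1)⁻¹ := by simp
    have hlt : cheegerEnergy m f < cheegerEnergy m f + ((k : ℝ≥0∞) + 1)⁻¹ :=
      ENNReal.lt_add_right hE hk.ne'
    conv_lhs at hlt => rw [cheegerEnergy]
    obtain ⟨u, hu, hliminf⟩ := by simpa only [iInf_lt_iff] using hlt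
    have hfreq := frequently_lt_of_liminf_lt (by isBoundedDefault) hliminf
    obtain ⟨n, henergy, hnorm⟩ := (hfreq.and_eventually (hu.2.eventually_lt_const hk)).exists
    exact ⟨u n, hu.1 n, hnorm, henergy⟩
  choose v hv hnorm henergy using key
  exact ⟨v, ⟨hv, tendsto_of_tendsto_of_tendsto_of_le_of_le tendsto_const_nhds
    tendsto_natCast_add_one_inv_atTop_zero (fun _ => zero_le) fun k => (hnorm k).le⟩, henergy⟩

lemma IsMinimalRelaxedSlope.dirichlet_eq (h : IsMinimalRelaxedSlope m f G) :
    dirichlet m f = ∫ x, G x ^ 2 ∂m := by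
  rw [dirichlet, h.2.2, lintegral_enorm_sq_eq h.1, ENNReal.toReal_mul,
    ENNReal.toReal_ofReal (integral_nonneg fun x => sq_nonneg _)]
  simp

variable [BorelSpace X]

lemma ApproximatesL2.tendstoLp (hu : ApproximatesL2 m f u) (hf : MemLp f 2 m) :
    TendstoLp 2 m u atTop f :=
  ⟨fun n => (hu.1 n).continuous.measurable.aestronglyMeasurable, hf, hu.2⟩

lemma dirichlet_le_of_tendsto (hm : BoundedlyFinite m) (hu : ApproximatesL2 m f u) {b : ℕ → ℝ}
    {B : ℝ} (hb : Tendsto b atTop (𝓝 B)) (hub : ∀ᶠ n in atTop, ∫ x, rlip (u n) x ^ 2 ∂m ≤ b n) :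
    dirichlet m f ≤ B := by
  have hB : 0 ≤ B := ge_of_tendsto hb (hub.mono fun n hn =>
    (integral_nonneg fun x => sq_nonneg (rlip (u n) x)).trans hn)
  have hE : cheegerEnergy m f ≤ ENNReal.ofReal (B / 2) := by
    refine (iInf₂_le u hu).trans ?_
    rw [← (ENNReal.tendsto_ofReal (hb.div_const 2)).liminf_eq]
    refine liminf_le_liminf (hub.mono fun n hn => ?_)
    rw [(hu.1 n).lintegral_lip_sq hm, div_eq_inv_mul, ENNReal.ofReal_mul (by norm_num),
      ENNReal.ofReal_inv_of_pos two_pos, ENNReal.ofReal_ofNat]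
    gcongr
  have hEreal := ENNReal.toReal_mono ENNReal.ofReal_ne_top hE
  rw [ENNReal.toReal_ofReal (by positivity)] at hEreal
  rw [dirichlet]
  linarith

lemma MemW12.exists_minimizing_seq (hm : BoundedlyFinite m) (hf : MemW12 m f) :
    ∃ u : ℕ → X → ℝ, ApproximatesL2 m f u ∧
      Tendsto (fun n => ∫ x, rlip (u n) x ^ 2 ∂m) atTop (𝓝 (dirichlet m f)) := by
  have hE := hf.cheegerEnergy_ne_top
  obtain ⟨v, hv, henergy⟩ := exists_approximatesL2_lintegral_lip_lt hE
  refine ⟨v, hv, ?_⟩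
  have hlim : Tendsto (fun k => 2⁻¹ * ∫⁻ x, lip (v k) x ^ 2 ∂m) atTop
      (𝓝 (cheegerEnergy m f)) := by
    refine tendsto_of_le_liminf_of_limsup_le (iInf₂_le v hv) ?_
    have hbound : Tendsto (fun k : ℕ => cheegerEnergy m f + ((k : ℝ≥0∞) + 1)⁻¹) atTop
        (𝓝 (cheegerEnergy m f)) := by
      simpa only [add_zero] using tendsto_natCast_add_one_inv_atTop_zero.const_add _
    rw [← hbound.limsup_eq]
    exact limsup_le_limsup (Eventually.of_forall fun k => (henergy k).le)
  refine (((ENNReal.tendsto_toReal hE).comp hlim).const_mul 2).congr fun k => ?_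
  rw [Function.comp_apply, (hv.1 k).lintegral_lip_sq hm, ENNReal.toReal_mul,
    ENNReal.toReal_ofReal (integral_nonneg fun x => sq_nonneg (rlip (v k) x))]
  simp

lemma integral_rlip_average_sq_le (hm : BoundedlyFinite m) {u v : X → ℝ} (hu : IsLipBs u)
    (hv : IsLipBs v) :
    ∫ x, rlip (fun y => 2⁻¹ * (u y + v y)) x ^ 2 ∂m ≤
      2⁻¹ * ∫ x, rlip u x ^ 2 ∂m + 2⁻¹ * ∫ x, rlip v x ^ 2 ∂m
        - 4⁻¹ * ∫ x, (rlip u x - rlip v x) ^ 2 ∂m := by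
  have hu2 := (hu.memLp_rlip (p := 2) hm).integrable_sq
  have hv2 := (hv.memLp_rlip (p := 2) hm).integrable_sq
  have hsub2 : Integrable (fun x => (rlip u x - rlip v x) ^ 2) m :=
    ((hu.memLp_rlip hm).sub (hv.memLp_rlip hm)).integrable_sq
  have hsum : Integrable (fun x => 2⁻¹ * rlip u x ^ 2 + 2⁻¹ * rlip v x ^ 2) m :=
    (hu2.const_mul _).add (hv2.const_mul _)
  rw [← integral_const_mul, ← integral_const_mul, ← integral_const_mul,
    ← integral_add (hu2.const_mul _) (hv2.const_mul _), ← integral_sub hsum (hsub2.const_mul _)]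
  refine integral_mono (((hu.add hv).const_mul 2⁻¹).memLp_rlip hm).integrable_sq
    (hsum.sub (hsub2.const_mul _)) fun x => ?_
  have havg := rlip_average_le (hu.lip_ne_top x) (hv.lip_ne_top x)
  have := pow_le_pow_left₀ (rlip_nonneg _ x) havg 2
  exact this.trans_eq (by ring)

lemma exists_integral_sub_rlip_sq_lt (hm : BoundedlyFinite m) (hf : MemLp f 2 m)
    (hu : ApproximatesL2 m f u)
    (hlim : Tendsto (fun n => ∫ x, rlip (u n) x ^ 2 ∂m) atTop (𝓝 (dirichlet m f)))
    {ε : ℝ} (hε : 0 < ε) :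
    ∃ N, ∀ a ≥ N, ∀ b ≥ N, ∫ x, (rlip (u a) x - rlip (u b) x) ^ 2 ∂m < ε := by
  by_contra! hfar
  choose a ha b hb hab using hfar
  have ha' : Tendsto a atTop atTop := tendsto_atTop_mono ha tendsto_id
  have hb' : Tendsto b atTop atTop := tendsto_atTop_mono hb tendsto_id
  have havg : ApproximatesL2 m f (fun n x => 2⁻¹ * (u (a n) x + u (b n) x)) := by
    refine ⟨fun n => ((hu.1 _).add (hu.1 _)).const_mul _, ?_⟩
    have hLp := hu.tendstoLp hf
    convert! (((hLp.comp_tendsto ha').add (hLp.comp_tendsto hb')).const_mul 2⁻¹).tendsto using 4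
    ring
  have hB : Tendsto (fun n => 2⁻¹ * ∫ x, rlip (u (a n)) x ^ 2 ∂m
      + 2⁻¹ * ∫ x, rlip (u (b n)) x ^ 2 ∂m - 4⁻¹ * ε) atTop
      (𝓝 (2⁻¹ * dirichlet m f + 2⁻¹ * dirichlet m f - 4⁻¹ * ε)) :=
    (((hlim.comp ha').const_mul _).add ((hlim.comp hb').const_mul _)).sub_const _
  have hcontra := dirichlet_le_of_tendsto hm havg hB <| Eventually.of_forall fun n =>
    (integral_rlip_average_sq_le hm (hu.1 _) (hu.1 _)).trans (by linarith [hab n])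
  linarith

lemma MemW12.exists_isMinimalRelaxedSlope (hm : BoundedlyFinite m) (hf : MemW12 m f) :
    ∃ G, IsMinimalRelaxedSlope m f G := by
  obtain ⟨u, hu, hlim⟩ := hf.exists_minimizing_seq hm
  obtain ⟨G, hG⟩ := exists_tendstoLp_two_of_cauchy (fun n => (hu.1 n).memLp_rlip hm)
    fun ε hε => exists_integral_sub_rlip_sq_lt hm hf.1 hu hlim hε
  refine ⟨G, hG.memLp, ⟨u, hu, hG.tendsto⟩, ?_⟩
  rw [lintegral_enorm_sq_eq hG.memLp, ← tendsto_nhds_unique hlim hG.integral_sq, dirichlet,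
    ENNReal.ofReal_mul zero_le_two, ENNReal.ofReal_toReal hf.cheegerEnergy_ne_top, ← mul_assoc]
  simp [ENNReal.inv_mul_cancel]

lemma MemW12.isMinimalRelaxedSlope (hm : BoundedlyFinite m) (hf : MemW12 m f) :
    IsMinimalRelaxedSlope m f (relaxedSlope m f) := by
  have h := hf.exists_isMinimalRelaxedSlope hm
  rw [relaxedSlope, dif_pos h]
  exact h.choose_spec

lemma IsMinimalRelaxedSlope.isRelaxedSlope (h : IsMinimalRelaxedSlope m f G)
    (hf : MemLp f 2 m) : IsRelaxedSlope m f G := by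
  obtain ⟨hG, ⟨u, hu, hlim⟩, -⟩ := h
  exact ⟨u, fun n => rlip (u n), hu.1, fun n => EventuallyLE.rfl, hu.tendstoLp hf,
    fun n => (measurable_rlip (hu.1 n).continuous).aestronglyMeasurable, hG, hlim⟩

namespace IsRelaxedSlope

lemma eventually_integral_rlip_sq_le (hm : BoundedlyFinite m) {Γ : ℕ → X → ℝ}
    (hu : ∀ n, IsLipBs (u n)) (hle : ∀ n, rlip (u n) ≤ᵐ[m] Γ n) (hΓ : TendstoLp 2 m Γ atTop G) :
    ∀ᶠ n in atTop, ∫ x, rlip (u n) x ^ 2 ∂m ≤ ∫ x, Γ n x ^ 2 ∂m := by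
  filter_upwards [hΓ.eventually_memLp] with n hn
  refine integral_mono_ae ((hu n).memLp_rlip hm).integrable_sq hn.integrable_sq ?_
  filter_upwards [hle n] with x hx using pow_le_pow_left₀ (rlip_nonneg _ x) hx 2

lemma dirichlet_le (hm : BoundedlyFinite m) (h : IsRelaxedSlope m f G) :
    dirichlet m f ≤ ∫ x, G x ^ 2 ∂m := by
  obtain ⟨u, Γ, hu, hle, hf, hΓ⟩ := h
  exact dirichlet_le_of_tendsto hm ⟨hu, hf.tendsto⟩ hΓ.integral_sq
    (eventually_integral_rlip_sq_le hm hu hle hΓ)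

lemma memW12 (hm : BoundedlyFinite m) (h : IsRelaxedSlope m f G) : MemW12 m f := by
  obtain ⟨u, Γ, hu, hle, hf, hΓ⟩ := h
  refine ⟨hf.memLp, u, ⟨hu, hf.tendsto⟩, ?_⟩
  refine lt_of_le_of_lt ?_ (ENNReal.ofReal_lt_top (r := ∫ x, G x ^ 2 ∂m))
  rw [← (ENNReal.tendsto_ofReal hΓ.integral_sq).liminf_eq]
  refine liminf_le_liminf ((eventually_integral_rlip_sq_le hm hu hle hΓ).mono fun n hn => ?_)
  rw [(hu n).lintegral_lip_sq hm]
  exact ENNReal.ofReal_le_ofReal hn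

lemma glue {M : ℝ≥0} (hG : IsRelaxedSlope m f G) (hH : IsRelaxedSlope m f' H)
    (hψ : LipschitzWith M ψ) (h0 : ∀ y, 0 ≤ ψ y) (h1 : ∀ y, ψ y ≤ 1) :
    IsRelaxedSlope m (fun x => (1 - ψ x) * f x + ψ x * f' x)
      (fun x => (1 - ψ x) * G x + ψ x * H x + M * |f' x - f x|) := by
  obtain ⟨u, Γ, hu, hle, hf, hΓ⟩ := hG
  obtain ⟨v, Δ, hv, hle', hf', hΔ⟩ := hH
  have hψ_lim : TendstoLp ∞ m (fun _ : ℕ => ψ) atTop ψ :=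
    tendstoLp_const (memLp_top_of_bound hψ.continuous.measurable.aestronglyMeasurable 1
      (ae_of_all _ fun x => abs_le.2 ⟨by linarith [h0 x], h1 x⟩)) _
  have hψ_lim' : TendstoLp ∞ m (fun (_ : ℕ) x => 1 - ψ x) atTop fun x => 1 - ψ x :=
    (tendstoLp_const (memLp_top_const 1) _).sub hψ_lim
  refine ⟨fun n x => (1 - ψ x) * u n x + ψ x * v n x,
    fun n x => (1 - ψ x) * Γ n x + ψ x * Δ n x + M * |v n x - u n x|,
    fun n => (hu n).glue (hv n) hψ h0 h1, fun n => ?_, (hψ_lim'.mul hf).add (hψ_lim.mul hf'),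
    ((hψ_lim'.mul hΓ).add (hψ_lim.mul hΔ)).add ((hf'.sub hf).abs.const_mul M)⟩
  filter_upwards [hle n, hle' n] with x hx hx'
  refine (rlip_glue_le ((hu n).lip_ne_top x) ((hv n).lip_ne_top x) (lip_ne_top hψ x)
    hψ.continuous.continuousAt h0 h1).trans ?_
  rw [mul_comm (M : ℝ)]
  have := sub_nonneg.2 (h1 x)
  have := h0 x
  gcongr
  exact rlip_le_of_lipschitzWith hψ x

lemma of_tendsto {φ Γ : ℕ → X → ℝ} (h : ∀ k, IsRelaxedSlope m (φ k) (Γ k))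
    (hφ : TendstoLp 2 m φ atTop f) (hΓ : TendstoLp 2 m Γ atTop G) : IsRelaxedSlope m f G := by
  have key : ∀ k : ℕ, ∃ v g : X → ℝ, IsLipBs v ∧ AEStronglyMeasurable g m ∧ rlip v ≤ᵐ[m] g ∧
      eLpNorm (fun x => v x - φ k x) 2 m < ((k : ℝ≥0∞) + 1)⁻¹ ∧
      eLpNorm (fun x => g x - Γ k x) 2 m < ((k : ℝ≥0∞) + 1)⁻¹ := by
    intro k
    have hk : (0 : ℝ≥0∞) < ((k : ℝ≥0∞) + 1)⁻¹ := by simp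
    obtain ⟨u, g, hu, hle, hf, hg⟩ := h k
    obtain ⟨n, hn, hn'⟩ := ((hf.tendsto.eventually_lt_const hk).and
      (hg.tendsto.eventually_lt_const hk)).exists
    exact ⟨u n, g n, hu n, hg.1 n, hle n, hn, hn'⟩
  choose v g hv hg hle hvφ hgΓ using key
  exact ⟨v, g, hv, hle, hφ.of_eLpNorm_sub_lt (fun k => (hv k).continuous.aestronglyMeasurable) hvφ,
    hΓ.of_eLpNorm_sub_lt hg hgΓ⟩

lemma interpolate {M : ℝ≥0} (hG : IsRelaxedSlope m f G) (hH : IsRelaxedSlope m f H)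
    (hψ : LipschitzWith M ψ) (h0 : ∀ y, 0 ≤ ψ y) (h1 : ∀ y, ψ y ≤ 1) :
    IsRelaxedSlope m f (fun x => G x + ψ x * (H x - G x)) := by
  convert! hG.glue hH hψ h0 h1 using 2 with x x
  · ring
  · simp only [sub_self, abs_zero, mul_zero, add_zero]
    ring

end IsRelaxedSlope

lemma IsMinimalRelaxedSlope.ae_le (hm : BoundedlyFinite m) (hG : IsMinimalRelaxedSlope m f G)
    (hH : IsRelaxedSlope m f H) : G ≤ᵐ[m] H := by
  have hGr := hG.isRelaxedSlope hH.memLp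
  have hD := hH.memLp_slope.sub hG.1
  have hpos : 0 ≤ᵐ[m] fun x => G x * (H x - G x) := by
    refine ae_nonneg_of_forall_lipschitz (hG.1.integrable_mul hD) one_ne_zero
      fun ψ K hK h0 h1 => ?_
    have hψD : MemLp (fun x => ψ x * (H x - G x)) 2 m :=
      hD.mul (memLp_top_of_bound hK.continuous.measurable.aestronglyMeasurable 1
        (ae_of_all _ fun x => abs_le.2 ⟨by linarith [h0 x], h1 x⟩))
    have hvar := integral_mul_nonneg_of_integral_sq_le hG.1 hψD fun ε hε hε1 => by
      have hinterp := hGr.interpolate hH ((lipschitzWith_smul ε).comp hK)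
        (fun x => mul_nonneg hε.le (h0 x)) (fun x => mul_le_one₀ hε1 (h0 x) (h1 x))
      rw [← hG.dirichlet_eq]
      simpa only [Function.comp_apply, smul_eq_mul, mul_assoc] using hinterp.dirichlet_le hm
    simpa only [pow_one, mul_left_comm] using hvar
  filter_upwards [hpos, hH.ae_nonneg] with x hx hHx
  by_contra! hlt
  have hG0 : 0 < G x := hHx.trans_lt hlt
  exact (mul_neg_of_pos_of_neg hG0 (sub_neg.2 hlt)).not_ge hx

end Relaxation

section Calculus

variable {X : Type*} [MetricSpace X] [MeasurableSpace X] {m : Measure X} {f f' g G H : X → ℝ}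

namespace IsRelaxedSlope

lemma add (hG : IsRelaxedSlope m f G) (hH : IsRelaxedSlope m f' H) :
    IsRelaxedSlope m (f + f') (G + H) := by
  obtain ⟨u, Γ, hu, hle, hf, hΓ⟩ := hG
  obtain ⟨v, Δ, hv, hle', hf', hΔ⟩ := hH
  refine ⟨fun n => u n + v n, fun n => Γ n + Δ n, fun n => (hu n).add (hv n), fun n => ?_,
    hf.add hf', hΓ.add hΔ⟩
  filter_upwards [hle n, hle' n] with x hx hx'
  exact (rlip_add_le ((hu n).lip_ne_top x) ((hv n).lip_ne_top x)).trans (add_le_add hx hx')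

lemma const_mul (hG : IsRelaxedSlope m f G) (c : ℝ) :
    IsRelaxedSlope m (fun x => c * f x) (fun x => |c| * G x) := by
  obtain ⟨u, Γ, hu, hle, hf, hΓ⟩ := hG
  refine ⟨fun n x => c * u n x, fun n x => |c| * Γ n x, fun n => (hu n).const_mul c,
    fun n => ?_, hf.const_mul c, hΓ.const_mul |c|⟩
  filter_upwards [hle n] with x hx
  exact (rlip_const_mul_le ((hu n).lip_ne_top x) c).trans
    (mul_le_mul_of_nonneg_left hx (abs_nonneg c))

lemma zero : IsRelaxedSlope m (0 : X → ℝ) 0 := by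
  have hzero : MemLp (0 : X → ℝ) 2 m := MemLp.zero
  have hlim := tendstoLp_const hzero (atTop : Filter ℕ)
  refine ⟨fun _ => 0, fun _ => 0, fun _ => IsLipBs.zero, fun _ => ae_of_all _ fun x => ?_,
    hlim, hlim⟩
  exact rlip_le_of_lipschitzWith (LipschitzWith.const (0 : ℝ)) x

lemma comp_lipschitz (hG : IsRelaxedSlope m f G) {φ : ℝ → ℝ} (hφ : LipschitzWith 1 φ)
    (h0 : φ 0 = 0) : IsRelaxedSlope m (fun x => φ (f x)) G := by
  obtain ⟨u, Γ, hu, hle, hf, hΓ⟩ := hG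
  refine ⟨fun n x => φ (u n x), Γ, fun n => (hu n).comp hφ h0, fun n => ?_,
    hf.comp_lipschitz hφ h0, hΓ⟩
  filter_upwards [hle n] with x hx
  exact (rlip_comp_lipschitz_le ((hu n).lip_ne_top x) hφ).trans hx

lemma comp_of_hasDerivAt {φ φ' : ℝ → ℝ} (hG : IsRelaxedSlope m f G) (hφ : LipschitzWith 1 φ)
    (h0 : φ 0 = 0) (hd : ∀ z, HasDerivAt φ (φ' z) z) (hc : Continuous φ') :
    IsRelaxedSlope m (fun x => φ (f x)) (fun x => |φ' (f x)| * G x) := by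
  obtain ⟨u, Γ, hu, hle, hf, hΓ⟩ := hG
  obtain ⟨s, hs, hsx⟩ := hf.exists_subseq_tendsto_ae two_ne_zero
  have hφ' : ∀ z, |φ' z| ≤ 1 := fun z => by
    simpa [(hd z).deriv] using norm_deriv_le_of_lipschitz (x₀ := z) hφ
  refine ⟨fun n x => φ (u (s n) x), fun n x => |φ' (u (s n) x)| * Γ (s n) x,
    fun n => (hu _).comp hφ h0, fun n => ?_,
    (hf.comp_tendsto hs.tendsto_atTop).comp_lipschitz hφ h0,
    (hΓ.comp_tendsto hs.tendsto_atTop).bdd_mul ENNReal.ofNat_ne_top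
      (fun n => hc.abs.comp_aestronglyMeasurable (hf.1 _)) (fun n x => (abs_abs _).trans_le (hφ' _))
      (hsx.mono fun x hx => (hc.abs.tendsto _).comp hx)⟩
  filter_upwards [hle (s n)] with x hx
  exact (rlip_comp_le ((hu _).lip_ne_top x) (hu _).continuous.continuousAt (hd _)).trans
    (mul_le_mul_of_nonneg_left hx (abs_nonneg _))

variable [BorelSpace X]

lemma mul_lipschitz {ψ : X → ℝ} {M : ℝ≥0} (hG : IsRelaxedSlope m f G) (hψ : LipschitzWith M ψ)
    (h0 : ∀ y, 0 ≤ ψ y) (h1 : ∀ y, ψ y ≤ 1) :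
    IsRelaxedSlope m (fun x => ψ x * f x) (fun x => ψ x * G x + M * |f x|) := by
  simpa using zero.glue hG hψ h0 h1

lemma relaxedSlope_le (hm : BoundedlyFinite m) (h : IsRelaxedSlope m f G) :
    relaxedSlope m f ≤ᵐ[m] G :=
  ((h.memW12 hm).isMinimalRelaxedSlope hm).ae_le hm h

end IsRelaxedSlope

variable [BorelSpace X]

lemma MemW12.isRelaxedSlope (hm : BoundedlyFinite m) (hf : MemW12 m f) :
    IsRelaxedSlope m f (relaxedSlope m f) :=
  (hf.isMinimalRelaxedSlope hm).isRelaxedSlope hf.1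

lemma MemW12.memLp_relaxedSlope (hm : BoundedlyFinite m) (hf : MemW12 m f) :
    MemLp (relaxedSlope m f) 2 m :=
  (hf.isMinimalRelaxedSlope hm).1

lemma MemW12.add (hm : BoundedlyFinite m) (hf : MemW12 m f) (hg : MemW12 m g) :
    MemW12 m (f + g) :=
  ((hf.isRelaxedSlope hm).add (hg.isRelaxedSlope hm)).memW12 hm

lemma MemW12.const_mul (hm : BoundedlyFinite m) (hf : MemW12 m f) (c : ℝ) :
    MemW12 m (fun x => c * f x) :=
  ((hf.isRelaxedSlope hm).const_mul c).memW12 hm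

lemma MemW12.neg (hm : BoundedlyFinite m) (hf : MemW12 m f) : MemW12 m (-f) := by
  convert! hf.const_mul hm (-1) using 2 with x
  simp

lemma MemW12.sub (hm : BoundedlyFinite m) (hf : MemW12 m f) (hg : MemW12 m g) :
    MemW12 m (f - g) :=
  sub_eq_add_neg f g ▸ hf.add hm (hg.neg hm)

lemma MemW12.dirichlet_eq_integral (hm : BoundedlyFinite m) (hf : MemW12 m f) :
    dirichlet m f = ∫ x, relaxedSlope m f x ^ 2 ∂m :=
  (hf.isMinimalRelaxedSlope hm).dirichlet_eq

lemma relaxedSlope_nonneg (hm : BoundedlyFinite m) (hf : MemW12 m f) :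
    0 ≤ᵐ[m] relaxedSlope m f :=
  (hf.isRelaxedSlope hm).ae_nonneg

lemma relaxedSlope_add_le (hm : BoundedlyFinite m) (hf : MemW12 m f) (hg : MemW12 m g) :
    relaxedSlope m (f + g) ≤ᵐ[m] relaxedSlope m f + relaxedSlope m g :=
  ((hf.isRelaxedSlope hm).add (hg.isRelaxedSlope hm)).relaxedSlope_le hm

lemma relaxedSlope_const_mul (hm : BoundedlyFinite m) (hf : MemW12 m f) {c : ℝ} (hc : c ≠ 0) :
    relaxedSlope m (fun x => c * f x) =ᵐ[m] fun x => |c| * relaxedSlope m f x := by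
  have hle := ((hf.isRelaxedSlope hm).const_mul c).relaxedSlope_le hm
  have hge := (((hf.const_mul hm c).isRelaxedSlope hm).const_mul c⁻¹).relaxedSlope_le hm
  simp only [inv_mul_cancel_left₀ hc] at hge
  filter_upwards [hle, hge] with x hxle hxge
  rw [abs_inv, inv_mul_eq_div, le_div_iff₀' (abs_pos.2 hc)] at hxge
  exact hxle.antisymm hxge

lemma relaxedSlope_neg (hm : BoundedlyFinite m) (hf : MemW12 m f) :
    relaxedSlope m (-f) =ᵐ[m] relaxedSlope m f := by
  convert! relaxedSlope_const_mul hm hf (c := -1) (by norm_num) using 3 with x x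
  · simp
  · simp

lemma relaxedSlope_sub_le (hm : BoundedlyFinite m) (hf : MemW12 m f) (hg : MemW12 m g) :
    relaxedSlope m (f - g) ≤ᵐ[m] relaxedSlope m f + relaxedSlope m g := by
  have hle := relaxedSlope_add_le hm hf (hg.neg hm)
  rw [← sub_eq_add_neg] at hle
  filter_upwards [hle, relaxedSlope_neg hm hg] with x hx hneg
  rwa [Pi.add_apply, hneg] at hx

/-- A smooth approximation of the identity, uniform as `a → ∞`, whose derivative vanishes at
`0`. -/
noncomputable def flatten (a z : ℝ) : ℝ := z - Real.arctan (a * z) / a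

lemma hasDerivAt_flatten {a : ℝ} (ha : a ≠ 0) (z : ℝ) :
    HasDerivAt (flatten a) (1 - (1 + (a * z) ^ 2)⁻¹) z := by
  have harctan : HasDerivAt (fun z => Real.arctan (a * z)) (1 / (1 + (a * z) ^ 2) * (a * 1)) z :=
    ((hasDerivAt_id z).const_mul a).arctan
  convert! (hasDerivAt_id z).sub (harctan.div_const a) using 2
  field_simp

lemma lipschitzWith_flatten {a : ℝ} (ha : a ≠ 0) : LipschitzWith 1 (flatten a) := by
  refine lipschitzWith_of_nnnorm_deriv_le
    (fun z => (hasDerivAt_flatten ha z).differentiableAt) fun z => ?_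
  rw [(hasDerivAt_flatten ha z).deriv, ← NNReal.coe_le_coe, coe_nnnorm, NNReal.coe_one,
    Real.norm_eq_abs, abs_le]
  have hpos : 0 < (1 + (a * z) ^ 2)⁻¹ := by positivity
  have hle : (1 + (a * z) ^ 2)⁻¹ ≤ 1 := inv_le_one_of_one_le₀ (by nlinarith [sq_nonneg (a * z)])
  constructor <;> linarith

lemma tendsto_flatten (z : ℝ) : Tendsto (fun a => flatten a z) atTop (𝓝 z) := by
  have hzero : Tendsto (fun a => Real.arctan (a * z) / a) atTop (𝓝 0) := by
    refine squeeze_zero_norm' ?_ (tendsto_const_nhds.div_atTop tendsto_id (a := Real.pi / 2))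
    filter_upwards [eventually_gt_atTop 0] with a ha
    rw [norm_div, Real.norm_of_nonneg ha.le, Real.norm_eq_abs, id]
    gcongr
    exact abs_le.2 ⟨(Real.neg_pi_div_two_lt_arctan _).le, (Real.arctan_lt_pi_div_two _).le⟩
  simpa [flatten] using tendsto_const_nhds.sub hzero

lemma tendsto_deriv_flatten (z : ℝ) :
    Tendsto (fun a : ℝ => 1 - (1 + (a * z) ^ 2)⁻¹) atTop (𝓝 (if z = 0 then 0 else 1)) := by
  split_ifs with hz
  · simp [hz]
  · have hatTop : Tendsto (fun a : ℝ => 1 + z ^ 2 * a ^ 2) atTop atTop :=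
      tendsto_atTop_add_const_left _ _
        ((tendsto_pow_atTop two_ne_zero).const_mul_atTop (by positivity))
    simpa [mul_pow, mul_comm] using hatTop.inv_tendsto_atTop.const_sub 1

lemma IsRelaxedSlope.mul_indicator_ne (hG : IsRelaxedSlope m f G) (c : ℝ) :
    IsRelaxedSlope m f (fun x => |if f x - c = 0 then 0 else 1| * G x) := by
  have ha : ∀ k : ℕ, (k : ℝ) + 1 ≠ 0 := fun k => by positivity
  have hatTop : Tendsto (fun k : ℕ => (k : ℝ) + 1) atTop atTop :=
    tendsto_atTop_add_const_right _ _ tendsto_natCast_atTop_atTop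
  let φ : ℕ → ℝ → ℝ := fun k z => flatten (k + 1) (z - c) - flatten (k + 1) (0 - c)
  let φ' : ℕ → ℝ → ℝ := fun k z => 1 - (1 + ((k + 1) * (z - c)) ^ 2)⁻¹
  have hφ : ∀ k, LipschitzWith 1 (φ k) := fun k =>
    LipschitzWith.of_dist_le_mul fun z w => by
      simpa [φ] using (lipschitzWith_flatten (ha k)).dist_le_mul (z - c) (w - c)
  have hφ0 : ∀ k, φ k 0 = 0 := fun k => sub_self _
  have hd : ∀ k z, HasDerivAt (φ k) (φ' k z) z := fun k z =>
    ((hasDerivAt_flatten (ha k) _).comp_sub_const z c).sub_const _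
  have hc : ∀ k, Continuous (φ' k) := fun k => continuous_const.sub
    (Continuous.inv₀ (by fun_prop) fun z => by positivity)
  have hφ' : ∀ k z, |φ' k z| ≤ 1 := fun k z => by
    simpa [(hd k z).deriv] using norm_deriv_le_of_lipschitz (x₀ := z) (hφ k)
  have hf := hG.memLp
  refine of_tendsto (fun k => hG.comp_of_hasDerivAt (hφ k) (hφ0 k) (hd k) (hc k)) ?_ ?_
  · refine TendstoLp.of_dominated ENNReal.ofNat_ne_top
      (fun k => (hφ k).continuous.comp_aestronglyMeasurable hf.1) hf.norm
      (fun k => ae_of_all _ fun x => ?_) (ae_of_all _ fun x => ?_)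
    · simpa [hφ0] using (hφ k).dist_le_mul (f x) 0
    · simpa [φ] using ((tendsto_flatten (f x - c)).comp hatTop).sub
        ((tendsto_flatten (0 - c)).comp hatTop)
  · exact (tendstoLp_const hG.memLp_slope _).bdd_mul ENNReal.ofNat_ne_top
      (fun k => (hc k).abs.comp_aestronglyMeasurable hf.1)
      (fun k x => (abs_abs _).trans_le (hφ' k _))
      (ae_of_all _ fun x => ((tendsto_deriv_flatten (f x - c)).comp hatTop).abs)

lemma relaxedSlope_eq_zero_of_mem (hm : BoundedlyFinite m) (hf : MemW12 m f) {s : Set ℝ}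
    (hs : s.Countable) : ∀ᵐ x ∂m, f x ∈ s → relaxedSlope m f x = 0 := by
  have hle : ∀ᵐ x ∂m, ∀ c ∈ s, relaxedSlope m f x ≤ _ := (ae_ball_iff hs).2 fun c _ =>
    ((hf.isRelaxedSlope hm).mul_indicator_ne c).relaxedSlope_le hm
  filter_upwards [hle, relaxedSlope_nonneg hm hf] with x hx h0 hfx
  have := hx (f x) hfx
  simp only [sub_self, if_true, abs_zero, zero_mul] at this
  exact this.antisymm h0

lemma relaxedSlope_eq_of_sub_mem (hm : BoundedlyFinite m) (hf : MemW12 m f) (hg : MemW12 m g)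
    {s : Set ℝ} (hs : s.Countable) :
    ∀ᵐ x ∂m, f x - g x ∈ s → relaxedSlope m f x = relaxedSlope m g x := by
  have hd := hf.sub hm hg
  have hle := relaxedSlope_add_le hm hg hd
  have hge := relaxedSlope_sub_le hm hf hd
  rw [add_sub_cancel] at hle
  rw [sub_sub_cancel] at hge
  filter_upwards [hle, hge, relaxedSlope_eq_zero_of_mem hm hd hs] with x hxle hxge hxd hx
  rw [Pi.add_apply, hxd hx, add_zero] at hxle hxge
  exact hxle.antisymm hxge

lemma relaxedSlope_eq_of_sub_mem_or_add_mem (hm : BoundedlyFinite m) (hf : MemW12 m f)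
    (hg : MemW12 m g) {s : Set ℝ} (hs : s.Countable) :
    ∀ᵐ x ∂m, f x - g x ∈ s ∨ f x + g x ∈ s → relaxedSlope m f x = relaxedSlope m g x := by
  filter_upwards [relaxedSlope_eq_of_sub_mem hm hf hg hs,
    relaxedSlope_eq_of_sub_mem hm hf (hg.neg hm) hs, relaxedSlope_neg hm hg]
    with x hsub hadd hneg hx
  rw [Pi.neg_apply, sub_neg_eq_add, hneg] at hadd
  exact hx.elim hsub hadd

end Calculus

section Sawtooth

/-- The triangular wave with slopes `±1` and period `a`. -/
noncomputable def sawtooth (a z : ℝ) : ℝ :=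
  Metric.infDist z (AddSubgroup.zmultiples a : Set ℝ)

lemma lipschitzWith_sawtooth (a : ℝ) : LipschitzWith 1 (sawtooth a) :=
  Metric.lipschitz_infDist_pt _

lemma sawtooth_zero (a : ℝ) : sawtooth a 0 = 0 :=
  Metric.infDist_zero_of_mem (zero_mem (AddSubgroup.zmultiples a))

lemma sawtooth_nonneg (a z : ℝ) : 0 ≤ sawtooth a z := Metric.infDist_nonneg

lemma sawtooth_le {a : ℝ} (ha : 0 < a) (z : ℝ) : sawtooth a z ≤ a := by
  have hmem : toIcoDiv ha 0 z • a ∈ (AddSubgroup.zmultiples a : Set ℝ) :=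
    AddSubgroup.zsmul_mem_zmultiples a _
  refine (Metric.infDist_le_dist_of_mem hmem).trans ?_
  obtain ⟨h0, ha⟩ := toIcoMod_mem_Ico ha 0 z
  rw [zero_add] at ha
  rw [Real.dist_eq, self_sub_toIcoDiv_zsmul, abs_of_nonneg h0]
  exact ha.le

lemma sawtooth_sub_mem_or_add_mem (a z : ℝ) :
    sawtooth a z - z ∈ AddSubgroup.zmultiples a ∨ sawtooth a z + z ∈ AddSubgroup.zmultiples a := by
  obtain ⟨y, hy, hzy⟩ := (AddSubgroup.isClosed_of_discrete (H := AddSubgroup.zmultiples a)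
    ).exists_infDist_eq_dist ⟨0, zero_mem _⟩ z
  rw [sawtooth, hzy, Real.dist_eq]
  rcases abs_cases (z - y) with ⟨h, -⟩ | ⟨h, -⟩
  · left
    rw [h, sub_sub_cancel_left]
    exact neg_mem hy
  · right
    rw [h, neg_sub, sub_add_cancel]
    exact hy

lemma countable_zmultiples (a : ℝ) : (AddSubgroup.zmultiples a : Set ℝ).Countable := by
  rw [AddSubgroup.coe_zmultiples]
  exact countable_range _

lemma tendstoLp_sawtooth {α : Type*} [MeasurableSpace α] {μ : Measure α} {f : α → ℝ}
    {a : ℕ → ℝ} (hf : MemLp f 2 μ) (ha : ∀ n, 0 < a n) (ha0 : Tendsto a atTop (𝓝 0)) :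
    TendstoLp 2 μ (fun n x => sawtooth (a n) (f x)) atTop 0 := by
  refine TendstoLp.of_dominated ENNReal.ofNat_ne_top
    (fun n => (lipschitzWith_sawtooth (a n)).continuous.comp_aestronglyMeasurable hf.1) hf.norm
    (fun n => ae_of_all _ fun x => ?_) (ae_of_all _ fun x => ?_)
  · simpa [sawtooth_zero] using (lipschitzWith_sawtooth (a n)).dist_le_mul (f x) 0
  · exact squeeze_zero (fun n => sawtooth_nonneg (a n) (f x))
      (fun n => sawtooth_le (ha n) (f x)) ha0

end Sawtooth

section Parallelogram

lemma integral_add_sq_add_integral_sub_sq {α : Type*} [MeasurableSpace α] {μ : Measure α}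
    {f g : α → ℝ} (hf : MemLp f 2 μ) (hg : MemLp g 2 μ) :
    ∫ x, (f + g) x ^ 2 ∂μ + ∫ x, (f - g) x ^ 2 ∂μ
      = 2 * ∫ x, f x ^ 2 ∂μ + 2 * ∫ x, g x ^ 2 ∂μ := by
  rw [← integral_add (hf.add hg).integrable_sq (hf.sub hg).integrable_sq, ← integral_const_mul,
    ← integral_const_mul, ← integral_add (hf.integrable_sq.const_mul 2)
      (hg.integrable_sq.const_mul 2)]
  refine integral_congr_ae (ae_of_all _ fun x => ?_)
  simp only [Pi.add_apply, Pi.sub_apply]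
  ring

variable {X : Type*} [MetricSpace X] [MeasurableSpace X] [BorelSpace X] {m : Measure X}
  {f g v ψ : X → ℝ} {K : ℝ≥0}

lemma MemW12.sawtooth (hm : BoundedlyFinite m) (hf : MemW12 m f) (a : ℝ) :
    MemW12 m (fun x => sawtooth a (f x)) :=
  ((hf.isRelaxedSlope hm).comp_lipschitz (lipschitzWith_sawtooth a) (sawtooth_zero a)).memW12 hm

lemma relaxedSlope_sawtooth (hm : BoundedlyFinite m) (hf : MemW12 m f) (a : ℝ) :
    relaxedSlope m (fun x => sawtooth a (f x)) =ᵐ[m] relaxedSlope m f := by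
  filter_upwards [relaxedSlope_eq_of_sub_mem_or_add_mem hm (hf.sawtooth hm a) hf
    (s := AddSubgroup.zmultiples a) (countable_zmultiples a)] with x hx
  exact hx (sawtooth_sub_mem_or_add_mem a (f x))

lemma dirichlet_parallelogram (hm : BoundedlyFinite m) (hH : InfinitesimallyHilbertian m)
    (hf : MemW12 m f) (hg : MemW12 m g) :
    dirichlet m (f + g) + dirichlet m (f - g) = 2 * dirichlet m f + 2 * dirichlet m g := by
  have hnorm : ∀ u : X → ℝ, MemW12 m u →
      w12Norm m u ^ 2 = ∫ x, u x ^ 2 ∂m + dirichlet m u := fun u hu => by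
    rw [w12Norm, Real.sq_sqrt (by positivity), eLpNorm_two_toReal_sq hu.1, dirichlet]
  have hpar := hH f g hf hg
  rw [hnorm _ (hf.add hm hg), hnorm _ (hf.sub hm hg), hnorm f hf, hnorm g hg] at hpar
  linarith [integral_add_sq_add_integral_sub_sq hf.1 hg.1]

lemma MemW12.mul_lipschitz (hm : BoundedlyFinite m) (hv : MemW12 m v) (hψ : LipschitzWith K ψ)
    (h0 : ∀ y, 0 ≤ ψ y) (h1 : ∀ y, ψ y ≤ 1) : MemW12 m (fun x => ψ x * v x) :=
  ((hv.isRelaxedSlope hm).mul_lipschitz hψ h0 h1).memW12 hm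

/-- The reverse Leibniz inequality is the direct one for `1 - ψ`, as `v = ψ v + (1 - ψ) v`. -/
lemma abs_relaxedSlope_mul_sub_le (hm : BoundedlyFinite m) (hv : MemW12 m v)
    (hψ : LipschitzWith K ψ) (h0 : ∀ y, 0 ≤ ψ y) (h1 : ∀ y, ψ y ≤ 1) :
    ∀ᵐ x ∂m, |relaxedSlope m (fun x => ψ x * v x) x - ψ x * relaxedSlope m v x| ≤ K * |v x| := by
  have hψ' : LipschitzWith K fun x => 1 - ψ x := by
    simpa using (LipschitzWith.const (1 : ℝ)).sub hψ
  have hcompl0 : ∀ y, 0 ≤ 1 - ψ y := fun y => sub_nonneg.2 (h1 y)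
  have hcompl1 : ∀ y, 1 - ψ y ≤ 1 := fun y => sub_le_self _ (h0 y)
  have hD := hv.isRelaxedSlope hm
  have hsum := relaxedSlope_add_le hm (hv.mul_lipschitz hm hψ h0 h1)
    (hv.mul_lipschitz hm hψ' hcompl0 hcompl1)
  have hsplit : (fun x => ψ x * v x) + (fun x => (1 - ψ x) * v x) = v := by
    ext x
    simp only [Pi.add_apply]
    ring
  rw [hsplit] at hsum
  filter_upwards [(hD.mul_lipschitz hψ h0 h1).relaxedSlope_le hm,
    (hD.mul_lipschitz hψ' hcompl0 hcompl1).relaxedSlope_le hm, hsum] with x hle hle' hsum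
  rw [Pi.add_apply] at hsum
  rw [abs_le]
  constructor <;> linarith

lemma abs_relaxedSlope_mul_sq_sub_le (hm : BoundedlyFinite m) (hv : MemW12 m v)
    (hψ : LipschitzWith K ψ) (h0 : ∀ y, 0 ≤ ψ y) (h1 : ∀ y, ψ y ≤ 1) :
    ∀ᵐ x ∂m, |relaxedSlope m (fun x => ψ x * v x) x ^ 2 - ψ x ^ 2 * relaxedSlope m v x ^ 2|
      ≤ K * |v x| * (2 * relaxedSlope m v x + K * |v x|) := by
  filter_upwards [abs_relaxedSlope_mul_sub_le hm hv hψ h0 h1, relaxedSlope_nonneg hm hv,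
    relaxedSlope_nonneg hm (hv.mul_lipschitz hm hψ h0 h1)] with x hx hD hd
  have hψD : 0 ≤ ψ x * relaxedSlope m v x := mul_nonneg (h0 x) hD
  have hψD' : ψ x * relaxedSlope m v x ≤ relaxedSlope m v x := mul_le_of_le_one_left hD (h1 x)
  rw [← mul_pow, sq_sub_sq, mul_comm, abs_mul]
  refine mul_le_mul hx ?_ (abs_nonneg _) (by positivity)
  rw [abs_of_nonneg (add_nonneg hd hψD)]
  linarith [(abs_le.1 hx).2]

lemma MemW12.integrable_sq_mul_relaxedSlope_sq (hm : BoundedlyFinite m) (hv : MemW12 m v)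
    (hψ : Continuous ψ) (h0 : ∀ y, 0 ≤ ψ y) (h1 : ∀ y, ψ y ≤ 1) :
    Integrable (fun x => ψ x ^ 2 * relaxedSlope m v x ^ 2) m := by
  refine (hv.memLp_relaxedSlope hm).integrable_sq.bdd_mul (c := 1)
    (hψ.pow 2).measurable.aestronglyMeasurable (ae_of_all _ fun x => ?_)
  rw [Real.norm_of_nonneg (sq_nonneg _)]
  exact pow_le_one₀ (h0 x) (h1 x)

lemma tendsto_dirichlet_mul_sub_integral (hm : BoundedlyFinite m) {v : ℕ → X → ℝ} {F : X → ℝ}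
    (hv : ∀ n, MemW12 m (v n)) (hv0 : TendstoLp 2 m v atTop 0) (hF : MemLp F 2 m)
    (hvF : ∀ n, relaxedSlope m (v n) ≤ᵐ[m] F) (hψ : LipschitzWith K ψ) (h0 : ∀ y, 0 ≤ ψ y)
    (h1 : ∀ y, ψ y ≤ 1) :
    Tendsto (fun n => dirichlet m (fun x => ψ x * v n x)
      - ∫ x, ψ x ^ 2 * relaxedSlope m (v n) x ^ 2 ∂m) atTop (𝓝 0) := by
  have herror : TendstoLp 1 m (fun n x => K * |v n x| * (2 * F x + K * |v n x|)) atTop 0 := by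
    have hKv := hv0.abs.const_mul K
    have hprod := hKv.mul ((tendstoLp_const (hF.const_mul 2) _).add hKv) (r := 1)
    simpa only [Pi.zero_apply, abs_zero, mul_zero, zero_mul] using! hprod
  have hlim := herror.tendsto_integral
  simp only [Pi.zero_apply, integral_zero] at hlim
  refine squeeze_zero_norm' ?_ hlim
  filter_upwards [herror.eventually_memLp] with n hn
  have hmul := (hv n).mul_lipschitz hm hψ h0 h1
  have hint := (hv n).integrable_sq_mul_relaxedSlope_sq hm hψ.continuous h0 h1
  have hsq := (hmul.memLp_relaxedSlope hm).integrable_sq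
  rw [hmul.dirichlet_eq_integral hm, ← integral_sub hsq hint]
  refine (norm_integral_le_integral_norm _).trans
    (integral_mono_ae (hsq.sub hint).norm (memLp_one_iff_integrable.1 hn) ?_)
  filter_upwards [abs_relaxedSlope_mul_sq_sub_le hm (hv n) hψ h0 h1, hvF n] with x hx hxF
  exact hx.trans (by gcongr)

/-- The failure of the pointwise parallelogram rule for the minimal relaxed slopes. -/
noncomputable def parallelogramDefect (m : Measure X) (f g : X → ℝ) (x : X) : ℝ :=
  relaxedSlope m (f + g) x ^ 2 + relaxedSlope m (f - g) x ^ 2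
    - (2 * relaxedSlope m f x ^ 2 + 2 * relaxedSlope m g x ^ 2)

lemma integrable_parallelogramDefect (hm : BoundedlyFinite m) (hf : MemW12 m f)
    (hg : MemW12 m g) : Integrable (parallelogramDefect m f g) m :=
  ((((hf.add hm hg).memLp_relaxedSlope hm).integrable_sq.add
    ((hf.sub hm hg).memLp_relaxedSlope hm).integrable_sq).sub
    (((hf.memLp_relaxedSlope hm).integrable_sq.const_mul 2).add
      ((hg.memLp_relaxedSlope hm).integrable_sq.const_mul 2)))

lemma integral_sq_mul_parallelogramDefect (hm : BoundedlyFinite m) (hf : MemW12 m f)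
    (hg : MemW12 m g) (hψ : Continuous ψ) (h0 : ∀ y, 0 ≤ ψ y) (h1 : ∀ y, ψ y ≤ 1) :
    ∫ x, ψ x ^ 2 * parallelogramDefect m f g x ∂m =
      ∫ x, ψ x ^ 2 * relaxedSlope m (f + g) x ^ 2 ∂m
        + ∫ x, ψ x ^ 2 * relaxedSlope m (f - g) x ^ 2 ∂m
        - (2 * ∫ x, ψ x ^ 2 * relaxedSlope m f x ^ 2 ∂m
          + 2 * ∫ x, ψ x ^ 2 * relaxedSlope m g x ^ 2 ∂m) := by
  have hint : ∀ v : X → ℝ, MemW12 m v →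
      Integrable (fun x => ψ x ^ 2 * relaxedSlope m v x ^ 2) m :=
    fun v hv => hv.integrable_sq_mul_relaxedSlope_sq hm hψ h0 h1
  have hadd := hint _ (hf.add hm hg)
  have hsub := hint _ (hf.sub hm hg)
  have hf2 := (hint f hf).const_mul 2
  have hg2 := (hint g hg).const_mul 2
  rw [← integral_const_mul, ← integral_const_mul, ← integral_add' hadd hsub,
    ← integral_add' hf2 hg2, ← integral_sub' (hadd.add hsub) (hf2.add hg2)]
  refine integral_congr_ae (ae_of_all _ fun x => ?_)
  simp only [parallelogramDefect, Pi.add_apply, Pi.sub_apply]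
  ring

lemma tendsto_integral_sq_mul_parallelogramDefect (hm : BoundedlyFinite m)
    (hH : InfinitesimallyHilbertian m) {u v : ℕ → X → ℝ} {F G : X → ℝ}
    (hu : ∀ n, MemW12 m (u n)) (hu0 : TendstoLp 2 m u atTop 0) (hF : MemLp F 2 m)
    (huF : ∀ n, relaxedSlope m (u n) ≤ᵐ[m] F)
    (hv : ∀ n, MemW12 m (v n)) (hv0 : TendstoLp 2 m v atTop 0) (hG : MemLp G 2 m)
    (hvG : ∀ n, relaxedSlope m (v n) ≤ᵐ[m] G)
    (hψ : LipschitzWith K ψ) (h0 : ∀ y, 0 ≤ ψ y) (h1 : ∀ y, ψ y ≤ 1) :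
    Tendsto (fun n => ∫ x, ψ x ^ 2 * parallelogramDefect m (u n) (v n) x ∂m) atTop (𝓝 0) := by
  have hadd0 : TendstoLp 2 m (fun n => u n + v n) atTop 0 := by simpa using! hu0.add hv0
  have hsub0 : TendstoLp 2 m (fun n => u n - v n) atTop 0 := by simpa using! hu0.sub hv0
  have haddFG : ∀ n, relaxedSlope m (u n + v n) ≤ᵐ[m] F + G := fun n =>
    (relaxedSlope_add_le hm (hu n) (hv n)).trans (EventuallyLE.add_le_add (huF n) (hvG n))
  have hsubFG : ∀ n, relaxedSlope m (u n - v n) ≤ᵐ[m] F + G := fun n =>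
    (relaxedSlope_sub_le hm (hu n) (hv n)).trans (EventuallyLE.add_le_add (huF n) (hvG n))
  have hlim := ((tendsto_dirichlet_mul_sub_integral hm hu hu0 hF huF hψ h0 h1).const_mul 2).add
    ((tendsto_dirichlet_mul_sub_integral hm hv hv0 hG hvG hψ h0 h1).const_mul 2) |>.sub
    ((tendsto_dirichlet_mul_sub_integral hm (fun n => (hu n).add hm (hv n)) hadd0 (hF.add hG)
      haddFG hψ h0 h1).add
    (tendsto_dirichlet_mul_sub_integral hm (fun n => (hu n).sub hm (hv n)) hsub0 (hF.add hG)
      hsubFG hψ h0 h1))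
  simp only [mul_zero, add_zero, sub_zero] at hlim
  refine hlim.congr fun n => ?_
  have hpar := dirichlet_parallelogram hm hH ((hu n).mul_lipschitz hm hψ h0 h1)
    ((hv n).mul_lipschitz hm hψ h0 h1)
  have hmul_add : (fun x => ψ x * u n x) + (fun x => ψ x * v n x)
      = fun x => ψ x * (u n + v n) x := funext fun x => (mul_add _ _ _).symm
  have hmul_sub : (fun x => ψ x * u n x) - (fun x => ψ x * v n x)
      = fun x => ψ x * (u n - v n) x := funext fun x => (mul_sub _ _ _).symm
  rw [hmul_add, hmul_sub] at hpar
  rw [integral_sq_mul_parallelogramDefect hm (hu n) (hv n) hψ.continuous h0 h1]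
  linarith

lemma parallelogramDefect_sawtooth (hm : BoundedlyFinite m) (hf : MemW12 m f) (hg : MemW12 m g)
    (a : ℝ) :
    parallelogramDefect m (fun x => sawtooth a (f x)) (fun x => sawtooth a (g x))
      =ᵐ[m] parallelogramDefect m f g := by
  have hs := countable_zmultiples a
  have hf' := hf.sawtooth hm a
  have hg' := hg.sawtooth hm a
  have hadd := hf'.add hm hg'
  have hsub := hf'.sub hm hg'
  filter_upwards [relaxedSlope_sawtooth hm hf a, relaxedSlope_sawtooth hm hg a,
    relaxedSlope_eq_of_sub_mem_or_add_mem hm hadd (hf.add hm hg) hs,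
    relaxedSlope_eq_of_sub_mem_or_add_mem hm hadd (hf.sub hm hg) hs,
    relaxedSlope_eq_of_sub_mem_or_add_mem hm hsub (hf.add hm hg) hs,
    relaxedSlope_eq_of_sub_mem_or_add_mem hm hsub (hf.sub hm hg) hs]
    with x hfx hgx hadd_add hadd_sub hsub_add hsub_sub
  simp only [Pi.add_apply, Pi.sub_apply, SetLike.mem_coe] at hadd_add hadd_sub hsub_add hsub_sub
  simp only [parallelogramDefect, hfx, hgx]
  rcases sawtooth_sub_mem_or_add_mem a (f x) with hk | hk <;>
    rcases sawtooth_sub_mem_or_add_mem a (g x) with hl | hl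
  · rw [hadd_add (.inl (by convert! add_mem hk hl using 1; ring)),
      hsub_sub (.inl (by convert! sub_mem hk hl using 1; ring))]
  · rw [hadd_sub (.inl (by convert! add_mem hk hl using 1; ring)),
      hsub_add (.inl (by convert! sub_mem hk hl using 1; ring))]
    ring
  · rw [hadd_sub (.inr (by convert! add_mem hk hl using 1; ring)),
      hsub_add (.inr (by convert! sub_mem hk hl using 1; ring))]
    ring
  · rw [hadd_add (.inr (by convert! add_mem hk hl using 1; ring)),
      hsub_sub (.inr (by convert! sub_mem hk hl using 1; ring))]

lemma integral_sq_mul_parallelogramDefect_eq_zero (hm : BoundedlyFinite m)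
    (hH : InfinitesimallyHilbertian m) (hf : MemW12 m f) (hg : MemW12 m g)
    (hψ : LipschitzWith K ψ) (h0 : ∀ y, 0 ≤ ψ y) (h1 : ∀ y, ψ y ≤ 1) :
    ∫ x, ψ x ^ 2 * parallelogramDefect m f g x ∂m = 0 := by
  have ha : ∀ n : ℕ, 0 < 1 / ((n : ℝ) + 1) := fun n => Nat.one_div_pos_of_nat
  have ha0 := tendsto_one_div_add_atTop_nhds_zero_nat (𝕜 := ℝ)
  have hlim := tendsto_integral_sq_mul_parallelogramDefect hm hH
    (fun n : ℕ => hf.sawtooth hm (1 / (n + 1))) (tendstoLp_sawtooth hf.1 ha ha0)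
    (hf.memLp_relaxedSlope hm) (fun n => (relaxedSlope_sawtooth hm hf _).le)
    (fun n : ℕ => hg.sawtooth hm (1 / (n + 1))) (tendstoLp_sawtooth hg.1 ha ha0)
    (hg.memLp_relaxedSlope hm) (fun n => (relaxedSlope_sawtooth hm hg _).le) hψ h0 h1
  refine tendsto_nhds_unique (tendsto_const_nhds.congr fun n => integral_congr_ae ?_) hlim
  filter_upwards [parallelogramDefect_sawtooth hm hf hg (1 / (n + 1))] with x hx
  rw [hx]

lemma parallelogramDefect_ae_eq_zero (hm : BoundedlyFinite m) (hH : InfinitesimallyHilbertian m)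
    (hf : MemW12 m f) (hg : MemW12 m g) : parallelogramDefect m f g =ᵐ[m] 0 := by
  have hint := integrable_parallelogramDefect hm hf hg
  have hpos := ae_nonneg_of_forall_lipschitz hint two_ne_zero fun ψ K hK h0 h1 =>
    (integral_sq_mul_parallelogramDefect_eq_zero hm hH hf hg hK h0 h1).ge
  have hneg := ae_nonneg_of_forall_lipschitz hint.neg two_ne_zero fun ψ K hK h0 h1 => by
    simp only [Pi.neg_apply, mul_neg, integral_neg,
      integral_sq_mul_parallelogramDefect_eq_zero hm hH hf hg hK h0 h1, neg_zero, le_refl]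
  filter_upwards [hpos, hneg] with x hx hx'
  exact (neg_nonneg.1 hx').antisymm hx

lemma gradInner_neg_left (hm : BoundedlyFinite m) (hH : InfinitesimallyHilbertian m)
    (hf : MemW12 m f) (hg : MemW12 m g) : gradInner m (-g) f =ᵐ[m] -gradInner m g f := by
  have hsub := relaxedSlope_neg hm (hg.sub hm hf)
  rw [neg_sub, sub_eq_neg_add] at hsub
  filter_upwards [parallelogramDefect_ae_eq_zero hm hH hg hf, hsub, relaxedSlope_neg hm hg]
    with x hdefect hxsub hxneg
  simp only [parallelogramDefect, Pi.zero_apply] at hdefect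
  simp only [gradInner, Pi.neg_apply, hxsub, hxneg]
  linarith

lemma relaxedSlope_add_natCast_mul_sq (hm : BoundedlyFinite m) (hH : InfinitesimallyHilbertian m)
    (hf : MemW12 m f) (hg : MemW12 m g) (k : ℕ) :
    ∀ᵐ x ∂m, relaxedSlope m (g + fun x => k * f x) x ^ 2
      = relaxedSlope m g x ^ 2 + 2 * k * gradInner m g f x + k ^ 2 * relaxedSlope m f x ^ 2 := by
  induction k using Nat.twoStepInduction with
  | zero =>
    have hzero : (g + fun x => ((0 : ℕ) : ℝ) * f x) = g := by ext x; simp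
    refine ae_of_all _ fun x => ?_
    rw [hzero]
    push_cast
    ring
  | one =>
    have hone : (g + fun x => ((1 : ℕ) : ℝ) * f x) = g + f := by ext x; simp
    refine ae_of_all _ fun x => ?_
    rw [hone, gradInner]
    push_cast
    ring
  | more k ih ih' =>
    have hdefect := parallelogramDefect_ae_eq_zero hm hH
      (hg.add hm (hf.const_mul hm (k + 1 : ℕ))) hf
    have hadd : (g + fun x => ((k + 1 : ℕ) : ℝ) * f x) + f
        = g + fun x => ((k + 2 : ℕ) : ℝ) * f x := by
      ext x; simp only [Pi.add_apply]; push_cast; ring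
    have hsub : (g + fun x => ((k + 1 : ℕ) : ℝ) * f x) - f = g + fun x => (k : ℝ) * f x := by
      ext x; simp only [Pi.add_apply, Pi.sub_apply]; push_cast; ring
    filter_upwards [hdefect, ih, ih'] with x hx hk hk'
    simp only [parallelogramDefect, Pi.zero_apply, hadd, hsub, hk, hk'] at hx
    push_cast at hx ⊢
    linear_combination hx

lemma relaxedSlope_add_inv_natCast_mul_sq (hm : BoundedlyFinite m)
    (hH : InfinitesimallyHilbertian m) (hf : MemW12 m f) (hg : MemW12 m g) {k : ℕ} (hk : k ≠ 0) :
    ∀ᵐ x ∂m, relaxedSlope m (f + fun x => (k : ℝ)⁻¹ * g x) x ^ 2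
      = relaxedSlope m f x ^ 2 + 2 * (k : ℝ)⁻¹ * gradInner m g f x
        + (k : ℝ)⁻¹ ^ 2 * relaxedSlope m g x ^ 2 := by
  have hk0 : (k : ℝ) ≠ 0 := Nat.cast_ne_zero.2 hk
  have hscale := relaxedSlope_const_mul hm (hg.add hm (hf.const_mul hm k)) (inv_ne_zero hk0)
  have hfactor : (fun x => (k : ℝ)⁻¹ * (g + fun x => (k : ℝ) * f x) x)
      = f + fun x => (k : ℝ)⁻¹ * g x := by
    ext x
    simp only [Pi.add_apply]
    field_simp
    ring
  rw [hfactor] at hscale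
  filter_upwards [hscale, relaxedSlope_add_natCast_mul_sq hm hH hf hg k] with x hx hx'
  rw [hx, mul_pow, hx', sq_abs]
  field_simp
  ring

end Parallelogram

section SpeedBound

variable {X : Type*} [MetricSpace X] {Γ : ℝ → X} {g v φ : ℝ → ℝ} {a b c d t : ℝ}

lemma ae_uIcc_mem_nhds (a b : ℝ) : ∀ᵐ t, t ∈ uIcc a b → uIcc a b ∈ 𝓝 t := by
  filter_upwards [Measure.ae_ne volume (min a b), Measure.ae_ne volume (max a b)]
    with t hmin hmax ht
  exact Icc_mem_nhds (lt_of_le_of_ne' ht.1 hmin) (lt_of_le_of_ne ht.2 hmax)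

lemma tendsto_abs_sub_div_abs_sub (h : HasDerivAt φ d t) :
    Tendsto (fun s => |φ s - φ t| / |s - t|) (𝓝[≠] t) (𝓝 |d|) :=
  (hasDerivAt_iff_tendsto_slope.1 h).abs.congr fun s => by rw [slope_def_field, abs_div]

/-- The displacement of the curve `Γ` on `[a, b]` is controlled by the integral of `g`. The order of
the endpoints, and of `s` and `t`, is irrelevant. -/
structure HasSpeedBound (Γ : ℝ → X) (g : ℝ → ℝ) (a b : ℝ) : Prop where
  intervalIntegrable : IntervalIntegrable g volume a b
  dist_le : ∀ s ∈ uIcc a b, ∀ t ∈ uIcc a b, dist (Γ s) (Γ t) ≤ |∫ r in s..t, g r|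

namespace HasSpeedBound

lemma congr (h : HasSpeedBound Γ g a b) (hgv : ∀ᵐ t, t ∈ uIcc a b → g t = v t) :
    HasSpeedBound Γ v a b where
  intervalIntegrable := h.intervalIntegrable.congr_ae <| by
    rw [EventuallyEq, ae_restrict_iff' measurableSet_uIoc]
    filter_upwards [hgv] with t ht hmem using ht (uIoc_subset_uIcc hmem)
  dist_le s hs t ht := (h.dist_le s hs t ht).trans_eq <| by
    congr 1
    refine intervalIntegral.integral_congr_ae ?_
    filter_upwards [hgv] with r hr hmem
    exact hr (uIcc_subset_uIcc hs ht (uIoc_subset_uIcc hmem))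

lemma comp_lipschitz {Y : Type*} [MetricSpace Y] {u : X → Y} {K : ℝ≥0} (h : HasSpeedBound Γ g a b)
    (hu : LipschitzWith K u) : HasSpeedBound (u ∘ Γ) (fun t => K * g t) a b where
  intervalIntegrable := h.intervalIntegrable.const_mul K
  dist_le s hs t ht := by
    rw [intervalIntegral.integral_const_mul, abs_mul, NNReal.abs_eq]
    exact (hu.dist_le_mul _ _).trans (by gcongr; exact h.dist_le s hs t ht)

lemma dist_le_abs_sub (h : HasSpeedBound Γ g a b) {s : ℝ} (hs : s ∈ uIcc a b)
    (ht : t ∈ uIcc a b) :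
    dist (Γ s) (Γ t) ≤ |(∫ r in a..s, g r) - ∫ r in a..t, g r| := by
  rw [intervalIntegral.integral_interval_sub_left
    (h.intervalIntegrable.mono_set (uIcc_subset_uIcc_left hs))
    (h.intervalIntegrable.mono_set (uIcc_subset_uIcc_left ht)), dist_comm]
  exact h.dist_le t ht s hs

lemma absolutelyContinuousOnInterval (h : HasSpeedBound Γ g a b) :
    AbsolutelyContinuousOnInterval Γ a b := by
  have hprim := h.intervalIntegrable.absolutelyContinuousOnInterval_intervalIntegral left_mem_uIcc
  refine squeeze_zero' (Eventually.of_forall fun E => Finset.sum_nonneg fun _ _ => dist_nonneg)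
    ?_ hprim
  rw [eventually_inf_principal]
  filter_upwards with E hE
  exact Finset.sum_le_sum fun i hi => h.dist_le_abs_sub (hE.1 i hi).1 (hE.1 i hi).2

lemma ae_eventually_lt (h : HasSpeedBound Γ g a b) :
    ∀ᵐ t, t ∈ uIcc a b → ∀ c, |g t| < c →
      ∀ᶠ s in 𝓝[≠] t, dist (Γ s) (Γ t) / |s - t| < c := by
  filter_upwards [ae_uIcc_mem_nhds a b, h.intervalIntegrable.ae_hasDerivAt_integral]
    with t hnhds hderiv ht c hc
  filter_upwards [(tendsto_abs_sub_div_abs_sub (hderiv ht a left_mem_uIcc)).eventually_lt_const hc,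
    mem_nhdsWithin_of_mem_nhds (hnhds ht)] with s hlt hs
  refine lt_of_le_of_lt ?_ hlt
  gcongr
  exact h.dist_le_abs_sub hs ht

lemma ae_abs_deriv_le (h : HasSpeedBound φ g a b) :
    ∀ᵐ t, t ∈ uIcc a b → |deriv φ t| ≤ |g t| := by
  filter_upwards [h.ae_eventually_lt] with t hlt ht
  by_cases hφ : DifferentiableAt ℝ φ t
  · refine le_of_forall_gt fun c hc => ?_
    obtain ⟨e, hge, hec⟩ := exists_between hc
    refine (le_of_tendsto (tendsto_abs_sub_div_abs_sub hφ.hasDerivAt) ?_).trans_lt hec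
    filter_upwards [hlt ht e hge] with s hs using hs.le
  · rw [deriv_zero_of_not_differentiableAt hφ, abs_zero]
    exact abs_nonneg _

end HasSpeedBound

/-- The supremum of the absolute derivatives of the distances from the points `x n`. When these
points are dense, it is a.e. the metric speed of `Γ`. -/
noncomputable def distSpeed (x : ℕ → X) (Γ : ℝ → X) (t : ℝ) : ℝ :=
  ⨆ n, |deriv (fun s => dist (Γ s) (x n)) t|

lemma distSpeed_nonneg (x : ℕ → X) (Γ : ℝ → X) (t : ℝ) : 0 ≤ distSpeed x Γ t :=
  Real.iSup_nonneg fun _ => abs_nonneg _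

lemma measurable_distSpeed (x : ℕ → X) (Γ : ℝ → X) : Measurable (distSpeed x Γ) :=
  Measurable.iSup fun _ => (measurable_deriv _).abs

namespace HasSpeedBound

lemma dist_right (h : HasSpeedBound Γ g a b) (y : X) :
    HasSpeedBound (fun t => dist (Γ t) y) g a b := by
  simpa [Function.comp_def] using h.comp_lipschitz (LipschitzWith.dist_left y)

lemma ae_abs_deriv_dist_le (h : HasSpeedBound Γ g a b) (x : ℕ → X) :
    ∀ᵐ t, t ∈ uIcc a b → ∀ n, |deriv (fun s => dist (Γ s) (x n)) t| ≤ |g t| := by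
  filter_upwards [ae_all_iff.2 fun n => (h.dist_right (x n)).ae_abs_deriv_le] with t ht hmem n
  exact ht n hmem

lemma ae_abs_deriv_dist_le_distSpeed (h : HasSpeedBound Γ g a b) (x : ℕ → X) :
    ∀ᵐ t, t ∈ uIcc a b → ∀ n, |deriv (fun s => dist (Γ s) (x n)) t| ≤ distSpeed x Γ t := by
  filter_upwards [h.ae_abs_deriv_dist_le x] with t ht hmem n
  exact le_ciSup (f := fun n => |deriv (fun s => dist (Γ s) (x n)) t|)
    ⟨|g t|, forall_mem_range.2 (ht hmem)⟩ n

lemma intervalIntegrable_distSpeed (h : HasSpeedBound Γ g a b) (x : ℕ → X) :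
    IntervalIntegrable (distSpeed x Γ) volume a b := by
  refine h.intervalIntegrable.abs.mono_fun (measurable_distSpeed x Γ).aestronglyMeasurable ?_
  rw [EventuallyLE, ae_restrict_iff' measurableSet_uIoc]
  filter_upwards [h.ae_abs_deriv_dist_le x] with t ht hmem
  rw [Real.norm_of_nonneg (distSpeed_nonneg x Γ t), Real.norm_of_nonneg (abs_nonneg _)]
  exact ciSup_le (ht (uIoc_subset_uIcc hmem))

lemma dist_sub_dist_le (h : HasSpeedBound Γ g a b) (x : ℕ → X) {s : ℝ} (hs : s ∈ uIcc a b)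
    (ht : t ∈ uIcc a b) (n : ℕ) :
    dist (Γ t) (x n) - dist (Γ s) (x n) ≤ |∫ r in s..t, distSpeed x Γ r| := by
  have hsub := uIcc_subset_uIcc hs ht
  have hAC := (h.dist_right (x n)).absolutelyContinuousOnInterval.mono hsub
  rw [← hAC.integral_deriv_eq_sub]
  refine (Real.le_norm_self _).trans (intervalIntegral.norm_integral_le_abs_of_norm_le ?_
    ((h.intervalIntegrable_distSpeed x).mono_set hsub))
  rw [ae_restrict_iff' measurableSet_uIoc]
  filter_upwards [h.ae_abs_deriv_dist_le_distSpeed x] with r hr hmem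
  exact hr (hsub (uIoc_subset_uIcc hmem)) n

lemma hasSpeedBound_distSpeed (h : HasSpeedBound Γ g a b) {x : ℕ → X} (hx : DenseRange x) :
    HasSpeedBound Γ (distSpeed x Γ) a b where
  intervalIntegrable := h.intervalIntegrable_distSpeed x
  dist_le s hs t ht := by
    refine le_of_forall_pos_le_add fun ε hε => ?_
    obtain ⟨n, hn⟩ := hx.exists_dist_lt (Γ s) (half_pos hε)
    have hle := h.dist_sub_dist_le x hs ht n
    have htri := dist_triangle_right (Γ s) (Γ t) (x n)
    linarith

lemma ae_tendsto_distSpeed (h : HasSpeedBound Γ g a b) {x : ℕ → X} (hx : DenseRange x) :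
    ∀ᵐ t, t ∈ uIcc a b →
      Tendsto (fun s => dist (Γ s) (Γ t) / |s - t|) (𝓝[≠] t) (𝓝 (distSpeed x Γ t)) := by
  filter_upwards [(h.hasSpeedBound_distSpeed hx).ae_eventually_lt, ae_all_iff.2 fun n =>
    (h.dist_right (x n)).absolutelyContinuousOnInterval.ae_differentiableAt] with t hlt hdiff ht
  rw [abs_of_nonneg (distSpeed_nonneg x Γ t)] at hlt
  refine tendsto_order.2 ⟨fun c hc => ?_, hlt ht⟩
  obtain ⟨n, hn⟩ := exists_lt_of_lt_ciSup hc
  filter_upwards [(tendsto_abs_sub_div_abs_sub (hdiff n ht).hasDerivAt).eventually_const_lt hn]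
    with s hs
  refine hs.trans_le ?_
  gcongr
  exact abs_dist_sub_le _ _ _

lemma exists_metricDerivative [SecondCountableTopology X] (h : HasSpeedBound Γ g a b) :
    ∃ v : ℝ → ℝ, HasSpeedBound Γ v a b ∧ ∀ᵐ t, t ∈ uIcc a b →
      Tendsto (fun s => dist (Γ s) (Γ t) / |s - t|) (𝓝[≠] t) (𝓝 (v t)) := by
  have : Nonempty X := ⟨Γ 0⟩
  have hdense := TopologicalSpace.denseRange_denseSeq X
  exact ⟨_, h.hasSpeedBound_distSpeed hdense, h.ae_tendsto_distSpeed hdense⟩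

end HasSpeedBound

lemma abs_deriv_comp_le {u : X → ℝ} {K : ℝ≥0} (hu : LipschitzWith K u) (hΓ : ContinuousAt Γ t)
    (hc : Tendsto (fun s => dist (Γ s) (Γ t) / |s - t|) (𝓝[≠] t) (𝓝 c))
    (hd : HasDerivAt (fun s => u (Γ s)) d t) : |d| ≤ rlip u (Γ t) * c := by
  have hbound : ∀ ε > 0, |d| ≤ (rlip u (Γ t) + ε) * c := fun ε hε => by
    refine le_of_tendsto_of_tendsto (tendsto_abs_sub_div_abs_sub hd) (hc.const_mul _) ?_
    filter_upwards [mem_nhdsWithin_of_mem_nhds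
      (hΓ.eventually (eventually_abs_sub_le_rlip (lip_ne_top hu _) hε))] with s hs
    rw [← mul_div_assoc]
    gcongr
  have hlim : Tendsto (fun ε => (rlip u (Γ t) + ε) * c) (𝓝[>] 0) (𝓝 ((rlip u (Γ t) + 0) * c)) :=
    ((continuous_const.add continuous_id).mul continuous_const).continuousWithinAt
  rw [add_zero] at hlim
  exact ge_of_tendsto hlim (eventually_mem_nhdsWithin.mono hbound)

end SpeedBound

section UnitInterval

variable {F : I → ℝ} {s t : I}

lemma ae_unitInterval_iff {p : ℝ → Prop} :
    (∀ᵐ t : I, p t) ↔ ∀ᵐ t : ℝ, t ∈ uIcc 0 1 → p t := by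
  rw [uIcc_of_le zero_le_one, ← ae_restrict_iff' measurableSet_Icc,
    ae_restrict_iff_subtype measurableSet_Icc, unitInterval.volume_def]

lemma integrable_unitInterval_iff :
    Integrable F ↔ IntervalIntegrable (IccExtend zero_le_one F) volume 0 1 := by
  rw [intervalIntegrable_iff_integrableOn_Icc_of_le zero_le_one,
    integrableOn_iff_comap_subtypeVal measurableSet_Icc, ← unitInterval.volume_def]
  simp only [Function.comp_def, IccExtend_val]

lemma setIntegral_unitInterval (F : I → ℝ) (hst : s ≤ t) :
    ∫ r in Icc s t, F r = ∫ r in (s : ℝ)..t, IccExtend zero_le_one F r := by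
  have hmp : MeasurePreserving ((↑) : I → ℝ) volume (volume.restrict (Icc 0 1)) :=
    measurePreserving_subtype_coe measurableSet_Icc
  have h := hmp.setIntegral_preimage_emb (MeasurableEmbedding.subtype_coe measurableSet_Icc)
    (IccExtend zero_le_one F) (Icc (s : ℝ) t)
  have hpre : ((↑) : I → ℝ) ⁻¹' Icc (s : ℝ) t = Icc s t := rfl
  simp only [hpre, IccExtend_val] at h
  rw [Measure.restrict_restrict measurableSet_Icc,
    inter_eq_left.2 (Icc_subset_Icc s.2.1 t.2.2)] at h
  rw [h, intervalIntegral.integral_of_le (by exact_mod_cast hst), integral_Icc_eq_integral_Ioc]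

end UnitInterval

section MetricSpeed

variable {X : Type*} [MetricSpace X] {γ : C(I, X)} {s t : I} {v : ℝ}

/-- The metric speed, with the limit replaced by the upper limit: it depends measurably on the curve
and on the time, and agrees a.e. with `metricSpeed` along absolutely continuous curves. -/
noncomputable def upperSpeed (γ : C(I, X)) (t : I) : ℝ≥0∞ :=
  limsup (fun s => edist (γ s) (γ t) / edist s t) (𝓝[≠] t)

lemma metricSpeed_eq_of_tendsto
    (h : Tendsto (fun s : I => dist (γ s) (γ t) / dist s t) (𝓝[≠] t) (𝓝 v)) :
    metricSpeed γ t = v := by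
  have hex : ∃ v : ℝ, Tendsto (fun s : I => dist (γ s) (γ t) / dist s t) (𝓝[≠] t) (𝓝 v) := ⟨v, h⟩
  rw [metricSpeed, dif_pos hex]
  exact tendsto_nhds_unique hex.choose_spec h

lemma metricSpeed_nonneg (γ : C(I, X)) (t : I) : 0 ≤ metricSpeed γ t := by
  rw [metricSpeed]
  split_ifs with hex
  · exact ge_of_tendsto' hex.choose_spec fun _ => by positivity
  · exact le_rfl

lemma upperSpeed_eq_of_tendsto
    (h : Tendsto (fun s : I => dist (γ s) (γ t) / dist s t) (𝓝[≠] t) (𝓝 v)) :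
    upperSpeed γ t = ENNReal.ofReal v := by
  rw [upperSpeed, ← (ENNReal.tendsto_ofReal h).limsup_eq]
  refine limsup_congr ?_
  filter_upwards [self_mem_nhdsWithin] with s hs
  rw [edist_dist, edist_dist, ENNReal.ofReal_div_of_pos (dist_pos.2 hs)]

lemma tendsto_of_tendsto_iccExtend
    (h : Tendsto (fun s => dist (IccExtend zero_le_one γ s) (IccExtend zero_le_one γ t) / |s - t|)
      (𝓝[≠] (t : ℝ)) (𝓝 v)) :
    Tendsto (fun s : I => dist (γ s) (γ t) / dist s t) (𝓝[≠] t) (𝓝 v) := by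
  have hval : Tendsto ((↑) : I → ℝ) (𝓝[≠] t) (𝓝[≠] (t : ℝ)) :=
    tendsto_nhdsWithin_of_tendsto_nhds_of_eventually_within _
      (continuous_subtype_val.continuousAt.mono_left inf_le_left)
      (eventually_mem_nhdsWithin.mono fun s hs => mt Subtype.ext hs)
  simpa [Function.comp_def, Subtype.dist_eq, Real.dist_eq] using h.comp hval

namespace IsAC

lemma exists_hasSpeedBound_iccExtend (h : IsAC γ) :
    ∃ g, HasSpeedBound (IccExtend zero_le_one γ) g 0 1 := by
  obtain ⟨g, hg, hle⟩ := h
  have hle' : ∀ s t : I, dist (γ s) (γ t) ≤ |∫ r in (s : ℝ)..t, IccExtend zero_le_one g r| := by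
    intro s t
    rcases lt_trichotomy s t with hst | rfl | hst
    · rw [← setIntegral_unitInterval g hst.le, dist_comm]
      exact (hle s t hst).trans (le_abs_self _)
    · rw [dist_self]
      exact abs_nonneg _
    · rw [intervalIntegral.integral_symm, abs_neg, ← setIntegral_unitInterval g hst.le]
      exact (hle t s hst).trans (le_abs_self _)
  refine ⟨_, integrable_unitInterval_iff.1 hg, fun s hs t ht => ?_⟩
  rw [uIcc_of_le zero_le_one] at hs ht
  rw [IccExtend_of_mem _ _ hs, IccExtend_of_mem _ _ ht]
  exact hle' ⟨s, hs⟩ ⟨t, ht⟩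

variable [SecondCountableTopology X]

lemma hasSpeedBound_metricSpeed (h : IsAC γ) :
    HasSpeedBound (IccExtend zero_le_one γ) (IccExtend zero_le_one (metricSpeed γ)) 0 1 ∧
      ∀ᵐ t, t ∈ uIcc 0 1 →
        Tendsto (fun s => dist (IccExtend zero_le_one γ s) (IccExtend zero_le_one γ t) / |s - t|)
          (𝓝[≠] t) (𝓝 (IccExtend zero_le_one (metricSpeed γ) t)) := by
  obtain ⟨g, hg⟩ := h.exists_hasSpeedBound_iccExtend
  obtain ⟨v, hv, hlim⟩ := hg.exists_metricDerivative
  have heq : ∀ᵐ t, t ∈ uIcc 0 1 → v t = IccExtend zero_le_one (metricSpeed γ) t := by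
    rw [← ae_unitInterval_iff]
    filter_upwards [ae_unitInterval_iff.2 hlim] with t ht
    rw [IccExtend_val, metricSpeed_eq_of_tendsto (tendsto_of_tendsto_iccExtend ht)]
  refine ⟨hv.congr heq, ?_⟩
  filter_upwards [hlim, heq] with t ht hvt hmem
  exact hvt hmem ▸ ht hmem

lemma ae_ofReal_metricSpeed (h : IsAC γ) :
    ∀ᵐ t, ENNReal.ofReal (metricSpeed γ t) = upperSpeed γ t := by
  filter_upwards [ae_unitInterval_iff.2 h.hasSpeedBound_metricSpeed.2] with t ht
  have hlim := tendsto_of_tendsto_iccExtend ht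
  rw [IccExtend_val] at hlim
  exact (upperSpeed_eq_of_tendsto hlim).symm

lemma integrable_metricSpeed (h : IsAC γ) : Integrable (metricSpeed γ) :=
  integrable_unitInterval_iff.2 h.hasSpeedBound_metricSpeed.1.intervalIntegrable

lemma dist_le (h : IsAC γ) (hst : s ≤ t) :
    dist (γ s) (γ t) ≤ ∫ r in Icc s t, metricSpeed γ r := by
  have hle := h.hasSpeedBound_metricSpeed.1.dist_le s
    (by rw [uIcc_of_le zero_le_one]; exact s.2) t (by rw [uIcc_of_le zero_le_one]; exact t.2)
  rwa [← setIntegral_unitInterval _ hst, IccExtend_val, IccExtend_val,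
    abs_of_nonneg (integral_nonneg fun r => metricSpeed_nonneg γ r)] at hle

section UpperGradient

variable [MeasurableSpace X] [BorelSpace X] {u : X → ℝ} {K : ℝ≥0}

lemma integrable_rlip_mul_metricSpeed (h : IsAC γ) (hu : LipschitzWith K u) :
    Integrable fun r => rlip u (γ r) * metricSpeed γ r := by
  refine h.integrable_metricSpeed.bdd_mul (c := K)
    ((measurable_rlip hu.continuous).comp γ.continuous.measurable).aestronglyMeasurable
    (ae_of_all _ fun r => ?_)
  rw [Real.norm_of_nonneg (rlip_nonneg u _)]
  exact rlip_le_of_lipschitzWith hu _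

lemma abs_sub_le_integral (h : IsAC γ) (hu : LipschitzWith K u) (hst : s ≤ t) :
    |u (γ t) - u (γ s)| ≤ ∫ r in Icc s t, rlip u (γ r) * metricSpeed γ r := by
  obtain ⟨hbound, hlim⟩ := h.hasSpeedBound_metricSpeed
  set Γ : ℝ → X := IccExtend zero_le_one γ with hΓ
  have hsub : uIcc (s : ℝ) t ⊆ uIcc 0 1 := by
    rw [uIcc_of_le zero_le_one]
    exact uIcc_subset_Icc s.2 t.2
  have hAC := (hbound.comp_lipschitz hu).absolutelyContinuousOnInterval
  have hint := integrable_unitInterval_iff.1 (h.integrable_rlip_mul_metricSpeed hu)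
  have hftc : ∫ r in (s : ℝ)..t, deriv (u ∘ Γ) r = u (γ t) - u (γ s) := by
    rw [(hAC.mono hsub).integral_deriv_eq_sub, Function.comp, Function.comp, hΓ, IccExtend_val,
      IccExtend_val]
  rw [← hftc, setIntegral_unitInterval _ hst, ← Real.norm_eq_abs]
  refine intervalIntegral.norm_integral_le_of_norm_le (by exact_mod_cast hst) ?_
    (hint.mono_set hsub)
  filter_upwards [hlim, hAC.ae_differentiableAt] with r hr hdiff hmem
  have hr01 := hsub (uIoc_subset_uIcc (uIoc_of_le (Subtype.coe_le_coe.2 hst) ▸ hmem))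
  exact abs_deriv_comp_le (Γ := Γ) (d := deriv (u ∘ Γ) r) hu
    γ.continuous.Icc_extend'.continuousAt (hr hr01) (hdiff hr01).hasDerivAt

end UpperGradient

end IsAC

end MetricSpeed

section Energy

variable {X : Type*} [MetricSpace X] {γ : C(I, X)} {t : I}

namespace IsAC2

lemma energy_div_sq (h : IsAC2 γ) (ht : 0 < t) :
    ((energy t γ).toReal / t) ^ 2 = (t : ℝ)⁻¹ * ∫ s in Icc 0 t, metricSpeed γ s ^ 2 := by
  have ht0 : (0 : ℝ) < t := ht
  have hlin : ∫⁻ s in Icc 0 t, ENNReal.ofReal (metricSpeed γ s) ^ 2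
      = ENNReal.ofReal (∫ s in Icc 0 t, metricSpeed γ s ^ 2) := by
    rw [ofReal_integral_eq_lintegral_ofReal h.2.integrable_sq.integrableOn
      (ae_of_all _ fun _ => sq_nonneg _)]
    simp only [ENNReal.ofReal_pow (metricSpeed_nonneg γ _)]
  have _ : 0 ≤ ∫ s in Icc 0 t, metricSpeed γ s ^ 2 := integral_nonneg fun s => sq_nonneg _
  rw [energy, if_pos h, setLAverage_eq, hlin, unitInterval.volume_Icc, Icc.coe_zero, sub_zero,
    ← ENNReal.ofReal_div_of_pos ht0, ENNReal.toReal_mul, ENNReal.toReal_ofReal ht0.le,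
    ← ENNReal.toReal_rpow, ENNReal.toReal_ofReal (by positivity), ← Real.sqrt_eq_rpow,
    mul_div_cancel_left₀ _ ht0.ne', Real.sq_sqrt (by positivity), div_eq_inv_mul]

variable [SecondCountableTopology X]

lemma eq_of_energy_eq_zero (h : IsAC2 γ) (ht : 0 < t) (h0 : (energy t γ).toReal = 0) :
    γ t = γ 0 := by
  have ht0 : (t : ℝ) ≠ 0 := (show (0 : ℝ) < t from ht).ne'
  have hsq : ∫ s in Icc 0 t, metricSpeed γ s ^ 2 = 0 := by
    simpa [h0, ht0] using (h.energy_div_sq ht).symm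
  rw [integral_eq_zero_iff_of_nonneg (fun _ => sq_nonneg _) h.2.integrable_sq.integrableOn] at hsq
  have hspeed : ∫ s in Icc 0 t, metricSpeed γ s = 0 :=
    integral_eq_zero_of_ae (hsq.mono fun _ hs => pow_eq_zero_iff two_ne_zero |>.1 hs)
  exact (dist_le_zero.1 ((h.1.dist_le ht.le).trans_eq hspeed)).symm

/-- The convexity inequality `a b ≤ a² / 2 + b² / 2` splits the upper gradient inequality into a
term that only sees the slope and one that only sees the curve. -/
lemma abs_sub_le [MeasurableSpace X] [BorelSpace X] {u : X → ℝ} {K : ℝ≥0} (h : IsAC2 γ)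
    (ht : 0 < t) (hu : LipschitzWith K u) :
    |u (γ t) - u (γ 0)| ≤ 2⁻¹ * (∫ s in Icc 0 t, rlip u (γ s) ^ 2)
      + 2⁻¹ * t * ((energy t γ).toReal / t) ^ 2 := by
  have ht0 : (t : ℝ) ≠ 0 := (show (0 : ℝ) < t from ht).ne'
  have hrlip : Integrable fun s => rlip u (γ s) ^ 2 := by
    have hmeas := ((measurable_rlip hu.continuous).comp γ.continuous.measurable).pow_const 2
    refine Integrable.of_bound hmeas.aestronglyMeasurable ((K : ℝ) ^ 2) (ae_of_all _ fun s => ?_)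
    rw [Real.norm_of_nonneg (sq_nonneg _)]
    exact pow_le_pow_left₀ (rlip_nonneg u _) (rlip_le_of_lipschitzWith hu _) 2
  rw [h.energy_div_sq ht, mul_assoc, mul_inv_cancel_left₀ ht0, ← integral_const_mul,
    ← integral_const_mul, ← integral_add (hrlip.integrableOn.const_mul _)
    (h.2.integrable_sq.integrableOn.const_mul _)]
  refine (h.1.abs_sub_le_integral hu ht.le).trans (integral_mono
    (h.1.integrable_rlip_mul_metricSpeed hu).integrableOn
    ((hrlip.integrableOn.const_mul _).add (h.2.integrable_sq.integrableOn.const_mul _)) fun s => ?_)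
  dsimp only
  linarith [two_mul_le_add_sq (rlip u (γ s)) (metricSpeed γ s)]

end IsAC2

end Energy

section Measurability

variable {X : Type*} [MetricSpace X] {γ : C(I, X)} {s t : I}

lemma edist_le_setLIntegral_of_denseRange {w : I → ℝ≥0∞} {x : ℕ → I} (hx : DenseRange x)
    (hle : ∀ n k, edist (γ (x n)) (γ (x k)) ≤ ∫⁻ r in uIcc (x n) (x k), w r) (hst : s < t) :
    edist (γ s) (γ t) ≤ ∫⁻ r in Icc s t, w r := by
  set D : Set I := Ioo s t ∩ range x
  have hdense : Icc s t ⊆ closure D := by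
    rw [← closure_Ioo hst.ne]
    exact closure_minimal (hx.open_subset_closure_inter isOpen_Ioo) isClosed_closure
  have hD : ∀ p ∈ D ×ˢ D, edist (γ p.1) (γ p.2) ≤ ∫⁻ r in Icc s t, w r := by
    rintro ⟨_, _⟩ ⟨⟨hn, n, rfl⟩, ⟨hk, k, rfl⟩⟩
    exact (hle n k).trans (lintegral_mono_set
      (uIcc_subset_Icc (Ioo_subset_Icc_self hn) (Ioo_subset_Icc_self hk)))
  have hclosed : IsClosed {p : I × I | edist (γ p.1) (γ p.2) ≤ ∫⁻ r in Icc s t, w r} :=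
    isClosed_le (by fun_prop) continuous_const
  have hst_mem : (s, t) ∈ closure (D ×ˢ D) := by
    rw [closure_prod_eq]
    exact ⟨hdense (left_mem_Icc.2 hst.le), hdense (right_mem_Icc.2 hst.le)⟩
  exact closure_minimal hD hclosed hst_mem

lemma lintegral_ne_top_of_lintegral_sq_ne_top {Ω : Type*} [MeasurableSpace Ω] {μ : Measure Ω}
    [IsFiniteMeasure μ] {w : Ω → ℝ≥0∞} (h : ∫⁻ x, w x ^ 2 ∂μ ≠ ∞) : ∫⁻ x, w x ∂μ ≠ ∞ := by
  have hle : ∫⁻ x, w x ∂μ ≤ ∫⁻ x, (1 + w x ^ 2) ∂μ := lintegral_mono fun x => by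
    rcases le_total (w x) 1 with hx | hx
    · exact hx.trans le_self_add
    · exact (le_self_pow₀ hx two_ne_zero).trans le_add_self
  refine ne_top_of_le_ne_top ?_ hle
  rw [lintegral_add_left measurable_const]
  exact ENNReal.add_ne_top.2 ⟨by simp, h⟩

lemma measurable_upperSpeed_uncurry [MeasurableSpace C(I, X)] [BorelSpace C(I, X)] :
    Measurable fun p : C(I, X) × I => upperSpeed p.1 p.2 := by
  refine measurable_limsup_nhdsNE (P := C(I, X) × I) (Y := I) (a := Prod.snd) continuous_snd
    (k := fun p s => edist (p.1 s) (p.1 p.2) / edist s p.2) fun p y hne => ?_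
  have hnum : ContinuousAt (fun p : C(I, X) × I => edist (p.1 y) (p.1 p.2)) p := by fun_prop
  have hden : ContinuousAt (fun p : C(I, X) × I => edist y p.2) p := by fun_prop
  exact ENNReal.Tendsto.div hnum (Or.inr (by simpa using hne)) hden (Or.inr (edist_ne_top _ _))

lemma measurable_upperSpeed (γ : C(I, X)) : Measurable (upperSpeed γ) := by
  borelize C(I, X)
  exact Measurable.comp (f := fun s : I => (γ, s)) (g := fun p : C(I, X) × I => upperSpeed p.1 p.2)
    measurable_upperSpeed_uncurry measurable_prodMk_left

lemma isAC_of_lintegral_upperSpeed_ne_top {x : ℕ → I} (hx : DenseRange x)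
    (hle : ∀ n k, edist (γ (x n)) (γ (x k)) ≤ ∫⁻ r in uIcc (x n) (x k), upperSpeed γ r)
    (hfin : ∫⁻ s, upperSpeed γ s ≠ ∞) : IsAC γ := by
  have hm := measurable_upperSpeed γ
  refine ⟨fun s => (upperSpeed γ s).toReal,
    integrable_toReal_of_lintegral_ne_top hm.aemeasurable hfin, fun s t hst => ?_⟩
  rw [integral_toReal hm.aemeasurable (ae_restrict_of_ae (ae_lt_top hm hfin)), dist_comm,
    dist_edist]
  exact ENNReal.toReal_mono (ne_top_of_le_ne_top hfin (setLIntegral_le_lintegral _ _))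
    (edist_le_setLIntegral_of_denseRange hx hle hst)

variable [SecondCountableTopology X]

lemma IsAC.edist_le (h : IsAC γ) (s t : I) :
    edist (γ s) (γ t) ≤ ∫⁻ r in uIcc s t, upperSpeed γ r := by
  wlog hst : s ≤ t generalizing s t
  · rw [edist_comm, uIcc_comm]
    exact this t s (le_of_not_ge hst)
  rw [uIcc_of_le hst, edist_dist]
  refine (ENNReal.ofReal_le_ofReal (h.dist_le hst)).trans_eq ?_
  rw [ofReal_integral_eq_lintegral_ofReal h.integrable_metricSpeed.integrableOn
    (ae_of_all _ (metricSpeed_nonneg γ))]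
  exact lintegral_congr_ae (ae_restrict_of_ae h.ae_ofReal_metricSpeed)

lemma IsAC.lintegral_upperSpeed_sq (h : IsAC γ) :
    ∫⁻ s, upperSpeed γ s ^ 2 = ∫⁻ s, ‖metricSpeed γ s‖ₑ ^ 2 := by
  refine lintegral_congr_ae ?_
  filter_upwards [h.ae_ofReal_metricSpeed] with s hs
  rw [← hs, Real.enorm_eq_ofReal (metricSpeed_nonneg γ s)]

lemma isAC2_iff {x : ℕ → I} (hx : DenseRange x) :
    IsAC2 γ ↔ ∫⁻ s, upperSpeed γ s ^ 2 < ∞ ∧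
      ∀ n k, edist (γ (x n)) (γ (x k)) ≤ ∫⁻ r in uIcc (x n) (x k), upperSpeed γ r := by
  refine ⟨fun h => ⟨?_, fun n k => h.1.edist_le _ _⟩, fun ⟨hfin, hle⟩ => ?_⟩
  · rw [h.1.lintegral_upperSpeed_sq, lintegral_enorm_sq_eq h.2]
    exact ENNReal.ofReal_lt_top
  · have hAC := isAC_of_lintegral_upperSpeed_ne_top hx hle
      (lintegral_ne_top_of_lintegral_sq_ne_top hfin.ne)
    rw [hAC.lintegral_upperSpeed_sq] at hfin
    exact ⟨hAC, hAC.integrable_metricSpeed.aestronglyMeasurable,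
      (eLpNorm_lt_top_iff_lintegral_rpow_enorm_lt_top two_ne_zero ENNReal.ofNat_ne_top).2
        (by simpa using hfin)⟩

variable [MeasurableSpace C(I, X)] [BorelSpace C(I, X)]

lemma measurableSet_isAC2 : MeasurableSet {γ : C(I, X) | IsAC2 γ} := by
  simp only [isAC2_iff (TopologicalSpace.denseRange_denseSeq I), Set.ofPred_and,
    Set.ofPred_forall]
  refine (measurableSet_lt (measurable_upperSpeed_uncurry.pow_const 2).lintegral_prod_right'
    measurable_const).inter (MeasurableSet.iInter fun n => MeasurableSet.iInter fun k => ?_)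
  exact measurableSet_le (Continuous.measurable (by fun_prop))
    measurable_upperSpeed_uncurry.lintegral_prod_right'

lemma measurable_energy (t : I) : Measurable (energy t : C(I, X) → ℝ≥0∞) := by
  classical
  have heq : (energy t : C(I, X) → ℝ≥0∞) = fun γ => if IsAC2 γ then
      ENNReal.ofReal t * (⨍⁻ s in Icc 0 t, upperSpeed γ s ^ 2 ∂volume) ^ (1 / 2 : ℝ) else ∞ := by
    ext γ
    rw [energy]
    split_ifs with hγ
    · rw [setLAverage_eq, setLAverage_eq, lintegral_congr_ae (ae_restrict_of_ae
        (hγ.1.ae_ofReal_metricSpeed.mono fun s hs => congrArg (· ^ 2) hs))]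
    · rfl
  simp only [heq, setLAverage_eq]
  exact Measurable.ite measurableSet_isAC2
    ((((measurable_upperSpeed_uncurry.pow_const 2).lintegral_prod_right'.div_const _).pow_const
      _).const_mul _) measurable_const

end Measurability

section TendstoLpApproximation

variable {α ι E : Type*} [MeasurableSpace α] [NormedAddCommGroup E] {μ : Measure α} {p : ℝ≥0∞}
  {l : Filter ι} {u : ι → α → E} {f : α → E}

lemma TendstoLp.of_forall_exists_approx (hp : 1 ≤ p) (hu : ∀ i, AEStronglyMeasurable (u i) μ)
    (hf : MemLp f p μ)
    (h : ∀ ε : ℝ≥0∞, 0 < ε → ∃ (v : ι → α → E) (g : α → E), TendstoLp p μ v l g ∧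
      (∀ i, eLpNorm (fun x => u i x - v i x) p μ ≤ ε) ∧ eLpNorm (fun x => g x - f x) p μ ≤ ε) :
    TendstoLp p μ u l f := by
  refine ⟨hu, hf, ENNReal.tendsto_nhds_zero.2 fun ε hε => ?_⟩
  have hε3 : 0 < ε / 3 := ENNReal.div_pos hε.ne' (by norm_num)
  obtain ⟨v, g, hv, huv, hgf⟩ := h (ε / 3) hε3
  filter_upwards [hv.tendsto.eventually_le_const hε3] with i hi
  have huvm := (hu i).sub (hv.1 i)
  have hvgm := (hv.1 i).sub hv.2.1
  calc eLpNorm (fun x => u i x - f x) p μ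
      = eLpNorm ((fun x => u i x - v i x) + (fun x => v i x - g x) + fun x => g x - f x) p μ := by
        congr with x
        simp only [Pi.add_apply, sub_add_sub_cancel]
    _ ≤ eLpNorm (fun x => u i x - v i x) p μ + eLpNorm (fun x => v i x - g x) p μ
        + eLpNorm (fun x => g x - f x) p μ :=
        (eLpNorm_add_le (g := fun x => g x - f x) (huvm.add hvgm) (hv.2.1.sub hf.1) hp).trans
          (by gcongr; exact eLpNorm_add_le huvm hvgm hp)
    _ ≤ ε / 3 + ε / 3 + ε / 3 := by gcongr; exact huv i
    _ = ε := ENNReal.add_thirds ε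

end TendstoLpApproximation

section Compression

variable {X Ω T E : Type*} [MeasurableSpace X] [MeasurableSpace Ω] [MeasurableSpace T]
  [NormedAddCommGroup E] {m : Measure X} {μ : Measure Ω} {e : Ω → X} {C : ℝ≥0} {p : ℝ≥0∞}
  {w : X → E}

lemma absolutelyContinuous_of_le_smul {ν : Measure X} (hle : ν ≤ C • m) : ν ≪ m :=
  (Measure.absolutelyContinuous_of_le hle).trans Measure.smul_absolutelyContinuous

lemma ae_comp_of_map_le (he : Measurable e) (hle : μ.map e ≤ C • m) {P : X → Prop}
    (hP : ∀ᵐ x ∂m, P x) : ∀ᵐ ω ∂μ, P (e ω) :=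
  ae_of_ae_map he.aemeasurable ((absolutelyContinuous_of_le_smul hle).ae_le hP)

lemma aestronglyMeasurable_comp_of_map_le (he : Measurable e) (hle : μ.map e ≤ C • m)
    (hw : AEStronglyMeasurable w m) : AEStronglyMeasurable (fun ω => w (e ω)) μ :=
  (hw.mono_ac (absolutelyContinuous_of_le_smul hle)).comp_aemeasurable he.aemeasurable

lemma eLpNorm_comp_le_of_map_le (he : Measurable e) (hle : μ.map e ≤ C • m)
    (hw : AEStronglyMeasurable w m) (hp : p ≠ ∞) :
    eLpNorm (fun ω => w (e ω)) p μ ≤ ((C ^ p.toReal⁻¹ : ℝ≥0) : ℝ≥0∞) * eLpNorm w p m := by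
  calc eLpNorm (fun ω => w (e ω)) p μ = eLpNorm w p (μ.map e) :=
        (eLpNorm_map_measure (hw.mono_ac (absolutelyContinuous_of_le_smul hle))
          he.aemeasurable).symm
    _ ≤ eLpNorm w p (C • m) := eLpNorm_mono_measure w hle
    _ = _ := by rw [eLpNorm_smul_measure_of_ne_top' hp]; rfl

lemma memLp_comp_of_map_le (he : Measurable e) (hle : μ.map e ≤ C • m) (hp : p ≠ ∞)
    (hw : MemLp w p m) : MemLp (fun ω => w (e ω)) p μ :=
  ⟨aestronglyMeasurable_comp_of_map_le he hle hw.1,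
    (eLpNorm_comp_le_of_map_le he hle hw.1 hp).trans_lt
      (ENNReal.mul_lt_top ENNReal.coe_lt_top hw.2)⟩

lemma TendstoLp.comp_of_map_le {ι : Type*} {l : Filter ι} {u : ι → X → E}
    (hu : TendstoLp p m u l w) (he : Measurable e) (hle : μ.map e ≤ C • m) (hp : p ≠ ∞) :
    TendstoLp p μ (fun i ω => u i (e ω)) l (fun ω => w (e ω)) := by
  refine ⟨fun i => aestronglyMeasurable_comp_of_map_le he hle (hu.1 i),
    memLp_comp_of_map_le he hle hp hu.2, ?_⟩
  have hbound := ENNReal.Tendsto.const_mul (a := ((C ^ p.toReal⁻¹ : ℝ≥0) : ℝ≥0∞)) hu.3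
    (Or.inr ENNReal.coe_ne_top)
  rw [mul_zero] at hbound
  exact tendsto_of_tendsto_of_tendsto_of_le_of_le tendsto_const_nhds hbound (fun _ => zero_le)
    fun i => eLpNorm_comp_le_of_map_le (w := fun x => u i x - w x) he hle
      ((hu.1 i).sub hu.2.1) hp

lemma map_prod_le_of_forall_map_le [SFinite μ] {ρ : Measure T} [SFinite ρ] {ν : Measure X}
    {e : Ω × T → X} (he : Measurable e) (hρ : ρ univ ≤ 1)
    (hle : ∀ t, μ.map (fun ω => e (ω, t)) ≤ ν) : (μ.prod ρ).map e ≤ ν := by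
  refine Measure.le_iff.2 fun s hs => ?_
  rw [Measure.map_apply he hs, Measure.prod_apply_symm (he hs)]
  calc ∫⁻ t, μ ((fun ω => (ω, t)) ⁻¹' (e ⁻¹' s)) ∂ρ ≤ ∫⁻ _, ν s ∂ρ := by
        refine lintegral_mono fun t => ?_
        have hslice := Measure.le_iff.1 (hle t) s hs
        rwa [Measure.map_apply (f := fun ω => e (ω, t)) (he.comp measurable_prodMk_right) hs]
          at hslice
    _ = ν s * ρ univ := lintegral_const _
    _ ≤ ν s := mul_le_of_le_one_right' hρ

end Compression

section Evaluation

variable {X : Type*} [MetricSpace X] [MeasurableSpace X] [BorelSpace X]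
  [MeasurableSpace C(I, X)] [BorelSpace C(I, X)] {m : Measure X} {π : Measure C(I, X)}
  {p : ℝ≥0∞} {w : X → ℝ}

lemma measurable_eval_at (t : I) : Measurable fun γ : C(I, X) => γ t :=
  Continuous.measurable (by fun_prop)

lemma measurable_eval : Measurable fun q : C(I, X) × I => q.1 q.2 :=
  Continuous.measurable (by fun_prop)

lemma tendstoLp_boundedContinuous_eval [IsFiniteMeasure π] (hp : p ≠ ∞)
    (φ : BoundedContinuousFunction X ℝ) (t : I) :
    TendstoLp p π (fun (s : I) γ => φ (γ s)) (𝓝 t) (fun γ => φ (γ t)) := by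
  have hmeas : ∀ s : I, AEStronglyMeasurable (fun γ : C(I, X) => φ (γ s)) π := fun s =>
    (φ.continuous.measurable.comp (measurable_eval_at s)).aestronglyMeasurable
  have hseq : ∀ s : ℕ → I, Tendsto s atTop (𝓝 t) →
      TendstoLp p π (fun n γ => φ (γ (s n))) atTop (fun γ => φ (γ t)) := fun s hs =>
    TendstoLp.of_dominated hp (fun n => hmeas (s n)) (memLp_const ‖φ‖)
      (fun n => ae_of_all _ fun γ => φ.norm_coe_le_norm _)
      (ae_of_all _ fun γ => ((φ.continuous.comp γ.continuous).tendsto t).comp hs)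
  exact ⟨hmeas, (hseq _ tendsto_const_nhds).memLp,
    tendsto_of_seq_tendsto fun s hs => (hseq s hs).tendsto⟩

namespace IsTestPlan

lemma ae_eval (hπ : IsTestPlan m π) (t : I) {P : X → Prop} (hP : ∀ᵐ x ∂m, P x) :
    ∀ᵐ γ ∂π, P (γ t) :=
  let ⟨_, hC⟩ := hπ.compression
  ae_comp_of_map_le (measurable_eval_at t) (hC t) hP

lemma memLp_eval (hπ : IsTestPlan m π) (t : I) (hp : p ≠ ∞) (hw : MemLp w p m) :
    MemLp (fun γ => w (γ t)) p π :=
  let ⟨_, hC⟩ := hπ.compression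
  memLp_comp_of_map_le (measurable_eval_at t) (hC t) hp hw

lemma integrable_eval (hπ : IsTestPlan m π) (t : I) (hw : Integrable w m) :
    Integrable (fun γ => w (γ t)) π :=
  memLp_one_iff_integrable.1
    (hπ.memLp_eval t ENNReal.one_ne_top (memLp_one_iff_integrable.2 hw))

variable [SecondCountableTopology X]

lemma tendstoLp_eval (hm : BoundedlyFinite m) (hπ : IsTestPlan m π) (hp1 : 1 ≤ p) (hp : p ≠ ∞)
    (hw : MemLp w p m) (t : I) :
    TendstoLp p π (fun (s : I) γ => w (γ s)) (𝓝 t) (fun γ => w (γ t)) := by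
  have := hπ.isProbabilityMeasure
  have : IsLocallyFiniteMeasure m := ⟨fun x => ⟨Metric.ball x 1, Metric.ball_mem_nhds x one_pos,
    hm _ Metric.isBounded_ball⟩⟩
  obtain ⟨C, hC⟩ := hπ.compression
  refine .of_forall_exists_approx hp1 (fun s => (hπ.memLp_eval s hp hw).1)
    (hπ.memLp_eval t hp hw) fun ε hε => ?_
  set K : ℝ≥0∞ := ((C ^ p.toReal⁻¹ : ℝ≥0) : ℝ≥0∞)
  have hδ : ε / (K + 1) ≠ 0 := (ENNReal.div_pos hε.ne' (by simp [K])).ne'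
  obtain ⟨φ, hφ, hφp⟩ := hw.exists_boundedContinuous_eLpNorm_sub_le hp hδ
  have happrox : ∀ s : I, eLpNorm (fun γ : C(I, X) => w (γ s) - φ (γ s)) p π ≤ ε := fun s =>
    calc eLpNorm (fun γ : C(I, X) => w (γ s) - φ (γ s)) p π
        ≤ K * eLpNorm (fun x => w x - φ x) p m :=
          eLpNorm_comp_le_of_map_le (w := fun x => w x - φ x) (measurable_eval_at s) (hC s)
            (hw.1.sub hφp.1) hp
      _ ≤ (K + 1) * (ε / (K + 1)) := mul_le_mul' le_self_add hφ
      _ ≤ ε := ENNReal.mul_div_le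
  refine ⟨_, _, tendstoLp_boundedContinuous_eval hp φ t, happrox, ?_⟩
  exact (eLpNorm_sub_comm (fun γ => φ (γ t)) (fun γ : C(I, X) => w (γ t)) p π).trans_le (happrox t)

end IsTestPlan

end Evaluation

section PathAverage

variable {X : Type*} [MetricSpace X] [MeasurableSpace X] [BorelSpace X]
  [MeasurableSpace C(I, X)] [BorelSpace C(I, X)] {m : Measure X} {π : Measure C(I, X)}
  {h : C(I, X) → ℝ} {w : X → ℝ}

lemma tendsto_average_Icc {Ψ : I → ℝ} (hΨ : Integrable Ψ) (h0 : Tendsto Ψ (𝓝 0) (𝓝 (Ψ 0))) :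
    Tendsto (fun t : I => (t : ℝ)⁻¹ * ∫ s in Icc 0 t, Ψ s) (𝓝[>] 0) (𝓝 (Ψ 0)) := by
  have hvol : ∀ t : I, volume.real (Icc 0 t) = (t : ℝ) := fun t => by
    rw [Measure.real, unitInterval.volume_Icc]
    simp [t.2.1]
  have hIcc : Tendsto (fun t : I => Icc 0 t) (𝓝[>] 0) (𝓝 (0 : I)).smallSets :=
    Tendsto.Icc tendsto_const_nhds (tendsto_id.mono_left nhdsWithin_le_nhds)
  have hlittle := Tendsto.integral_sub_linear_isLittleO_ae (h0.mono_left inf_le_left)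
    ⟨univ, univ_mem, hΨ.1.restrict⟩ (volume.finiteAt_nhds 0) hIcc
  have hquot := hlittle.tendsto_div_nhds_zero.add_const (Ψ 0)
  rw [zero_add] at hquot
  refine hquot.congr' ?_
  filter_upwards [self_mem_nhdsWithin] with t ht
  have ht0 : (t : ℝ) ≠ 0 := (unitInterval.coe_pos.2 ht).ne'
  rw [hvol, smul_eq_mul]
  field_simp
  ring

/-- The mean over `s ∈ [0, t]` of `∫ h(γ) w(γ_s) dπ(γ)`, as an integral over `π ⊗ ds`. -/
noncomputable def pathAverage (π : Measure C(I, X)) (h : C(I, X) → ℝ) (w : X → ℝ) (t : I) : ℝ :=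
  (t : ℝ)⁻¹ * ∫ q : C(I, X) × I, h q.1 * w (q.1 q.2) ∂(π.prod (volume.restrict (Icc 0 t)))

namespace IsTestPlan

lemma exists_map_eval_le (hπ : IsTestPlan m π) (A : Set I) :
    ∃ C : ℝ≥0, (π.prod (volume.restrict A)).map (fun q : C(I, X) × I => q.1 q.2) ≤ C • m := by
  have := hπ.isProbabilityMeasure
  obtain ⟨C, hC⟩ := hπ.compression
  refine ⟨C, map_prod_le_of_forall_map_le measurable_eval ?_ hC⟩
  rw [Measure.restrict_apply_univ]
  exact prob_le_one

lemma integrable_mul_eval (hπ : IsTestPlan m π) (hh : MemLp h ∞ π) (hw : Integrable w m)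
    (A : Set I) :
    Integrable (fun q : C(I, X) × I => h q.1 * w (q.1 q.2)) (π.prod (volume.restrict A)) := by
  have := hπ.isProbabilityMeasure
  obtain ⟨C, hC⟩ := hπ.exists_map_eval_le A
  have hint := memLp_comp_of_map_le measurable_eval hC ENNReal.one_ne_top
    (memLp_one_iff_integrable.2 hw)
  exact (memLp_one_iff_integrable.1 hint).mul_of_top_right (hh.comp_fst _)

lemma tendsto_pathAverage_of_tendstoLp (hπ : IsTestPlan m π) (hh : MemLp h ∞ π) {ι : Type*}
    {l : Filter ι} {v : ι → X → ℝ} (hv : TendstoLp 1 m v l w) (t : I) :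
    Tendsto (fun i => pathAverage π h (v i) t) l (𝓝 (pathAverage π h w t)) := by
  have := hπ.isProbabilityMeasure
  obtain ⟨C, hC⟩ := hπ.exists_map_eval_le (Icc 0 t)
  exact ((hv.comp_of_map_le measurable_eval hC ENNReal.one_ne_top).integral_mul
    (hh.comp_fst _)).const_mul _

variable [SecondCountableTopology X]

lemma tendsto_pathAverage (hm : BoundedlyFinite m) (hπ : IsTestPlan m π) (hh : MemLp h ∞ π)
    (hw : Integrable w m) :
    Tendsto (pathAverage π h w) (𝓝[>] 0) (𝓝 (∫ γ, h γ * w (γ 0) ∂π)) := by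
  have := hπ.isProbabilityMeasure
  have hint := hπ.integrable_mul_eval hh hw univ
  rw [Measure.restrict_univ] at hint
  have hcont := ((hπ.tendstoLp_eval hm le_rfl ENNReal.one_ne_top
    (memLp_one_iff_integrable.2 hw) 0).integral_mul hh)
  refine (tendsto_average_Icc (Ψ := fun s => ∫ γ, h γ * w (γ s) ∂π) hint.integral_prod_right
    hcont).congr fun t => ?_
  rw [pathAverage, integral_prod_symm _ (hπ.integrable_mul_eval hh hw _)]

end IsTestPlan

end PathAverage

section KineticEnergy

variable {X : Type*} [MetricSpace X] [SecondCountableTopology X] [MeasurableSpace X]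
  [MeasurableSpace C(I, X)] [BorelSpace C(I, X)] {m : Measure X} {π : Measure C(I, X)}

namespace IsTestPlan

lemma ae_isAC2 (hπ : IsTestPlan m π) : ∀ᵐ γ ∂π, IsAC2 γ := by
  filter_upwards [ae_lt_top ((measurable_energy 1).pow_const 2) hπ.kineticEnergy.ne] with γ hγ
  by_contra hAC
  simp [energy, hAC] at hγ

lemma memLp_energy_one (hπ : IsTestPlan m π) :
    MemLp (fun γ : C(I, X) => (energy 1 γ).toReal) 2 π := by
  refine ⟨(measurable_energy 1).ennreal_toReal.aestronglyMeasurable, ?_⟩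
  rw [eLpNorm_lt_top_iff_lintegral_rpow_enorm_lt_top two_ne_zero ENNReal.ofNat_ne_top]
  refine lt_of_le_of_lt (lintegral_mono fun γ => ?_) hπ.kineticEnergy
  rw [Real.enorm_eq_ofReal ENNReal.toReal_nonneg, ENNReal.toReal_ofNat, ENNReal.rpow_ofNat]
  gcongr
  exact ENNReal.ofReal_toReal_le

lemma memLp_energy_div (hπ : IsTestPlan m π) {t : I} (ht : 0 < t) :
    MemLp (fun γ : C(I, X) => (energy t γ).toReal / (t : ℝ)) 2 π := by
  refine (hπ.memLp_energy_one.const_mul √(t : ℝ)⁻¹).of_le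
    ((measurable_energy t).ennreal_toReal.div_const _).aestronglyMeasurable ?_
  filter_upwards [hπ.ae_isAC2] with γ hγ
  have ht0 : (0 : ℝ) ≤ t := t.2.1
  rw [Real.norm_of_nonneg (by positivity), Real.norm_of_nonneg (by positivity)]
  refine le_of_sq_le_sq ?_ (by positivity)
  have hone := hγ.energy_div_sq (t := 1) one_pos
  simp only [Set.Icc.coe_one, div_one, inv_one, one_mul] at hone
  rw [hγ.energy_div_sq ht, mul_pow, Real.sq_sqrt (by positivity), hone]
  gcongr ?_ * ?_
  exact setIntegral_mono_set hγ.2.integrable_sq.integrableOn (ae_of_all _ fun s => sq_nonneg _)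
    (Icc_subset_Icc_right unitInterval.le_one').eventuallyLE

end IsTestPlan

end KineticEnergy

section GradInner

variable {X : Type*} [MetricSpace X] [MeasurableSpace X] [BorelSpace X] {m : Measure X}
  {f g : X → ℝ}

lemma integrable_gradInner (hm : BoundedlyFinite m) (hf : MemW12 m f) (hg : MemW12 m g) :
    Integrable (gradInner m g f) m :=
  ((((hg.add hm hf).memLp_relaxedSlope hm).integrable_sq.sub
    (hg.memLp_relaxedSlope hm).integrable_sq).sub
    (hf.memLp_relaxedSlope hm).integrable_sq).div_const 2

lemma MemW12.exists_tendstoLp_rlip (hm : BoundedlyFinite m) (hf : MemW12 m f) :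
    ∃ u : ℕ → X → ℝ, (∀ n, IsLipBs (u n)) ∧ TendstoLp 2 m u atTop f ∧
      TendstoLp 2 m (fun n => rlip (u n)) atTop (relaxedSlope m f) := by
  obtain ⟨hD, ⟨u, hu, hlim⟩, -⟩ := hf.isMinimalRelaxedSlope hm
  exact ⟨u, hu.1, hu.tendstoLp hf.1, fun n => ((hu.1 n).memLp_rlip (p := 2) hm).1, hD, hlim⟩

end GradInner

section PathQuotient

variable {X : Type*} {f g u : X → ℝ} {t : I}

/-- The difference quotient of `u` along a curve `γ` over the time interval `[0, t]`. -/
noncomputable def pathQuotient [TopologicalSpace X] (u : X → ℝ) (t : I) (γ : C(I, X)) : ℝ :=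
  (u (γ t) - u (γ 0)) / t

lemma pathQuotient_add_const_mul [TopologicalSpace X] (f g : X → ℝ) (c : ℝ) (t : I)
    (γ : C(I, X)) :
    pathQuotient (f + fun x => c * g x) t γ = pathQuotient f t γ + c * pathQuotient g t γ := by
  simp only [pathQuotient, Pi.add_apply]
  ring

lemma pathQuotient_neg [TopologicalSpace X] (g : X → ℝ) (t : I) (γ : C(I, X)) :
    pathQuotient (-g) t γ = -pathQuotient g t γ := by
  simp only [pathQuotient, Pi.neg_apply]
  ring

lemma IsAC2.pathQuotient_le [MetricSpace X] [SecondCountableTopology X] [MeasurableSpace X]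
    [BorelSpace X] {γ : C(I, X)} {K : ℝ≥0} (hγ : IsAC2 γ) (ht : 0 < t) (hu : LipschitzWith K u) :
    pathQuotient u t γ ≤ 2⁻¹ * ((t : ℝ)⁻¹ * ∫ s in Icc 0 t, rlip u (γ s) ^ 2)
      + 2⁻¹ * ((energy t γ).toReal / t) ^ 2 := by
  have ht0 : (0 : ℝ) < t := ht
  rw [pathQuotient, div_le_iff₀ ht0]
  refine ((le_abs_self _).trans (hγ.abs_sub_le ht hu)).trans_eq ?_
  generalize (∫ s in Icc 0 t, rlip u (γ s) ^ 2) = a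
  field_simp

end PathQuotient

section TestPlanDerivative

variable {X : Type*} [MetricSpace X] [MeasurableSpace X] [BorelSpace X]
  [MeasurableSpace C(I, X)] [BorelSpace C(I, X)] {m : Measure X} {π : Measure C(I, X)}
  {f g u : X → ℝ} {h : C(I, X) → ℝ} {t : I}

namespace IsTestPlan

lemma tendstoLp_pathQuotient_of_tendstoLp (hπ : IsTestPlan m π) {p : ℝ≥0∞} (hp : p ≠ ∞)
    {ι : Type*} {l : Filter ι} {v : ι → X → ℝ} (hv : TendstoLp p m v l g) (t : I) :
    TendstoLp p π (fun i => pathQuotient (v i) t) l (pathQuotient g t) := by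
  obtain ⟨C, hC⟩ := hπ.compression
  have heval : ∀ s : I, TendstoLp p π (fun i γ => v i (γ s)) l fun γ => g (γ s) := fun s =>
    hv.comp_of_map_le (measurable_eval_at s) (hC s) hp
  have hquot := ((heval t).sub (heval 0)).const_mul (t : ℝ)⁻¹
  simpa only [← div_eq_inv_mul] using! hquot

lemma memLp_pathQuotient (hπ : IsTestPlan m π) {p : ℝ≥0∞} (hp : p ≠ ∞) (hg : MemLp g p m)
    (t : I) : MemLp (pathQuotient g t) p π :=
  (hπ.tendstoLp_pathQuotient_of_tendstoLp hp (tendstoLp_const hg (⊤ : Filter Unit)) t).memLp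

lemma integrable_pathQuotient (hπ : IsTestPlan m π) (hg : MemLp g 2 m) (t : I) :
    Integrable (pathQuotient g t) π :=
  have := hπ.isProbabilityMeasure
  (hπ.memLp_pathQuotient ENNReal.ofNat_ne_top hg t).integrable one_le_two

variable [SecondCountableTopology X]

lemma integral_mul_pathQuotient_le_of_isLipBs (hm : BoundedlyFinite m) (hπ : IsTestPlan m π)
    (hh : MemLp h ∞ π) (h0 : 0 ≤ᵐ[π] h) (ht : 0 < t) (hu : IsLipBs u) :
    ∫ γ, h γ * pathQuotient u t γ ∂π ≤ 2⁻¹ * pathAverage π h (fun x => rlip u x ^ 2) t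
      + 2⁻¹ * ∫ γ, h γ * ((energy t γ).toReal / t) ^ 2 ∂π := by
  have := hπ.isProbabilityMeasure
  have hprod := hπ.integrable_mul_eval hh (hu.memLp_rlip hm).integrable_sq (Icc 0 t)
  have hslope := (hprod.integral_prod_left.const_mul (t : ℝ)⁻¹).const_mul 2⁻¹
  have hspeed : Integrable (fun γ => 2⁻¹ * (h γ * ((energy t γ).toReal / t) ^ 2)) π :=
    ((hπ.memLp_energy_div ht).integrable_sq.mul_of_top_right hh).const_mul 2⁻¹
  rw [pathAverage, integral_prod _ hprod, ← integral_const_mul, ← integral_const_mul,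
    ← integral_const_mul, ← integral_add hslope hspeed]
  refine integral_mono_ae ((hπ.integrable_pathQuotient (hu.memLp hm) t).mul_of_top_right hh)
    (hslope.add hspeed) ?_
  obtain ⟨⟨K, hK⟩, -⟩ := hu
  filter_upwards [h0, hπ.ae_isAC2] with γ hγ hAC
  refine (mul_le_mul_of_nonneg_left (hAC.pathQuotient_le ht hK) hγ).trans_eq ?_
  simp only [integral_const_mul]
  ring

lemma integral_mul_pathQuotient_le (hm : BoundedlyFinite m) (hπ : IsTestPlan m π)
    (hh : MemLp h ∞ π) (h0 : 0 ≤ᵐ[π] h) (ht : 0 < t) (hg : MemW12 m g) :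
    ∫ γ, h γ * pathQuotient g t γ ∂π ≤ 2⁻¹ * pathAverage π h (fun x => relaxedSlope m g x ^ 2) t
      + 2⁻¹ * ∫ γ, h γ * ((energy t γ).toReal / t) ^ 2 ∂π := by
  have := hπ.isProbabilityMeasure
  obtain ⟨u, hu, hug, hslope⟩ := hg.exists_tendstoLp_rlip hm
  have hquot := ((hπ.tendstoLp_pathQuotient_of_tendstoLp ENNReal.ofNat_ne_top hug
    t).mono_exponent one_le_two).integral_mul hh
  have hsq : TendstoLp 1 m (fun n x => rlip (u n) x ^ 2) atTop
      (fun x => relaxedSlope m g x ^ 2) := by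
    simpa only [sq] using hslope.mul hslope
  exact le_of_tendsto_of_tendsto' hquot
    (((hπ.tendsto_pathAverage_of_tendstoLp hh hsq t).const_mul _).add_const _) fun n =>
    hπ.integral_mul_pathQuotient_le_of_isLipBs hm hh h0 ht (hu n)

end IsTestPlan

namespace RepresentsGradient

variable [SecondCountableTopology X]

lemma tendstoLp_speed (hm : BoundedlyFinite m) (hf : MemW12 m f) (hπ : IsTestPlan m π)
    (hπf : RepresentsGradient m π f) :
    TendstoLp 2 π (fun (t : I) γ => (energy t γ).toReal / t) (𝓝[>] 0)
      (fun γ => relaxedSlope m f (γ 0)) :=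
  ⟨fun t => ((measurable_energy t).ennreal_toReal.div_const _).aestronglyMeasurable,
    hπ.memLp_eval 0 ENNReal.ofNat_ne_top (hf.memLp_relaxedSlope hm), hπf.speed⟩

lemma tendstoLp_pathQuotient (hm : BoundedlyFinite m) (hf : MemW12 m f) (hπ : IsTestPlan m π)
    (hπf : RepresentsGradient m π f) :
    TendstoLp 1 π (pathQuotient f) (𝓝[>] 0) (fun γ => relaxedSlope m f (γ 0) ^ 2) := by
  have hspeed := hπf.tendstoLp_speed hm hf hπ
  have heval : ∀ s : I, AEStronglyMeasurable (fun γ : C(I, X) => f (γ s)) π := fun s =>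
    (hπ.memLp_eval s ENNReal.ofNat_ne_top hf.1).1
  have hquot : TendstoLp 2 π (fun (t : I) γ => (f (γ t) - f (γ 0)) / (energy t γ).toReal)
      (𝓝[>] 0) (fun γ => relaxedSlope m f (γ 0)) :=
    ⟨fun t => (((heval t).sub (heval 0)).aemeasurable.div
      (measurable_energy t).ennreal_toReal.aemeasurable).aestronglyMeasurable,
      hspeed.memLp, hπf.quotient⟩
  refine (hquot.mul (r := 1) hspeed).congr (fun t => ?_) (ae_of_all _ fun γ => (sq _).symm)
  filter_upwards [hπ.ae_isAC2] with γ hγ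
  rcases t.2.1.eq_or_lt with ht | ht
  · simp [pathQuotient, ← ht]
  by_cases hE : (energy t γ).toReal = 0
  · simp [pathQuotient, hγ.eq_of_energy_eq_zero ht hE]
  · rw [pathQuotient]
    field_simp

end RepresentsGradient

lemma integral_mul_relaxedSlope_add_inv_natCast_mul_sq (hm : BoundedlyFinite m)
    (hH : InfinitesimallyHilbertian m) (hf : MemW12 m f) (hg : MemW12 m g)
    (hπ : IsTestPlan m π) (hh : MemLp h ∞ π) {k : ℕ} (hk : k ≠ 0) :
    ∫ γ, h γ * relaxedSlope m (f + fun x => (k : ℝ)⁻¹ * g x) (γ 0) ^ 2 ∂π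
      = ∫ γ, h γ * relaxedSlope m f (γ 0) ^ 2 ∂π
        + 2 * (k : ℝ)⁻¹ * ∫ γ, h γ * gradInner m g f (γ 0) ∂π
        + (k : ℝ)⁻¹ ^ 2 * ∫ γ, h γ * relaxedSlope m g (γ 0) ^ 2 ∂π := by
  have hint : ∀ {w : X → ℝ}, Integrable w m → Integrable (fun γ => h γ * w (γ 0)) π := fun hw =>
    (hπ.integrable_eval 0 hw).mul_of_top_right hh
  have hff := hint (hf.memLp_relaxedSlope hm).integrable_sq
  have hgf := (hint (integrable_gradInner hm hf hg)).const_mul (2 * (k : ℝ)⁻¹)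
  have hgg := (hint (hg.memLp_relaxedSlope hm).integrable_sq).const_mul ((k : ℝ)⁻¹ ^ 2)
  rw [← integral_const_mul, ← integral_const_mul, ← integral_add' hff hgf,
    ← integral_add' (hff.add hgf) hgg]
  refine integral_congr_ae ?_
  filter_upwards [hπ.ae_eval 0 (relaxedSlope_add_inv_natCast_mul_sq hm hH hf hg hk)] with γ hγ
  simp only [Pi.add_apply, hγ]
  ring

variable [SecondCountableTopology X]

namespace RepresentsGradient

lemma eventually_integral_mul_pathQuotient_lt_of_natCast (hm : BoundedlyFinite m)
    (hH : InfinitesimallyHilbertian m) (hf : MemW12 m f) (hg : MemW12 m g) (hπ : IsTestPlan m π)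
    (hπf : RepresentsGradient m π f) (hh : MemLp h ∞ π) (h0 : 0 ≤ᵐ[π] h) {k : ℕ} (hk : k ≠ 0)
    {b : ℝ} (hb : ∫ γ, h γ * gradInner m g f (γ 0) ∂π
      + 2⁻¹ * (k : ℝ)⁻¹ * ∫ γ, h γ * relaxedSlope m g (γ 0) ^ 2 ∂π < b) :
    ∀ᶠ t : I in 𝓝[>] 0, ∫ γ, h γ * pathQuotient g t γ ∂π < b := by
  have hc : (0 : ℝ) < (k : ℝ)⁻¹ := by positivity
  set c : ℝ := (k : ℝ)⁻¹
  set G : X → ℝ := f + fun x => c * g x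
  have hG : MemW12 m G := hf.add hm (hg.const_mul hm c)
  have hspeed := hπf.tendstoLp_speed hm hf hπ
  have hlim := (((hπ.tendsto_pathAverage hm hh (hG.memLp_relaxedSlope hm).integrable_sq).const_mul
    2⁻¹).add (((hspeed.mul (r := 1) hspeed).integral_mul hh).const_mul 2⁻¹)).sub
    ((hπf.tendstoLp_pathQuotient hm hf hπ).integral_mul hh)
  simp only [← sq] at hlim
  rw [integral_mul_relaxedSlope_add_inv_natCast_mul_sq hm hH hf hg hπ hh hk] at hlim
  have hlt := mul_lt_mul_of_pos_left hb hc
  filter_upwards [hlim.eventually_lt_const (u := c * b) (by linarith), self_mem_nhdsWithin]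
    with t hrhs ht
  have hle := hπ.integral_mul_pathQuotient_le hm hh h0 ht hG
  have hint : ∀ {v : X → ℝ}, MemW12 m v → Integrable (fun γ => h γ * pathQuotient v t γ) π :=
    fun hv => (hπ.integrable_pathQuotient hv.1 t).mul_of_top_right hh
  have hsplit : ∫ γ, h γ * pathQuotient G t γ ∂π
      = ∫ γ, h γ * pathQuotient f t γ ∂π + c * ∫ γ, h γ * pathQuotient g t γ ∂π := by
    rw [← integral_const_mul, ← integral_add (hint hf) ((hint hg).const_mul c)]
    refine integral_congr_ae (ae_of_all _ fun γ => ?_)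
    simp only [G, pathQuotient_add_const_mul]
    ring
  refine lt_of_mul_lt_mul_left ?_ hc.le
  linarith

lemma eventually_integral_mul_pathQuotient_lt (hm : BoundedlyFinite m)
    (hH : InfinitesimallyHilbertian m) (hf : MemW12 m f) (hg : MemW12 m g) (hπ : IsTestPlan m π)
    (hπf : RepresentsGradient m π f) (hh : MemLp h ∞ π) (h0 : 0 ≤ᵐ[π] h) {b : ℝ}
    (hb : ∫ γ, h γ * gradInner m g f (γ 0) ∂π < b) :
    ∀ᶠ t : I in 𝓝[>] 0, ∫ γ, h γ * pathQuotient g t γ ∂π < b := by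
  have hlim := ((tendsto_inv_atTop_nhds_zero_nat (𝕜 := ℝ)).const_mul 2⁻¹).mul_const
    (∫ γ, h γ * relaxedSlope m g (γ 0) ^ 2 ∂π)
  have hlim' := hlim.const_add (∫ γ, h γ * gradInner m g f (γ 0) ∂π)
  rw [mul_zero, zero_mul, add_zero] at hlim'
  obtain ⟨k, hkb, hk⟩ := ((hlim'.eventually_lt_const hb).and (eventually_ne_atTop 0)).exists
  exact hπf.eventually_integral_mul_pathQuotient_lt_of_natCast hm hH hf hg hπ hh h0 hk hkb

lemma tendsto_integral_mul_pathQuotient_of_nonneg (hm : BoundedlyFinite m)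
    (hH : InfinitesimallyHilbertian m) (hf : MemW12 m f) (hg : MemW12 m g) (hπ : IsTestPlan m π)
    (hπf : RepresentsGradient m π f) (hh : MemLp h ∞ π) (h0 : 0 ≤ᵐ[π] h) :
    Tendsto (fun t : I => ∫ γ, h γ * pathQuotient g t γ ∂π) (𝓝[>] 0)
      (𝓝 (∫ γ, h γ * gradInner m g f (γ 0) ∂π)) := by
  refine tendsto_order.2 ⟨fun a ha => ?_, fun b hb =>
    hπf.eventually_integral_mul_pathQuotient_lt hm hH hf hg hπ hh h0 hb⟩
  have hneg : ∫ γ, h γ * gradInner m (-g) f (γ 0) ∂π = -∫ γ, h γ * gradInner m g f (γ 0) ∂π := by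
    rw [← integral_neg]
    refine integral_congr_ae ?_
    filter_upwards [hπ.ae_eval 0 (gradInner_neg_left hm hH hf hg)] with γ hγ
    rw [hγ, Pi.neg_apply, mul_neg]
  filter_upwards [hπf.eventually_integral_mul_pathQuotient_lt hm hH hf (hg.neg hm) hπ hh h0
    (hneg.trans_lt (neg_lt_neg ha))] with t ht
  simp only [pathQuotient_neg, mul_neg, integral_neg] at ht
  exact neg_lt_neg_iff.1 ht

lemma tendsto_integral_mul_pathQuotient (hm : BoundedlyFinite m)
    (hH : InfinitesimallyHilbertian m) (hf : MemW12 m f) (hg : MemW12 m g) (hπ : IsTestPlan m π)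
    (hπf : RepresentsGradient m π f) (hh : MemLp h ∞ π) :
    Tendsto (fun t : I => ∫ γ, h γ * pathQuotient g t γ ∂π) (𝓝[>] 0)
      (𝓝 (∫ γ, h γ * gradInner m g f (γ 0) ∂π)) := by
  have hpos : MemLp (fun γ => max (h γ) 0) ∞ π := hh.pos_part
  have hneg : MemLp (fun γ => max (-h γ) 0) ∞ π := hh.neg_part
  have hsplit : ∀ {F : C(I, X) → ℝ}, Integrable F π → ∫ γ, h γ * F γ ∂π
      = ∫ γ, max (h γ) 0 * F γ ∂π - ∫ γ, max (-h γ) 0 * F γ ∂π := fun {F} hF => by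
    have hposF : Integrable (fun γ => max (h γ) 0 * F γ) π := hF.mul_of_top_right hpos
    have hnegF : Integrable (fun γ => max (-h γ) 0 * F γ) π := hF.mul_of_top_right hneg
    simp only [← integral_sub hposF hnegF, ← sub_mul, max_zero_sub_max_neg_zero_eq_self]
  rw [hsplit (hπ.integrable_eval 0 (integrable_gradInner hm hf hg))]
  simp only [fun t => hsplit (hπ.integrable_pathQuotient hg.1 t)]
  exact (hπf.tendsto_integral_mul_pathQuotient_of_nonneg hm hH hf hg hπ hpos
      (ae_of_all _ fun γ => le_max_right _ _)).sub
    (hπf.tendsto_integral_mul_pathQuotient_of_nonneg hm hH hf hg hπ hneg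
      (ae_of_all _ fun γ => le_max_right _ _))

end RepresentsGradient

end TestPlanDerivative

end MetricSobolev

theorem mainTheorem4_general {X : Type*} [MetricSpace X]
    [TopologicalSpace.SeparableSpace X] [MeasurableSpace X] [BorelSpace X]
    [MeasurableSpace C(unitInterval, X)] [BorelSpace C(unitInterval, X)]
    (m : MeasureTheory.Measure X) (hm : MetricSobolev.BoundedlyFinite m)
    (hH : MetricSobolev.InfinitesimallyHilbertian m)
    (f : X → ℝ) (hf : MetricSobolev.MemW12 m f)
    (π : MeasureTheory.Measure C(unitInterval, X)) (hπ : MetricSobolev.IsTestPlan m π)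
    (hπf : MetricSobolev.RepresentsGradient m π f)
    (g : X → ℝ) (hg : MetricSobolev.MemW12 m g) :
    MetricSobolev.WeakTendstoL1 π
      (fun (t : unitInterval) (γ : C(unitInterval, X)) => (g (γ t) - g (γ 0)) / (t : ℝ))
      (nhdsWithin 0 (Set.Ioi 0))
      (fun γ => MetricSobolev.gradInner m g f (γ 0)) := by
  have : SecondCountableTopology X := UniformSpace.secondCountable_of_separable X
  exact ⟨hπ.integrable_pathQuotient hg.1,
    hπ.integrable_eval 0 (MetricSobolev.integrable_gradInner hm hf hg),
    fun h hh => hπf.tendsto_integral_mul_pathQuotient hm hH hf hg hπ hh⟩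

theorem mainTheorem4 {X : Type*} [MetricSpace X] [CompleteSpace X]
    [TopologicalSpace.SeparableSpace X] [MeasurableSpace X] [BorelSpace X]
    [MeasurableSpace C(unitInterval, X)] [BorelSpace C(unitInterval, X)]
    (m : MeasureTheory.Measure X) (hm : MetricSobolev.BoundedlyFinite m)
    (hH : MetricSobolev.InfinitesimallyHilbertian m)
    (f : X → ℝ) (hf : MetricSobolev.MemW12 m f)
    (π : MeasureTheory.Measure C(unitInterval, X)) (hπ : MetricSobolev.IsTestPlan m π)
    (hπf : MetricSobolev.RepresentsGradient m π f)
    (g : X → ℝ) (hg : MetricSobolev.MemW12 m g) :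
    MetricSobolev.WeakTendstoL1 π
      (fun (t : unitInterval) (γ : C(unitInterval, X)) => (g (γ t) - g (γ 0)) / (t : ℝ))
      (nhdsWithin 0 (Set.Ioi 0))
      (fun γ => MetricSobolev.gradInner m g f (γ 0)) :=
  mainTheorem4_general m hm hH f hf π hπ hπf g hg
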